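/- Let $\nu,T>0$, $\mathbb T^3=\mathbb R^3/\mathbb Z^3$, and write $\|\cdot\|,\langle\cdot,\cdot\rangle$ for the norm and inner product of $L^2(\mathbb T^3)$. Let $H$ and $V$ be the closures in $L^2(\mathbb T^3)$ and $H^1(\mathbb T^3)$ of the smooth, divergence-free, zero-mean vector fields. A Leray–Hopf solution with initial velocity $u_0\in H$ is a $u\in L^\infty(0,T;H)\cap L^2(0,T;V)$, weakly continuous from $[0,T]$ to $H$, with $u(0)=u_0$, $$-\int_0^T\langle u,\partial_t\varphi\rangle\,dt+\int_0^T\langle (u\cdot\nabla)u,\varphi\rangle\,dt+\nu\int_0^T\langle\nabla u,\nabla\varphi\rangle\,dt=\langle u_0,\varphi(0)\rangle$$ for all divergence-free $\varphi\in C_c^\infty(\mathbb T^3\times[0,T))$, and $\tfrac12\|u(t)\|^2+\nu\int_0^t\|\nabla u\|^2ds\le\tfrac12\|u_0\|^2$ for all $t\in[0,T]$. Let $\eta\ge 0$ be a smooth, radial, compactly supported function on $\mathbb R^3$ of unit mass, let $\delta_n>0$, $\delta_n\to0$, and let $\overline f^{\,n}=\eta^n*f$ (convolution in $x$) with $\eta^n(y)=\delta_n^{-3}\eta(y/\delta_n)$.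 **Theorem 1.** Let $u$ be any Leray–Hopf solution, put $\overline R^{\,n}=\overline{(u\otimes u)}^{\,n}-\overline u^{\,n}\otimes\overline u^{\,n}$ and $J^n=\nu\nabla\overline u^{\,n}-\overline R^{\,n}$. Let $b\in L^2(\mathbb T^3;\mathbb R^3)$ be non-zero (for instance $b=u_0$, if $u_0\ne0$) and let $\mathcal B=\{v\in L^2(0,T;V):\int_0^T\|\nabla v\|^2dt\le\tfrac12\|b\|^2\}$. Then for every $n$ the functional $$\mathcal K^n(v)=\int_0^T\Big(\tfrac12\|\nabla v(t)\|^2-\langle J^n(t),\nabla v(t)\rangle\Big)dt$$ has a unique minimizer $v^n_*$ over $\mathcal B$, and a subsequence of $(v^n_*)$ converges weakly in $L^2(0,T;V)$. Moreover, if some subsequence converges weakly in $L^2(0,T;V)$ to a limit $v_*\neq0$, then the following hold. 1. There is exactly one pressure $p\in L^1(0,T;L^1(\mathbb T^3))$ with, for almost every $t\in(0,T)$, $\int_{\mathbb T^3}p\,dx=0$ and $-\Delta p=\sum_{i,j}\partial_i\partial_j(u_iu_j)$ in the sense of distributions. The field $(|u|^2+2p)u$ is integrable on $\mathbb T^3\times(0,T)$,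 and the local energy equality $$\partial_t\Big(\frac{|u|^2}2\Big)+\nabla\cdot\Big(u\Big(\frac{|u|^2}2+p\Big)-\nu\nabla\frac{|u|^2}2\Big)=-\nu|\nabla u|^2$$ holds in the sense of distributions on $\mathbb T^3\times[0,T)$, that is, for all real $\phi\in C_c^\infty(\mathbb T^3\times[0,T))$, $$2\nu\int_0^T\!\!\int_{\mathbb T^3}|\nabla u|^2\phi\,dx\,dt=\int_0^T\!\!\int_{\mathbb T^3}|u|^2(\partial_t\phi+\nu\Delta\phi)\,dx\,dt+\int_0^T\!\!\int_{\mathbb T^3}(|u|^2+2p)\,u\cdot\nabla\phi\,dx\,dt+\int_{\mathbb T^3}|u_0|^2\phi(\cdot,0)\,dx .$$ 2. The global energy equality $\tfrac12\|u(t)\|^2+\nu\int_0^t\|\nabla u\|^2ds=\tfrac12\|u_0\|^2$ holds for all $t\in[0,T]$. -/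

import Mathlib

open MeasureTheory Set Filter Topology
open scoped ENNReal ContDiff

noncomputable section

namespace TorusNS

/-! ### The torus and its smooth functions -/

/-- The three-dimensional flat torus `ℝ³ / ℤ³`, with its normalised Haar measure `volume`. -/
abbrev T3 : Type := UnitAddTorus (Fin 3)

/-- Vectors in `ℝ³` with the Euclidean norm. -/
abbrev Vec : Type := EuclideanSpace ℝ (Fin 3)

/-- Real `3 × 3` matrices with the Frobenius inner product. -/
abbrev Mat : Type := EuclideanSpace ℝ (Fin 3 × Fin 3)

/-- The quotient map `ℝ³ → ℝ³ / ℤ³`. -/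
def toTorus (y : Vec) : T3 := fun i => ((y i : ℝ) : UnitAddCircle)

/-- The partial derivative `∂ⱼ f` of a function on the torus. -/
def pderiv {F : Type*} [NormedAddCommGroup F] [NormedSpace ℝ F] (j : Fin 3) (f : T3 → F)
    (x : T3) : F :=
  deriv (fun s : ℝ => f (x + Pi.single j (s : UnitAddCircle))) 0

/-- The gradient of a vector field, `(∇ f)ᵢⱼ = ∂ⱼ fᵢ`. -/
def gradV (f : T3 → Vec) (x : T3) : Mat :=
  WithLp.toLp 2 fun ij : Fin 3 × Fin 3 => pderiv ij.2 (fun z => f z ij.1) x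

/-- The gradient of a scalar function. -/
def gradS (f : T3 → ℝ) (x : T3) : Vec := WithLp.toLp 2 fun j => pderiv j f x

/-- The divergence of a vector field. -/
def divV (f : T3 → Vec) (x : T3) : ℝ := ∑ j, pderiv j (fun z => f z j) x

/-- The Laplacian of a scalar function. -/
def lapS (f : T3 → ℝ) (x : T3) : ℝ := ∑ j, pderiv j (pderiv j f) x

/-- The tensor product `(a ⊗ b)ᵢⱼ = aᵢ bⱼ`. -/
def tensor (a b : Vec) : Mat := WithLp.toLp 2 fun ij : Fin 3 × Fin 3 => a ij.1 * b ij.2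

/-- `f ∈ C^∞(𝕋³)`: the periodic function on `ℝ³` that `f` induces is smooth. -/
def SmoothT {F : Type*} [NormedAddCommGroup F] [NormedSpace ℝ F] (f : T3 → F) : Prop :=
  ContDiff ℝ ∞ fun y : Vec => f (toTorus y)

/-- `φ ∈ C^∞_c(𝕋³ × [0, T))`: smooth up to and including the time `0`, where nothing is required
to vanish, and zero for all times close to `T`. -/
def IsTest {F : Type*} [NormedAddCommGroup F] [NormedSpace ℝ F] (T : ℝ) (φ : ℝ → T3 → F) : Prop :=
  (ContDiff ℝ ∞ fun z : ℝ × Vec => φ z.1 (toTorus z.2)) ∧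
    ∃ T' < T, ∀ t, T' ≤ t → ∀ x, φ t x = 0

/-! ### Function spaces -/

/-- `L²(𝕋³; ℝ³)`. -/
abbrev L2Vec : Type := Lp Vec 2 (volume : Measure T3)

/-- `L²(𝕋³; ℝ^{3×3})`. -/
abbrev L2Mat : Type := Lp Mat 2 (volume : Measure T3)

/-- Smooth, divergence free vector fields of zero mean on the torus. -/
def IsSolenoidal (φ : T3 → Vec) : Prop :=
  SmoothT φ ∧ (∀ x, divV φ x = 0) ∧ ∫ x, φ x = 0

/-- The space `H`: the closure in `L²` of the smooth, divergence free, zero mean fields. (These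
fields form a linear subspace, so that the span adds nothing.) -/
def H : Submodule ℝ L2Vec :=
  (Submodule.span ℝ {f : L2Vec | ∃ φ, IsSolenoidal φ ∧ f =ᵐ[volume] φ}).topologicalClosure

/-- The space `V`: the closure in `H¹` of the smooth, divergence free, zero mean fields. A field
`v ∈ H¹` is recorded as the pair `(v, ∇v) ∈ L² × L²`, whose Hilbert norm is the `H¹` norm
`(‖v‖² + ‖∇v‖²)^{1/2}`. -/
def V : Submodule ℝ (WithLp 2 (L2Vec × L2Mat)) :=
  (Submodule.span ℝ {w : WithLp 2 (L2Vec × L2Mat) |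
    ∃ φ, IsSolenoidal φ ∧ w.fst =ᵐ[volume] φ ∧ w.snd =ᵐ[volume] gradV φ}).topologicalClosure

/-- The field `v ∈ L²` underlying an element of `V`. -/
def V.val (v : V) : L2Vec := (v : WithLp 2 (L2Vec × L2Mat)).fst

/-- The gradient `∇v ∈ L²` of an element of `V`. -/
def V.grad (v : V) : L2Mat := (v : WithLp 2 (L2Vec × L2Mat)).snd

/-- Lebesgue measure on the time interval `(0, T)`. -/
abbrev timeMeasure (T : ℝ) : Measure ℝ := volume.restrict (Ioo 0 T)

/-- The Bochner space `L²(0, T; V)`. -/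
abbrev L2V (T : ℝ) : Type := Lp V 2 (timeMeasure T)

/-- Weak convergence in a real normed space. -/
def WeakConv {X : Type*} [NormedAddCommGroup X] [NormedSpace ℝ X] (v : ℕ → X) (w : X) : Prop :=
  ∀ ℓ : X →L[ℝ] ℝ, Tendsto (fun n => ℓ (v n)) atTop (𝓝 (ℓ w))

/-! ### Leray–Hopf solutions -/

/-- Weak solutions on `𝕋³ × [0, T]` with viscosity `ν` and initial velocity `u₀`. As usual, the
class `u ∈ L^∞(0, T; H) ∩ L²(0, T; V)` is represented by its weakly continuous representative
`u : [0, T] → H`, so that `u t` is meaningful for every `t`. The field `U` is `u` itself as an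
element of `L²(0, T; V)`; it gives access to `∇u`. -/
structure IsWeakSolution (ν T : ℝ) (u₀ : L2Vec) (u : ℝ → L2Vec) (U : L2V T) : Prop where
  mem_H : ∀ t ∈ Icc 0 T, u t ∈ H
  bounded : MemLp u ∞ (timeMeasure T)
  val_eq : ∀ᵐ t ∂timeMeasure T, V.val (U t) = u t
  weak_continuous : ∀ w : L2Vec, ContinuousOn (fun t => inner ℝ (u t) w) (Icc 0 T)
  initial : u 0 = u₀
  equation : ∀ φ : ℝ → T3 → Vec, IsTest T φ → (∀ t x, divV (φ t) x = 0) →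
    -(∫ t in Ioo 0 T, ∫ x, inner ℝ (u t x) (deriv (fun s => φ s x) t))
      + (∫ t in Ioo 0 T, ∫ x, ∑ i, ∑ j, u t x j * V.grad (U t) x (i, j) * φ t x i)
      + ν * (∫ t in Ioo 0 T, ∫ x, inner ℝ (V.grad (U t) x) (gradV (φ t) x))
      = ∫ x, inner ℝ (u₀ x) (φ 0 x)

/-- Leray–Hopf solutions: weak solutions that satisfy the global energy inequality. -/
structure IsLerayHopf (ν T : ℝ) (u₀ : L2Vec) (u : ℝ → L2Vec) (U : L2V T) : Prop
    extends IsWeakSolution ν T u₀ u U where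
  energy_le : ∀ t ∈ Icc 0 T,
    1 / 2 * ‖u t‖ ^ 2 + ν * (∫ s in Ioo 0 t, ‖V.grad (U s)‖ ^ 2) ≤ 1 / 2 * ‖u₀‖ ^ 2

/-! ### Mollification and the minimization problem -/

/-- Standard mollification kernels on `ℝ³`. -/
structure IsKernel (η : Vec → ℝ) : Prop where
  smooth : ContDiff ℝ ∞ η
  compact : HasCompactSupport η
  nonneg : ∀ y, 0 ≤ η y
  radial : ∀ y z, ‖y‖ = ‖z‖ → η y = η z
  mass : ∫ y, η y = 1

/-- The convolution `η_δ * f` in space, where `η_δ(y) = δ⁻³ η(y / δ)`. -/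
def moll {F : Type*} [NormedAddCommGroup F] [NormedSpace ℝ F] (η : Vec → ℝ) (δ : ℝ) (f : T3 → F)
    (x : T3) : F :=
  ∫ y : Vec, ((δ ^ 3)⁻¹ * η (δ⁻¹ • y)) • f (x - toTorus y)

/-- The cumulant (Reynolds stress) `η_δ * (f ⊗ f) - (η_δ * f) ⊗ (η_δ * f)`. -/
def cumulant (η : Vec → ℝ) (δ : ℝ) (f : T3 → Vec) (x : T3) : Mat :=
  moll η δ (fun z => tensor (f z) (f z)) x - tensor (moll η δ f x) (moll η δ f x)

/-- The flux `J = ν ∇(η_δ * f) - R`, with `R` the cumulant of `f`. -/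
def flux (ν : ℝ) (η : Vec → ℝ) (δ : ℝ) (f : T3 → Vec) (x : T3) : Mat :=
  ν • gradV (moll η δ f) x - cumulant η δ f x

/-- The functional `v ↦ ∫₀ᵀ (½ ‖∇v‖² - ⟨J, ∇v⟩) dt` on `L²(0, T; V)`. -/
def onsagerK (T : ℝ) (J : ℝ → T3 → Mat) (v : L2V T) : ℝ :=
  ∫ t in Ioo 0 T, (1 / 2 * ‖V.grad (v t)‖ ^ 2 - ∫ x, inner ℝ (J t x) (V.grad (v t) x))

/-- The enstrophy ball `{v ∈ L²(0, T; V) : ∫₀ᵀ ‖∇v‖² dt ≤ ½ ‖b‖²}`. -/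
def enstrophyBall (T : ℝ) (b : L2Vec) : Set (L2V T) :=
  {v | ∫ t in Ioo 0 T, ‖V.grad (v t)‖ ^ 2 ≤ 1 / 2 * ‖b‖ ^ 2}

/-- `v` solves the minimization problem for `J` over the enstrophy ball. -/
def IsMinimizer (T : ℝ) (b : L2Vec) (J : ℝ → T3 → Mat) (v : L2V T) : Prop :=
  v ∈ enstrophyBall T b ∧ IsMinOn (onsagerK T J) (enstrophyBall T b) v

/-! ### Energy equalities -/

/-- `p` is the pressure of the velocity `u`: it has zero mean and solves
`-Δp = ∑ᵢⱼ ∂ᵢ∂ⱼ(uᵢ uⱼ)` in the sense of distributions on the torus, at almost every time. Mere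
integrability of `p` is asked; these equations determine `p`. -/
def IsPressure (T : ℝ) (u : ℝ → L2Vec) (p : Lp (Lp ℝ 1 (volume : Measure T3)) 1 (timeMeasure T)) :
    Prop :=
  ∀ᵐ t ∂timeMeasure T, (∫ x, p t x) = 0 ∧
    ∀ ψ : T3 → ℝ, SmoothT ψ →
      -(∫ x, p t x * lapS ψ x)
        = ∫ x, ∑ i, ∑ j, u t x i * u t x j * pderiv i (pderiv j ψ) x

/-- The local energy equality
`∂ₜ(|u|²/2) + ∇·(u (|u|²/2 + p) - ν ∇(|u|²/2)) = -ν |∇u|²`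
in the sense of distributions on `𝕋³ × [0, T)`, multiplied by `2`. The transport flux is
integrable over `𝕋³ × (0, T)`, and the test functions need not vanish at the time `0`, whence the
term with the initial velocity. -/
def LocalEnergyEq (ν T : ℝ) (u₀ : L2Vec) (u : ℝ → L2Vec) (U : L2V T)
    (p : Lp (Lp ℝ 1 (volume : Measure T3)) 1 (timeMeasure T)) : Prop :=
  (∀ᵐ t ∂timeMeasure T, Integrable fun x => (‖u t x‖ ^ 2 + 2 * p t x) • u t x) ∧
  Integrable (fun t => ∫ x, ‖(‖u t x‖ ^ 2 + 2 * p t x) • u t x‖) (timeMeasure T) ∧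
  ∀ φ : ℝ → T3 → ℝ, IsTest T φ →
    2 * ν * (∫ t in Ioo 0 T, ∫ x, ‖V.grad (U t) x‖ ^ 2 * φ t x)
      = (∫ t in Ioo 0 T, ∫ x, ‖u t x‖ ^ 2 * (deriv (fun s => φ s x) t + ν * lapS (φ t) x))
        + (∫ t in Ioo 0 T, ∫ x,
            (‖u t x‖ ^ 2 + 2 * p t x) * inner ℝ (u t x) (gradS (φ t) x))
        + ∫ x, ‖u₀ x‖ ^ 2 * φ 0 x

/-- The global energy equality at every time of `[0, T]`. -/
def GlobalEnergyEq (ν T : ℝ) (u₀ : L2Vec) (u : ℝ → L2Vec) (U : L2V T) : Prop :=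
  ∀ t ∈ Icc 0 T,
    1 / 2 * ‖u t‖ ^ 2 + ν * (∫ s in Ioo 0 t, ‖V.grad (U s)‖ ^ 2) = 1 / 2 * ‖u₀‖ ^ 2

end TorusNS

end

open TorusNS

/-!
Write `w` for the mollified velocity `η_δ * u` and `g` for the potential of its flux `J`: the
field of `V` whose gradient is the orthogonal projection of `J` onto the gradients of solenoidal
fields.

*The minimizer.* Completing the square turns the functional into `½ ‖∇(v - g)‖²` up to a constant,
so that the unique minimizer over the enstrophy ball is `g` itself if it lies in the ball, and `g`
scaled back to the sphere otherwise (`isMinimizer_iff`). The minimizers are bounded, whence the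
weakly convergent subsequence (`exists_weakConv_subseq`).

*What a weak limit `v' ≠ 0` gives.* Tested against a field that is bounded in time, the flux
converges to `ν ∇u`, as `V` embeds in `L⁴` and the Reynolds stress therefore tends to zero in `L²`
at almost every time (`tendsto_inner_potential_of_bounded`). If the scaling factors tended to zero
along a subsequence, the weak limit would vanish against all such fields, which are dense. So
`v' ≠ 0` bounds the scaling factors from below, hence bounds the fields `∇g` in `L²(0, T; L²)`
(`eventually_norm_potential_le`); being bounded they converge weakly to `ν ∇u`
(`tendsto_inner_potential`).

*The energy balance.* The mollified velocity is absolutely continuous in time with values in `L²`,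
and `⟨∂ₜw, h⟩ = ⟨w ⊗ w, ∇h⟩ + ⟨Π(w ⊗ w), ∇·h⟩ - ⟨∇g, ∇h⟩` for *every* `h ∈ H¹`, where `Π` is the
pressure operator (`inner_force`). Indeed both sides agree on `V` by the definition of `g`, on
gradients by the definition of `Π`, and on constants; Fourier modes show that these fields span
`H¹`. Taking `h = φ w` gives the energy balance of `w` localised by `φ`
(`IsWeakSolution.mollified_energy`), in which the only trace of the Reynolds stress is the term
`∫ ⟨∇g, ∇(φ w)⟩`. It pairs a weakly with a strongly convergent sequence; all other terms are
dominated by `‖u‖²` in `V`, which is integrable in time. The limit is the energy balance of `u`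
without defect (`IsWeakSolution.local_energy`). The choice `φ = 1` gives the global energy
equality, a test function that vanishes near the time `T` the local one. The pressure of `u` is
`Π(u ⊗ u)`; it is unique, even among integrable functions, since the Laplacians of the Fourier
modes determine a mean zero function.
-/

noncomputable section

namespace TorusNS

/-! ### Calculus on the torus -/

section Calculus

variable {E F G : Type*} [NormedAddCommGroup E] [NormedSpace ℝ E] [NormedAddCommGroup F]
  [NormedSpace ℝ F] [NormedAddCommGroup G] [NormedSpace ℝ G]

lemma isOpenQuotientMap_toTorus : IsOpenQuotientMap toTorus := by
  have h1 : IsOpenQuotientMap (fun (y : Fin 3 → ℝ) (i : Fin 3) => (y i : UnitAddCircle)) :=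
    IsOpenQuotientMap.piMap fun _ => QuotientAddGroup.isOpenQuotientMap_mk
  exact h1.comp (PiLp.homeomorph 2 (fun _ : Fin 3 => ℝ)).isOpenQuotientMap

lemma continuous_toTorus : Continuous toTorus := isOpenQuotientMap_toTorus.continuous

lemma toTorus_surjective : Function.Surjective toTorus := isOpenQuotientMap_toTorus.surjective

lemma toTorus_add (y z : Vec) : toTorus (y + z) = toTorus y + toTorus z := by
  ext i; simp [toTorus]

lemma toTorus_sub (y z : Vec) : toTorus (y - z) = toTorus y - toTorus z := by
  ext i; simp [toTorus]

lemma toTorus_neg (y : Vec) : toTorus (-y) = -toTorus y := by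
  ext i; simp [toTorus]

lemma toTorus_zero : toTorus 0 = 0 := by
  ext i; simp [toTorus]

lemma toTorus_single (j : Fin 3) (s : ℝ) :
    toTorus (s • EuclideanSpace.single j 1) = Pi.single j (s : UnitAddCircle) := by
  ext i
  by_cases h : i = j
  · subst h; simp [toTorus]
  · simp [toTorus, h]

lemma SmoothT.continuous {f : T3 → F} (hf : SmoothT f) : Continuous f :=
  isOpenQuotientMap_toTorus.isQuotientMap.continuous_iff.2 (ContDiff.continuous hf)

lemma SmoothT.differentiable {f : T3 → F} (hf : SmoothT f) :
    Differentiable ℝ fun y : Vec => f (toTorus y) :=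
  ContDiff.differentiable hf (by simp)

/-- The chain rule for a smooth periodic function along a straight line. -/
lemma SmoothT.hasDerivAt_line {f : T3 → F} (hf : SmoothT f) (x y : Vec) (s : ℝ) :
    HasDerivAt (fun s : ℝ => f (toTorus (x + s • y)))
      (fderiv ℝ (fun y : Vec => f (toTorus y)) (x + s • y) y) s := by
  have h2 : HasDerivAt (fun s : ℝ => x + s • y) y s := by
    simpa using ((hasDerivAt_id s).smul_const y).const_add x
  exact (hf.differentiable (x + s • y)).hasFDerivAt.comp_hasDerivAt s h2

lemma pderiv_toTorus {f : T3 → F} (hf : SmoothT f) (j : Fin 3) (y : Vec) :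
    pderiv j f (toTorus y)
      = fderiv ℝ (fun y : Vec => f (toTorus y)) y (EuclideanSpace.single j 1) := by
  have := (hf.hasDerivAt_line y (EuclideanSpace.single j 1) 0).deriv
  simp only [toTorus_add, toTorus_single, zero_smul, add_zero] at this
  exact this

lemma SmoothT.hasDerivAt {f : T3 → F} (hf : SmoothT f) (j : Fin 3) (x : T3) (s : ℝ) :
    HasDerivAt (fun s : ℝ => f (x + Pi.single j (s : UnitAddCircle)))
      (pderiv j f (x + Pi.single j (s : UnitAddCircle))) s := by
  obtain ⟨y, rfl⟩ := toTorus_surjective x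
  have := hf.hasDerivAt_line y (EuclideanSpace.single j 1) s
  rw [← pderiv_toTorus hf] at this
  simpa only [toTorus_add, toTorus_single] using this

lemma SmoothT.hasDerivAt_zero {f : T3 → F} (hf : SmoothT f) (j : Fin 3) (x : T3) :
    HasDerivAt (fun s : ℝ => f (x + Pi.single j (s : UnitAddCircle))) (pderiv j f x) 0 := by
  have := hf.hasDerivAt j x 0
  have h0 : Pi.single j (((0 : ℝ) : UnitAddCircle)) = (0 : T3) := by simp
  rwa [h0, add_zero] at this

/-- The directional derivative in terms of the partial derivatives. -/
lemma SmoothT.fderiv_apply {f : T3 → F} (hf : SmoothT f) (x y : Vec) :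
    fderiv ℝ (fun y : Vec => f (toTorus y)) x y = ∑ j, y j • pderiv j f (toTorus x) := by
  conv_lhs => rw [← (EuclideanSpace.basisFun (Fin 3) ℝ).sum_repr y]
  simp [map_sum, pderiv_toTorus hf]

lemma SmoothT.pderiv {f : T3 → F} (hf : SmoothT f) (j : Fin 3) : SmoothT (pderiv j f) := by
  unfold SmoothT
  simp_rw [pderiv_toTorus hf]
  exact (ContDiff.fderiv_right hf (m := ∞) (by simp)).clm_apply contDiff_const

lemma smoothT_const (c : F) : SmoothT fun _ => c := contDiff_const

lemma SmoothT.add {f g : T3 → F} (hf : SmoothT f) (hg : SmoothT g) :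
    SmoothT fun x => f x + g x := ContDiff.add hf hg

lemma SmoothT.sum {ι : Type*} {s : Finset ι} {f : ι → T3 → F} (hf : ∀ i ∈ s, SmoothT (f i)) :
    SmoothT fun x => ∑ i ∈ s, f i x :=
  ContDiff.sum hf

lemma SmoothT.clm (L : E →L[ℝ] F) {f : T3 → E} (hf : SmoothT f) : SmoothT fun x => L (f x) :=
  L.contDiff.comp hf

lemma SmoothT.bilin (B : E →L[ℝ] F →L[ℝ] G) {f : T3 → E} {g : T3 → F} (hf : SmoothT f)
    (hg : SmoothT g) : SmoothT fun x => B (f x) (g x) :=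
  ContDiff.clm_apply (B.contDiff.comp hf) hg

lemma SmoothT.const_smul (c : ℝ) {f : T3 → F} (hf : SmoothT f) : SmoothT fun x => c • f x :=
  ContDiff.const_smul c hf

lemma SmoothT.smul {f : T3 → ℝ} {g : T3 → F} (hf : SmoothT f) (hg : SmoothT g) :
    SmoothT fun x => f x • g x := ContDiff.smul hf hg

lemma SmoothT.mul {f g : T3 → ℝ} (hf : SmoothT f) (hg : SmoothT g) :
    SmoothT fun x => f x * g x := ContDiff.mul hf hg

lemma SmoothT.apply {ι : Type*} [Fintype ι] {f : T3 → EuclideanSpace ℝ ι} (hf : SmoothT f)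
    (i : ι) : SmoothT fun x => f x i :=
  hf.clm (EuclideanSpace.proj i : EuclideanSpace ℝ ι →L[ℝ] ℝ)

lemma SmoothT.toLp {ι : Type*} [Fintype ι] {f : ι → T3 → ℝ} (hf : ∀ i, SmoothT (f i)) :
    SmoothT fun x => (WithLp.toLp 2 fun i => f i x : EuclideanSpace ℝ ι) :=
  contDiff_euclidean.2 fun i => hf i

lemma SmoothT.gradV {f : T3 → Vec} (hf : SmoothT f) : SmoothT (gradV f) :=
  SmoothT.toLp fun ij => (hf.apply ij.1).pderiv ij.2

lemma SmoothT.gradS {f : T3 → ℝ} (hf : SmoothT f) : SmoothT (gradS f) :=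
  SmoothT.toLp fun j => hf.pderiv j

lemma SmoothT.lapS {f : T3 → ℝ} (hf : SmoothT f) : SmoothT (lapS f) :=
  SmoothT.sum fun j _ => (hf.pderiv j).pderiv j

lemma pderiv_const (c : F) (j : Fin 3) (x : T3) : pderiv j (fun _ => c) x = 0 := by
  simp [TorusNS.pderiv]

lemma pderiv_add {f g : T3 → F} (hf : SmoothT f) (hg : SmoothT g) (j : Fin 3) (x : T3) :
    pderiv j (fun z => f z + g z) x = pderiv j f x + pderiv j g x :=
  ((hf.hasDerivAt_zero j x).add (hg.hasDerivAt_zero j x)).deriv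

lemma pderiv_clm (L : E →L[ℝ] F) {f : T3 → E} (hf : SmoothT f) (j : Fin 3) (x : T3) :
    pderiv j (fun z => L (f z)) x = L (pderiv j f x) :=
  (L.hasFDerivAt.comp_hasDerivAt (0 : ℝ) (hf.hasDerivAt_zero j x)).deriv

lemma pderiv_bilin (B : E →L[ℝ] F →L[ℝ] G) {f : T3 → E} {g : T3 → F} (hf : SmoothT f)
    (hg : SmoothT g) (j : Fin 3) (x : T3) :
    pderiv j (fun z => B (f z) (g z)) x = B (pderiv j f x) (g x) + B (f x) (pderiv j g x) := by
  have h1 := B.hasFDerivAt.comp_hasDerivAt (0 : ℝ) (hf.hasDerivAt_zero j x)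
  have h2 := (h1.clm_apply (hg.hasDerivAt_zero j x)).deriv
  simpa [TorusNS.pderiv] using h2

lemma pderiv_smul {f : T3 → ℝ} {g : T3 → F} (hf : SmoothT f) (hg : SmoothT g) (j : Fin 3)
    (x : T3) :
    pderiv j (fun z => f z • g z) x = pderiv j f x • g x + f x • pderiv j g x :=
  pderiv_bilin (ContinuousLinearMap.lsmul ℝ ℝ) hf hg j x

lemma pderiv_mul {f g : T3 → ℝ} (hf : SmoothT f) (hg : SmoothT g) (j : Fin 3) (x : T3) :
    pderiv j (fun z => f z * g z) x = pderiv j f x * g x + f x * pderiv j g x :=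
  pderiv_smul hf hg j x

lemma pderiv_const_smul (c : ℝ) {f : T3 → F} (hf : SmoothT f) (j : Fin 3) (x : T3) :
    pderiv j (fun z => c • f z) x = c • pderiv j f x :=
  pderiv_clm (c • ContinuousLinearMap.id ℝ F) hf j x

lemma pderiv_const_mul (c : ℝ) {f : T3 → ℝ} (hf : SmoothT f) (j : Fin 3) (x : T3) :
    pderiv j (fun z => c * f z) x = c * pderiv j f x :=
  pderiv_const_smul c hf j x

lemma pderiv_apply {ι : Type*} [Fintype ι] {f : T3 → EuclideanSpace ℝ ι} (hf : SmoothT f)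
    (i : ι) (j : Fin 3) (x : T3) : pderiv j (fun z => f z i) x = pderiv j f x i :=
  pderiv_clm (EuclideanSpace.proj i : EuclideanSpace ℝ ι →L[ℝ] ℝ) hf j x

/-- Second derivatives commute. -/
lemma pderiv_comm {f : T3 → F} (hf : SmoothT f) (i j : Fin 3) (x : T3) :
    pderiv i (pderiv j f) x = pderiv j (pderiv i f) x := by
  obtain ⟨y, rfl⟩ := toTorus_surjective x
  have key : ∀ i j : Fin 3, pderiv i (pderiv j f) (toTorus y)
      = fderiv ℝ (fderiv ℝ fun y : Vec => f (toTorus y)) y (EuclideanSpace.single i 1)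
        (EuclideanSpace.single j 1) := by
    intro i j
    rw [pderiv_toTorus (hf.pderiv j)]
    simp_rw [pderiv_toTorus hf]
    have hd : DifferentiableAt ℝ (fderiv ℝ fun y : Vec => f (toTorus y)) y :=
      (ContDiff.fderiv_right hf (m := ∞) (by simp)).differentiable (by simp) y
    rw [fderiv_clm_apply hd (differentiableAt_const _)]
    simp
  rw [key, key]
  exact (ContDiffAt.isSymmSndFDerivAt (ContDiff.contDiffAt hf) (by
    simpa using (mod_cast le_top : ((2 : ℕ∞) : WithTop ℕ∞) ≤ ((⊤ : ℕ∞) : WithTop ℕ∞)))) _ _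

instance : IsProbabilityMeasure (volume : Measure UnitAddCircle) := ⟨by simp⟩

instance : Measure.IsAddHaarMeasure (volume : Measure T3) :=
  inferInstanceAs (Measure.IsAddHaarMeasure (Measure.pi fun _ => volume))

instance : IsProbabilityMeasure (volume : Measure T3) :=
  inferInstanceAs (IsProbabilityMeasure (Measure.pi fun _ => volume))

lemma integrable_of_continuous {F : Type*} [NormedAddCommGroup F] {f : T3 → F}
    (hf : Continuous f) : Integrable f :=
  hf.integrable_of_hasCompactSupport (HasCompactSupport.of_compactSpace f)

lemma SmoothT.integrable {f : T3 → F} (hf : SmoothT f) : Integrable f :=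
  integrable_of_continuous hf.continuous

lemma exists_bound_of_continuous {F : Type*} [NormedAddCommGroup F] {f : T3 → F}
    (hf : Continuous f) : ∃ C, 0 ≤ C ∧ ∀ x, ‖f x‖ ≤ C := by
  obtain ⟨C, hC⟩ := isCompact_univ.exists_bound_of_continuousOn hf.continuousOn
  exact ⟨max C 0, le_max_right _ _, fun x => (hC x (mem_univ x)).trans (le_max_left _ _)⟩

/-- A derivative has zero mean: the translates of a function all have the same integral. -/
lemma integral_pderiv {f : T3 → F} [CompleteSpace F] (hf : SmoothT f) (j : Fin 3) :
    ∫ x, pderiv j f x = 0 := by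
  obtain ⟨C, -, hC⟩ := exists_bound_of_continuous (hf.pderiv j).continuous
  let c : ℝ → T3 := fun s => Pi.single j (s : UnitAddCircle)
  have h0 : ∀ s, Continuous fun x => f (x + c s) := fun s =>
    hf.continuous.comp (continuous_add_const _)
  have h1 : ∀ s, Continuous fun x => TorusNS.pderiv j f (x + c s) := fun s =>
    (hf.pderiv j).continuous.comp (continuous_add_const _)
  have hd : HasDerivAt (fun s => ∫ x, f (x + c s)) (∫ x, TorusNS.pderiv j f (x + c 0)) 0 :=
    (hasDerivAt_integral_of_dominated_loc_of_deriv_le (μ := (volume : Measure T3))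
      (F := fun (s : ℝ) x => f (x + c s)) (F' := fun (s : ℝ) x => TorusNS.pderiv j f (x + c s))
      (bound := fun _ => C) univ_mem (Eventually.of_forall fun s => (h0 s).aestronglyMeasurable)
      (integrable_of_continuous (h0 0)) (h1 0).aestronglyMeasurable
      (Eventually.of_forall fun x s _ => hC _) (integrable_const C)
      (Eventually.of_forall fun x s _ => hf.hasDerivAt j x s)).2
  have e0 : ∀ s, ∫ x, f (x + c s) = ∫ x, f x := fun s => integral_add_right_eq_self f (c s)
  have e1 : ∫ x, TorusNS.pderiv j f (x + c 0) = ∫ x, TorusNS.pderiv j f x :=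
    integral_add_right_eq_self (TorusNS.pderiv j f) (c 0)
  rw [e1, funext e0] at hd
  exact hd.unique (hasDerivAt_const 0 _)

/-- Integration by parts. -/
lemma integral_mul_pderiv {f g : T3 → ℝ} (hf : SmoothT f) (hg : SmoothT g) (j : Fin 3) :
    ∫ x, f x * pderiv j g x = -∫ x, pderiv j f x * g x := by
  have h := integral_pderiv (hf.mul hg) j
  simp_rw [pderiv_mul hf hg] at h
  rw [integral_add ((hf.pderiv j).mul hg).integrable (hf.mul (hg.pderiv j)).integrable] at h
  linarith

end Calculus

/-! ### Sobolev and Poincaré inequalities -/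

section Sobolev

/-- The Cauchy–Schwarz inequality for continuous functions on the torus. -/
lemma sq_integral_mul_le {f g : T3 → ℝ} (hf : Continuous f) (hg : Continuous g) :
    (∫ x, f x * g x) ^ 2 ≤ (∫ x, f x ^ 2) * ∫ x, g x ^ 2 := by
  have i1 : Integrable fun x => f x ^ 2 := integrable_of_continuous (by fun_prop)
  have i2 : Integrable fun x => f x * g x := integrable_of_continuous (by fun_prop)
  have i3 : Integrable fun x => g x ^ 2 := integrable_of_continuous (by fun_prop)
  have h : ∀ t : ℝ, 0 ≤ (∫ x, f x ^ 2) * (t * t) + (2 * ∫ x, f x * g x) * t + ∫ x, g x ^ 2 := by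
    intro t
    have h0 : 0 ≤ ∫ x, (t * f x + g x) ^ 2 := integral_nonneg fun x => sq_nonneg _
    have h1 : ∫ x, (t * f x + g x) ^ 2
        = ∫ x, ((t * t) * f x ^ 2 + ((2 * t) * (f x * g x) + g x ^ 2)) := by
      congr 1; ext x; ring
    rw [h1, integral_add (i1.const_mul _) (by exact (i2.const_mul _).add i3),
      integral_add (i2.const_mul _) i3, integral_const_mul, integral_const_mul] at h0
    linarith
  have := discrim_le_zero h
  rw [discrim] at this
  linarith

/-- A function is bounded on a coordinate circle by the integral of its modulus and of the modulus
of its derivative. -/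
lemma abs_le_integral_update {w : T3 → ℝ} (hw : SmoothT w) (i : Fin 3) (x : T3) :
    |w x| ≤ ∫ s : UnitAddCircle,
      (|w (Function.update x i s)| + |pderiv i w (Function.update x i s)|) := by
  have hup : Continuous fun s : UnitAddCircle => Function.update x i s :=
    continuous_const.update i continuous_id
  have c1 : Continuous fun s : UnitAddCircle => |w (Function.update x i s)| :=
    (hw.continuous.comp hup).abs
  have c2 : Continuous fun s : UnitAddCircle => |pderiv i w (Function.update x i s)| :=
    ((hw.pderiv i).continuous.comp hup).abs
  have int : ∀ {g : UnitAddCircle → ℝ}, Continuous g → Integrable g := fun hg =>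
    hg.integrable_of_hasCompactSupport (HasCompactSupport.of_compactSpace _)
  set A : ℝ := ∫ s : UnitAddCircle, |pderiv i w (Function.update x i s)|
  have key : ∀ s : UnitAddCircle, |w x| ≤ |w (Function.update x i s)| + A := by
    intro s
    obtain ⟨a, ha⟩ := QuotientAddGroup.mk_surjective (x i)
    obtain ⟨b, hb, rfl⟩ : ∃ b ∈ Ico a (a + 1), (b : UnitAddCircle) = s := by
      have := AddCircle.coe_image_Ico_eq (1 : ℝ) a
      exact (this ▸ mem_univ s : s ∈ ((↑) : ℝ → UnitAddCircle) '' Ico a (a + 1))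
    have hline : ∀ r : ℝ, Function.update x i (r : UnitAddCircle)
        = Function.update x i 0 + Pi.single i (r : UnitAddCircle) := by
      intro r; ext k
      by_cases hk : k = i
      · subst hk; simp
      · simp [hk]
    have hd : ∀ r : ℝ, HasDerivAt (fun r : ℝ => w (Function.update x i (r : UnitAddCircle)))
        (pderiv i w (Function.update x i (r : UnitAddCircle))) r := by
      intro r
      simp_rw [hline]
      exact hw.hasDerivAt i _ r
    have hc : Continuous fun r : ℝ => pderiv i w (Function.update x i (r : UnitAddCircle)) :=
      ((hw.pderiv i).continuous.comp hup).comp (AddCircle.continuous_mk' 1)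
    have hftc := intervalIntegral.integral_eq_sub_of_hasDerivAt (fun r _ => hd r)
      (hc.intervalIntegrable a b)
    have hx : Function.update x i (a : UnitAddCircle) = x := by
      have : (a : UnitAddCircle) = x i := ha
      rw [this]; exact Function.update_eq_self i x
    rw [hx] at hftc
    have h1 : |∫ r in a..b, pderiv i w (Function.update x i (r : UnitAddCircle))| ≤ A := by
      refine (intervalIntegral.abs_integral_le_integral_abs hb.1).trans ?_
      have : A = ∫ r in a..(a + 1), |pderiv i w (Function.update x i (r : UnitAddCircle))| :=
        (UnitAddCircle.intervalIntegral_preimage a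
          fun s => |pderiv i w (Function.update x i s)|).symm
      rw [this]
      exact intervalIntegral.integral_mono_interval le_rfl hb.1 hb.2.le
        (Eventually.of_forall fun _ => abs_nonneg _) (hc.abs.intervalIntegrable _ _)
    rw [hftc] at h1
    have := abs_sub_abs_le_abs_sub (w x) (w (Function.update x i (b : UnitAddCircle)))
    rw [abs_sub_comm] at h1
    linarith
  have := integral_mono (integrable_const |w x|) ((int c1).add (integrable_const A)) key
  rw [integral_add (int c1) (int c2)]
  simp only [Pi.add_apply] at this
  rw [integral_add (int c1) (integrable_const A)] at this
  simpa using this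

/-- The Sobolev embedding `H¹ ⊂ L⁶` in three dimensions, by the Gagliardo–Nirenberg argument: the
function `f⁴` is bounded by its integrals along the three coordinate circles, whose product is
controlled by the grid-lines lemma. -/
lemma integral_pow_six_le {f : T3 → ℝ} (hf : SmoothT f) :
    ∫ x, f x ^ 6 ≤ (∫ x, (|f x| + 4 * ∑ j, |pderiv j f x|) ^ 2) ^ 3 := by
  have hfc := hf.continuous
  have hpc : ∀ j, Continuous (pderiv j f) := fun j => (hf.pderiv j).continuous
  set g : T3 → ℝ := fun x => |f x| + 4 * ∑ j, |pderiv j f x|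
  have hgc : Continuous g := by fun_prop
  set h : T3 → ℝ := fun x => |f x| ^ 3 * g x
  have hhc : Continuous h := by fun_prop
  have hg0 : ∀ x, 0 ≤ g x := fun x => by positivity
  have hh0 : ∀ x, 0 ≤ h x := fun x => by positivity
  have hw : SmoothT fun x => f x ^ 4 := ContDiff.pow hf 4
  have hpw : ∀ j x, pderiv j (fun x => f x ^ 4) x = 4 * f x ^ 3 * pderiv j f x := by
    intro j x
    have := ((hf.hasDerivAt_zero j x).fun_pow 4).deriv
    simpa [pderiv] using this
  have hbound : ∀ i x, |f x ^ 4| + |pderiv i (fun x => f x ^ 4) x| ≤ h x := by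
    intro i x
    rw [hpw, abs_mul, abs_mul, abs_pow, abs_pow]
    have := Finset.single_le_sum (f := fun j => |pderiv j f x|) (fun j _ => abs_nonneg _)
      (Finset.mem_univ i)
    have h3 : 0 ≤ |f x| ^ 3 := by positivity
    simp only [h, g, abs_of_pos (by norm_num : (0 : ℝ) < 4)]
    nlinarith [mul_le_mul_of_nonneg_left this h3]
  have hline : ∀ i x, ENNReal.ofReal (f x ^ 4)
      ≤ ∫⁻ s : UnitAddCircle, ENNReal.ofReal (h (Function.update x i s)) := by
    intro i x
    have hup : Continuous fun s : UnitAddCircle => Function.update x i s :=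
      continuous_const.update i continuous_id
    have int : ∀ {g : UnitAddCircle → ℝ}, Continuous g → Integrable g := fun hg =>
      hg.integrable_of_hasCompactSupport (HasCompactSupport.of_compactSpace _)
    have hi : Integrable fun s : UnitAddCircle => h (Function.update x i s) := int (hhc.comp hup)
    rw [← ofReal_integral_eq_lintegral_ofReal hi (Eventually.of_forall fun s => hh0 _)]
    refine ENNReal.ofReal_le_ofReal ((le_abs_self _).trans
      ((abs_le_integral_update hw i x).trans (integral_mono (int ?_) hi
        fun s => hbound i _)))
    exact ((hw.continuous.comp hup).abs).add (((hw.pderiv i).continuous.comp hup).abs)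
  -- With `p = 3 / 2` the grid-lines lemma bounds the integral of the product over `i` of
  -- `(∫ h along the circle i)^(1/2)`, and each factor is at least `(f⁴)^(1/2)`.
  have hgrid := lintegral_prod_lintegral_pow_le (fun _ : Fin 3 => (volume : Measure UnitAddCircle))
    (p := 3 / 2) (by
      rw [Fintype.card_fin]; exact (Real.holderConjugate_iff.2 ⟨by norm_num, by norm_num⟩))
    (f := fun x => ENNReal.ofReal (h x)) (hhc.measurable.ennreal_ofReal)
  have hle : ENNReal.ofReal (∫ x, f x ^ 6) ≤ ENNReal.ofReal (∫ x, h x) ^ (3 / 2 : ℝ) := by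
    rw [ofReal_integral_eq_lintegral_ofReal (integrable_of_continuous (by fun_prop))
      (Eventually.of_forall fun x => Even.pow_nonneg (by decide) _),
      ofReal_integral_eq_lintegral_ofReal (integrable_of_continuous hhc)
      (Eventually.of_forall hh0)]
    refine le_trans (lintegral_mono fun x => ?_) hgrid
    calc ENNReal.ofReal (f x ^ 6) = ∏ _i : Fin 3, ENNReal.ofReal (f x ^ 4) ^ (1 / 2 : ℝ) := by
          rw [Finset.prod_const, Finset.card_univ, Fintype.card_fin,
            ENNReal.ofReal_rpow_of_nonneg (by positivity) (by norm_num), ← Real.sqrt_eq_rpow,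
            show f x ^ 4 = (f x ^ 2) ^ 2 by ring, Real.sqrt_sq (by positivity),
            ← ENNReal.ofReal_pow (by positivity)]
          congr 1; ring
      _ ≤ _ := by
          refine Finset.prod_le_prod' fun i _ => ?_
          rw [show (1 / ((Fintype.card (Fin 3) : ℝ) - 1)) = (1 / 2 : ℝ) by
            rw [Fintype.card_fin]; norm_num]
          exact ENNReal.rpow_le_rpow (hline i x) (by norm_num)
  set a := ∫ x, f x ^ 6
  set b := ∫ x, h x
  set d := ∫ x, g x ^ 2
  have ha0 : 0 ≤ a := integral_nonneg fun x => by positivity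
  have hb0 : 0 ≤ b := integral_nonneg hh0
  have hd0 : 0 ≤ d := integral_nonneg fun x => sq_nonneg _
  have h1 : a ^ 2 ≤ b ^ 3 := by
    rw [ENNReal.ofReal_rpow_of_nonneg hb0 (by norm_num),
      ENNReal.ofReal_le_ofReal_iff (by positivity)] at hle
    calc a ^ 2 ≤ (b ^ (3 / 2 : ℝ)) ^ 2 := by gcongr
      _ = b ^ 3 := by
        rw [← Real.rpow_natCast, ← Real.rpow_mul hb0]; norm_num
  have h2 : b ^ 2 ≤ a * d := by
    have := sq_integral_mul_le (f := fun x => |f x| ^ 3) (by fun_prop) hgc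
    have e : ∀ x, (|f x| ^ 3) ^ 2 = f x ^ 6 := fun x => by
      rw [← pow_mul]; exact Even.pow_abs (by decide) _
    simp_rw [e] at this
    exact this
  rcases ha0.eq_or_lt with h | h
  · rw [← h]; positivity
  -- The integral `a` occurs on both sides; it is finite and not zero, so that it cancels.
  have h3 : a ^ 3 * a ≤ a ^ 3 * d ^ 3 := by
    calc a ^ 3 * a = (a ^ 2) ^ 2 := by ring
      _ ≤ (b ^ 3) ^ 2 := by gcongr
      _ = (b ^ 2) ^ 3 := by ring
      _ ≤ (a * d) ^ 3 := by gcongr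
      _ = _ := by ring
  exact le_of_mul_le_mul_left h3 (by positivity)

lemma integral_pow_four_le {f : T3 → ℝ} (hf : SmoothT f) :
    ∫ x, f x ^ 4 ≤ 49 ^ 2 * (∫ x, (f x ^ 2 + ∑ j, pderiv j f x ^ 2)) ^ 2 := by
  have hfc := hf.continuous
  have hpc : ∀ j, Continuous (pderiv j f) := fun j => (hf.pderiv j).continuous
  set N := ∫ x, (f x ^ 2 + ∑ j, pderiv j f x ^ 2)
  have hN : 0 ≤ N := integral_nonneg fun x => by positivity
  have h6 : ∫ x, f x ^ 6 ≤ (49 * N) ^ 3 := by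
    refine (integral_pow_six_le hf).trans ?_
    have : ∫ x, (|f x| + 4 * ∑ j, |pderiv j f x|) ^ 2 ≤ 49 * N := by
      rw [← integral_const_mul]
      refine integral_mono (integrable_of_continuous (by fun_prop))
        (integrable_of_continuous (by fun_prop)) fun x => ?_
      simp only [Fin.sum_univ_three]
      rw [← sq_abs (f x), ← sq_abs (pderiv 0 f x), ← sq_abs (pderiv 1 f x),
        ← sq_abs (pderiv 2 f x)]
      generalize |f x| = a
      generalize |pderiv 0 f x| = b
      generalize |pderiv 1 f x| = c
      generalize |pderiv 2 f x| = d
      nlinarith [sq_nonneg (4 * a - b), sq_nonneg (4 * a - c), sq_nonneg (4 * a - d),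
        sq_nonneg (b - c), sq_nonneg (b - d), sq_nonneg (c - d)]
    have h0 : 0 ≤ ∫ x, (|f x| + 4 * ∑ j, |pderiv j f x|) ^ 2 :=
      integral_nonneg fun x => sq_nonneg _
    gcongr
  have h2 : ∫ x, f x ^ 2 ≤ N :=
    integral_mono (integrable_of_continuous (by fun_prop))
      (integrable_of_continuous (by fun_prop)) fun x => by
        have : 0 ≤ ∑ j, pderiv j f x ^ 2 := by positivity
        simpa using this
  have h4 := sq_integral_mul_le (g := fun x => f x ^ 3) hfc (by fun_prop)
  have e1 : ∀ x, f x * f x ^ 3 = f x ^ 4 := fun x => by ring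
  have e2 : ∀ x, (f x ^ 3) ^ 2 = f x ^ 6 := fun x => by ring
  simp_rw [e1, e2] at h4
  have h60 : 0 ≤ ∫ x, f x ^ 6 := integral_nonneg fun x => by positivity
  refine abs_le_of_sq_le_sq' ?_ (by positivity) |>.2
  calc _ ≤ _ := h4
    _ ≤ N * (49 * N) ^ 3 := by gcongr
    _ ≤ _ := by nlinarith [pow_nonneg hN 4]

/-- The embedding `H¹ ⊂ L⁴` for vector fields. -/
lemma integral_norm_pow_four_le {f : T3 → Vec} (hf : SmoothT f) :
    ∫ x, ‖f x‖ ^ 4 ≤ 3 * 49 ^ 2 * (∫ x, (‖f x‖ ^ 2 + ‖gradV f x‖ ^ 2)) ^ 2 := by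
  have hc : ∀ i, Continuous fun x => f x i := fun i => (hf.apply i).continuous
  have hpc : ∀ i j, Continuous (pderiv j fun x => f x i) :=
    fun i j => ((hf.apply i).pderiv j).continuous
  set N : Fin 3 → ℝ := fun i => ∫ x, (f x i ^ 2 + ∑ j, pderiv j (fun z => f z i) x ^ 2)
  have hN : ∀ i, 0 ≤ N i := fun i => integral_nonneg fun x => by positivity
  have hi : ∀ i, Integrable fun x => f x i ^ 2 + ∑ j, pderiv j (fun z => f z i) x ^ 2 := fun i =>
    integrable_of_continuous (((hc i).pow 2).add (continuous_finsetSum _ fun j _ =>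
      (hpc i j).pow 2))
  have h1 : ∫ x, (‖f x‖ ^ 2 + ‖gradV f x‖ ^ 2) = ∑ i, N i := by
    rw [← integral_finsetSum _ fun i _ => hi i]
    congr 1; ext x
    rw [EuclideanSpace.real_norm_sq_eq, EuclideanSpace.real_norm_sq_eq, Fintype.sum_prod_type,
      ← Finset.sum_add_distrib]
    rfl
  rw [h1]
  have hc4 : Continuous fun x => ‖f x‖ ^ 4 := hf.continuous.norm.pow 4
  have hc3 : Continuous fun x => 3 * ∑ i, f x i ^ 4 :=
    continuous_const.mul (continuous_finsetSum _ fun i _ => (hc i).pow 4)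
  calc ∫ x, ‖f x‖ ^ 4 ≤ ∫ x, 3 * ∑ i, f x i ^ 4 := by
        refine integral_mono (integrable_of_continuous hc4)
          (integrable_of_continuous hc3) fun x => ?_
        simp only
        rw [show ‖f x‖ ^ 4 = (‖f x‖ ^ 2) ^ 2 by ring, EuclideanSpace.real_norm_sq_eq,
          Fin.sum_univ_three, Fin.sum_univ_three]
        nlinarith [sq_nonneg (f x 0 ^ 2 - f x 1 ^ 2), sq_nonneg (f x 0 ^ 2 - f x 2 ^ 2),
          sq_nonneg (f x 1 ^ 2 - f x 2 ^ 2)]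
    _ = 3 * ∑ i, ∫ x, f x i ^ 4 := by
        rw [integral_const_mul, integral_finsetSum _ fun i _ =>
          integrable_of_continuous ((hc i).fun_pow 4)]
    _ ≤ 3 * ∑ i, 49 ^ 2 * N i ^ 2 := by
        gcongr with i
        exact integral_pow_four_le (hf.apply i)
    _ ≤ 3 * 49 ^ 2 * (∑ i, N i) ^ 2 := by
        simp only [Fin.sum_univ_three]
        nlinarith [mul_nonneg (hN 0) (hN 1), mul_nonneg (hN 0) (hN 2), mul_nonneg (hN 1) (hN 2)]

/-- A translation moves a function in `L²` by at most the size of its gradient. -/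
lemma integral_sub_translate_sq_le {f : T3 → ℝ} (hf : SmoothT f) (y : Vec) :
    ∫ x, (f (x + toTorus y) - f x) ^ 2 ≤ ∫ x, (∑ j, y j * pderiv j f x) ^ 2 := by
  set D : T3 → ℝ := fun x => ∑ j, y j * pderiv j f x
  have hpc : ∀ j, Continuous (pderiv j f) := fun j => (hf.pderiv j).continuous
  have hD : Continuous D := by fun_prop
  have hl : Continuous fun s : ℝ => toTorus (s • y) := continuous_toTorus.comp (by fun_prop)
  have hstep : ∀ x : T3, (f (x + toTorus y) - f x) ^ 2
      ≤ ∫ s in (0 : ℝ)..1, D (x + toTorus (s • y)) ^ 2 := by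
    intro x
    have hDx : Continuous fun s : ℝ => D (x + toTorus (s • y)) := by fun_prop
    have hd : ∀ s : ℝ, HasDerivAt (fun s : ℝ => f (x + toTorus (s • y)))
        (D (x + toTorus (s • y))) s := by
      intro s
      obtain ⟨z, rfl⟩ := toTorus_surjective x
      have := hf.hasDerivAt_line z y s
      rw [hf.fderiv_apply] at this
      simpa only [← toTorus_add, smul_eq_mul] using this
    have hftc := intervalIntegral.integral_eq_sub_of_hasDerivAt (a := 0) (b := 1)
      (fun r _ => hd r) (hDx.intervalIntegrable _ _)
    simp only [one_smul, zero_smul, toTorus_zero, add_zero] at hftc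
    rw [← hftc]
    set m := ∫ s in (0 : ℝ)..1, D (x + toTorus (s • y))
    have h0 : 0 ≤ ∫ s in (0 : ℝ)..1, (D (x + toTorus (s • y)) - m) ^ 2 :=
      intervalIntegral.integral_nonneg zero_le_one fun s _ => sq_nonneg _
    have h1 : ∀ s : ℝ, (D (x + toTorus (s • y)) - m) ^ 2
        = D (x + toTorus (s • y)) ^ 2 - ((2 * m) * D (x + toTorus (s • y)) - m ^ 2) :=
      fun s => by ring
    simp_rw [h1] at h0
    rw [intervalIntegral.integral_sub (hDx.fun_pow 2 |>.intervalIntegrable _ _)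
      (by exact ((hDx.const_mul (2 * m)).sub continuous_const).intervalIntegrable _ _),
      intervalIntegral.integral_sub ((hDx.const_mul (2 * m)).intervalIntegrable _ _)
      (by simp), intervalIntegral.integral_const_mul] at h0
    simp only [intervalIntegral.integral_const, sub_zero, one_smul] at h0
    nlinarith
  have hjoint : Continuous fun p : T3 × ℝ => D (p.1 + toTorus (p.2 • y)) ^ 2 := by
    have : Continuous fun p : T3 × ℝ => toTorus (p.2 • y) := hl.comp continuous_snd
    fun_prop
  obtain ⟨C, -, hC⟩ := exists_bound_of_continuous (hD.pow 2)
  have hint : Integrable (Function.uncurry fun (x : T3) (s : ℝ) => D (x + toTorus (s • y)) ^ 2)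
      ((volume : Measure T3).prod (volume.restrict (Ioc (0 : ℝ) 1))) :=
    Integrable.of_bound hjoint.aestronglyMeasurable C (Eventually.of_forall fun p => hC _)
  calc ∫ x, (f (x + toTorus y) - f x) ^ 2
      ≤ ∫ x, ∫ s in Ioc (0 : ℝ) 1, D (x + toTorus (s • y)) ^ 2 := by
        refine integral_mono (integrable_of_continuous ?_) hint.integral_prod_left fun x => ?_
        · exact ((hf.continuous.comp (continuous_add_const _)).sub hf.continuous).pow 2
        · have := hstep x
          rwa [intervalIntegral.integral_of_le zero_le_one] at this
    _ = ∫ s in Ioc (0 : ℝ) 1, ∫ x, D (x + toTorus (s • y)) ^ 2 := integral_integral_swap hint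
    _ = ∫ s in Ioc (0 : ℝ) 1, ∫ x, D x ^ 2 := by
        congr 1; ext s
        exact integral_add_right_eq_self (fun x => D x ^ 2) _
    _ = _ := by simp [D]

/-- The Poincaré inequality: average the previous estimate over all translations. -/
lemma integral_sq_le_of_integral_eq_zero {f : T3 → ℝ} (hf : SmoothT f) (h0 : ∫ x, f x = 0) :
    ∫ x, f x ^ 2 ≤ 3 * ∫ x, ∑ j, pderiv j f x ^ 2 := by
  have hfc := hf.continuous
  have hpc : ∀ j, Continuous (pderiv j f) := fun j => (hf.pderiv j).continuous
  set G := ∫ x, ∑ j, pderiv j f x ^ 2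
  -- Every point of the torus lifts to a vector with entries of modulus at most `1`.
  have hz : ∀ z : T3, 2 * (∫ x, f x ^ 2) - 2 * (∫ x, f (x + z) * f x) ≤ 3 * G := by
    intro z
    obtain ⟨y, hy, rfl⟩ : ∃ y : Vec, (∀ j, |y j| ≤ 1) ∧ toTorus y = z := by
      have : ∀ j, ∃ b : ℝ, b ∈ Ico (0 : ℝ) (0 + 1) ∧ (b : UnitAddCircle) = z j := fun j => by
        have := AddCircle.coe_image_Ico_eq (1 : ℝ) 0
        exact (this ▸ mem_univ (z j) : z j ∈ ((↑) : ℝ → UnitAddCircle) '' Ico (0 : ℝ) (0 + 1))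
      choose b hb hbz using this
      refine ⟨WithLp.toLp 2 b, fun j => ?_, funext hbz⟩
      have := hb j
      simp only [zero_add, mem_Ico] at this
      exact abs_le.2 ⟨by simpa using by linarith, this.2.le⟩
    have hcz : Continuous fun x => f (x + toTorus y) := hfc.comp (continuous_add_const _)
    have h1 := integral_sub_translate_sq_le hf y
    have h2 : ∫ x, (∑ j, y j * pderiv j f x) ^ 2 ≤ 3 * G := by
      rw [← integral_const_mul]
      refine integral_mono (integrable_of_continuous (by fun_prop))
        (integrable_of_continuous (by fun_prop)) fun x => ?_
      have hcs := Finset.sum_mul_sq_le_sq_mul_sq Finset.univ (fun j => y j)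
        (fun j => pderiv j f x)
      have hy3 : ∑ j, y j ^ 2 ≤ 3 := by
        calc ∑ j, y j ^ 2 ≤ ∑ _j : Fin 3, (1 : ℝ) :=
              Finset.sum_le_sum fun j _ => (sq_le_one_iff_abs_le_one _).2 (hy j)
          _ = 3 := by simp
      exact hcs.trans (mul_le_mul_of_nonneg_right hy3 (by positivity))
    have e : ∀ x, (f (x + toTorus y) - f x) ^ 2
        = f (x + toTorus y) ^ 2 + f x ^ 2 - 2 * (f (x + toTorus y) * f x) := fun x => by ring
    simp_rw [e] at h1
    rw [integral_sub (integrable_of_continuous (by fun_prop))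
      (integrable_of_continuous (by fun_prop)), integral_add
      (integrable_of_continuous (by fun_prop)) (integrable_of_continuous (by fun_prop)),
      integral_const_mul, integral_add_right_eq_self (fun x => f x ^ 2)] at h1
    linarith
  have hjoint : Continuous fun p : T3 × T3 => f (p.2 + p.1) * f p.2 := by fun_prop
  have hint : Integrable (Function.uncurry fun (z x : T3) => f (x + z) * f x)
      ((volume : Measure T3).prod volume) :=
    hjoint.integrable_of_hasCompactSupport (HasCompactSupport.of_compactSpace _)
  -- The average over all translations of the correlation is the square of the mean of `f`.
  have hswap : ∫ z, ∫ x, f (x + z) * f x = 0 := by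
    rw [integral_integral_swap hint]
    have : ∀ x, ∫ z, f (x + z) * f x = 0 := fun x => by
      rw [integral_mul_const, integral_add_left_eq_self f x, h0, zero_mul]
    simp [this]
  have hI : Integrable fun z => ∫ x, f (x + z) * f x := hint.integral_prod_left
  have := integral_mono (((integrable_const (2 * ∫ x, f x ^ 2)).sub (hI.const_mul 2)))
    (integrable_const (3 * G)) hz
  simp only [Pi.sub_apply] at this
  rw [integral_sub (integrable_const _) (hI.const_mul 2),
    integral_const_mul 2 (fun z => ∫ x, f (x + z) * f x), hswap] at this
  simp only [integral_const, probReal_univ, one_smul] at this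
  have hpos : 0 ≤ ∫ x, f x ^ 2 := integral_nonneg fun x => sq_nonneg _
  linarith

end Sobolev

/-! ### The spaces `V` and `H¹` -/

section Spaces

variable {F : Type*} [NormedAddCommGroup F] [NormedSpace ℝ F]

instance : CompleteSpace V := by
  unfold V
  exact Submodule.isClosed_topologicalClosure _ |>.completeSpace_coe

instance : CompleteSpace H := by
  unfold H
  exact Submodule.isClosed_topologicalClosure _ |>.completeSpace_coe

instance : ENNReal.HolderTriple 4 4 2 := ⟨by
  rw [← two_mul, show (4 : ℝ≥0∞) = 2 * 2 by norm_num,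
    ENNReal.mul_inv (Or.inl (by norm_num)) (Or.inl (by norm_num)), ← mul_assoc,
    ENNReal.mul_inv_cancel (by norm_num) (by norm_num), one_mul]⟩

instance : Fact ((1 : ℝ≥0∞) ≤ 4) := ⟨by norm_num⟩

instance : Fact ((2 : ℝ≥0∞) ≠ ⊤) := ⟨by norm_num⟩

lemma memLp_of_continuous {F : Type*} [NormedAddCommGroup F] {f : T3 → F} (hf : Continuous f)
    (p : ℝ≥0∞) : MemLp f p := by
  obtain ⟨C, -, hC⟩ := exists_bound_of_continuous hf
  exact MemLp.of_bound (hf.aestronglyMeasurable_of_compactSpace) C (Eventually.of_forall hC)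

/-- The space in which `V` is a closed subspace: pairs of a field and a candidate gradient. -/
abbrev W : Type := WithLp 2 (L2Vec × L2Mat)

/-- The pair `(f, ∇f)` of a smooth vector field. -/
def smoothPair (f : T3 → Vec) (hf : SmoothT f) : W :=
  WithLp.toLp 2 ((memLp_of_continuous hf.continuous 2).toLp f,
    (memLp_of_continuous hf.gradV.continuous 2).toLp (gradV f))

lemma smoothPair_fst {f : T3 → Vec} (hf : SmoothT f) : (smoothPair f hf).fst =ᵐ[volume] f :=
  MemLp.coeFn_toLp (memLp_of_continuous hf.continuous 2)

lemma smoothPair_snd {f : T3 → Vec} (hf : SmoothT f) :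
    (smoothPair f hf).snd =ᵐ[volume] gradV f :=
  MemLp.coeFn_toLp (memLp_of_continuous hf.gradV.continuous 2)

lemma gradV_add {f g : T3 → Vec} (hf : SmoothT f) (hg : SmoothT g) (x : T3) :
    gradV (fun z => f z + g z) x = gradV f x + gradV g x := by
  ext ij
  exact pderiv_add (hf.apply ij.1) (hg.apply ij.1) ij.2 x

lemma gradV_const_smul (c : ℝ) {f : T3 → Vec} (hf : SmoothT f) (x : T3) :
    gradV (fun z => c • f z) x = c • gradV f x := by
  ext ij
  exact pderiv_const_smul c (hf.apply ij.1) ij.2 x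

lemma divV_add {f g : T3 → Vec} (hf : SmoothT f) (hg : SmoothT g) (x : T3) :
    divV (fun z => f z + g z) x = divV f x + divV g x := by
  simp only [divV, ← Finset.sum_add_distrib]
  exact Finset.sum_congr rfl fun j _ => pderiv_add (hf.apply j) (hg.apply j) j x

lemma divV_const_smul (c : ℝ) {f : T3 → Vec} (hf : SmoothT f) (x : T3) :
    divV (fun z => c • f z) x = c * divV f x := by
  simp only [divV, Finset.mul_sum]
  exact Finset.sum_congr rfl fun j _ => pderiv_const_smul c (hf.apply j) j x

lemma IsSolenoidal.add {f g : T3 → Vec} (hf : IsSolenoidal f) (hg : IsSolenoidal g) :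
    IsSolenoidal fun x => f x + g x := by
  refine ⟨hf.1.add hg.1, fun x => ?_, ?_⟩
  · rw [divV_add hf.1 hg.1, hf.2.1, hg.2.1, add_zero]
  · rw [integral_add hf.1.integrable hg.1.integrable, hf.2.2, hg.2.2, add_zero]

lemma IsSolenoidal.const_smul {f : T3 → Vec} (c : ℝ) (hf : IsSolenoidal f) :
    IsSolenoidal fun x => c • f x := by
  refine ⟨hf.1.const_smul c, fun x => ?_, ?_⟩
  · rw [divV_const_smul c hf.1, hf.2.1, mul_zero]
  · rw [integral_smul, hf.2.2, smul_zero]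

lemma isSolenoidal_zero : IsSolenoidal fun _ => 0 :=
  ⟨smoothT_const 0, fun x => by simp [divV, pderiv_const], by simp⟩

/-- The smooth solenoidal pairs `(φ, ∇φ)` form a subspace. -/
def solenoidalPairs : Submodule ℝ W where
  carrier := {w | ∃ φ, ∃ hφ : IsSolenoidal φ, w = smoothPair φ hφ.1}
  add_mem' := by
    rintro _ _ ⟨f, hf, rfl⟩ ⟨g, hg, rfl⟩
    refine ⟨_, hf.add hg, ?_⟩
    rw [smoothPair, smoothPair, ← WithLp.toLp_add, Prod.mk_add_mk, ← MemLp.toLp_add,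
      ← MemLp.toLp_add, smoothPair]
    congr 3
    exact (funext fun x => gradV_add hf.1 hg.1 x).symm
  zero_mem' := by
    refine ⟨_, isSolenoidal_zero, ?_⟩
    have h : gradV (fun _ => 0) = fun _ => 0 := by
      ext x ij
      exact pderiv_const (0 : ℝ) ij.2 x
    rw [smoothPair]
    simp only [h]
    have h1 : ∀ {G : Type} [NormedAddCommGroup G] (hG : MemLp (fun _ : T3 => (0 : G)) 2),
      hG.toLp (fun _ : T3 => (0 : G)) = 0 := fun hG => MemLp.toLp_zero hG
    rw [h1, h1]; rfl
  smul_mem' := by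
    rintro c _ ⟨f, hf, rfl⟩
    refine ⟨_, hf.const_smul c, ?_⟩
    rw [smoothPair, ← WithLp.toLp_smul, Prod.smul_mk, ← MemLp.toLp_const_smul,
      ← MemLp.toLp_const_smul, smoothPair]
    congr 3
    exact (funext fun x => gradV_const_smul c hf.1 x).symm

lemma V_eq : V = solenoidalPairs.topologicalClosure := by
  unfold V
  congr 1
  refine le_antisymm (Submodule.span_le.2 ?_) fun w hw => Submodule.subset_span ?_
  · rintro w ⟨φ, hφ, h1, h2⟩
    refine ⟨φ, hφ, ?_⟩
    have e1 : w.fst = (smoothPair φ hφ.1).fst := Lp.ext (h1.trans (smoothPair_fst hφ.1).symm)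
    have e2 : w.snd = (smoothPair φ hφ.1).snd := Lp.ext (h2.trans (smoothPair_snd hφ.1).symm)
    exact (WithLp.ext_iff 2).2 (Prod.ext e1 e2)
  · obtain ⟨φ, hφ, rfl⟩ := hw
    exact ⟨φ, hφ, smoothPair_fst hφ.1, smoothPair_snd hφ.1⟩

/-- A smooth solenoidal field as an element of `V`. -/
def toV (φ : T3 → Vec) (hφ : IsSolenoidal φ) : V :=
  ⟨smoothPair φ hφ.1, by
    rw [V_eq]; exact solenoidalPairs.le_topologicalClosure ⟨φ, hφ, rfl⟩⟩

lemma toV_val {φ : T3 → Vec} (hφ : IsSolenoidal φ) : V.val (toV φ hφ) =ᵐ[volume] φ :=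
  smoothPair_fst hφ.1

lemma toV_grad {φ : T3 → Vec} (hφ : IsSolenoidal φ) : V.grad (toV φ hφ) =ᵐ[volume] gradV φ :=
  smoothPair_snd hφ.1

lemma exists_tendsto_toV (v : V) : ∃ (φ : ℕ → T3 → Vec) (hφ : ∀ n, IsSolenoidal (φ n)),
    Tendsto (fun n => toV (φ n) (hφ n)) atTop (𝓝 v) := by
  have hv : (v : W) ∈ closure (solenoidalPairs : Set W) := by
    have h : (v : W) ∈ solenoidalPairs.topologicalClosure := V_eq ▸ v.2
    exact h
  obtain ⟨w, hw, hlim⟩ := mem_closure_iff_seq_limit.1 hv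
  choose φ hφ hwφ using hw
  refine ⟨φ, hφ, ?_⟩
  rw [tendsto_subtype_rng]
  simpa only [toV, ← hwφ] using hlim

/-- A closed property of elements of `V` may be checked on smooth solenoidal fields. -/
lemma V_induction {P : V → Prop} (hc : IsClosed {v | P v})
    (h : ∀ φ (hφ : IsSolenoidal φ), P (toV φ hφ)) (v : V) : P v := by
  obtain ⟨φ, hφ, hlim⟩ := exists_tendsto_toV v
  exact hc.mem_of_tendsto hlim (Eventually.of_forall fun n => h _ _)

/-- `v ↦ v`, as a continuous linear map `V → L²`. -/
def valL : V →L[ℝ] L2Vec := (WithLp.fstL 2 ℝ L2Vec L2Mat).comp V.subtypeL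

/-- `v ↦ ∇v`, as a continuous linear map `V → L²`. -/
def gradL : V →L[ℝ] L2Mat := (WithLp.sndL 2 ℝ L2Vec L2Mat).comp V.subtypeL

lemma gradL_apply (v : V) : gradL v = V.grad v := rfl

lemma norm_sq_V (v : V) : ‖v‖ ^ 2 = ‖V.val v‖ ^ 2 + ‖V.grad v‖ ^ 2 :=
  WithLp.prod_norm_sq_eq_of_L2 (v : W)

lemma norm_val_le (v : V) : ‖V.val v‖ ≤ ‖v‖ :=
  abs_le_of_sq_le_sq' (by rw [norm_sq_V]; nlinarith [sq_nonneg ‖V.grad v‖]) (norm_nonneg _) |>.2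

lemma norm_grad_le (v : V) : ‖V.grad v‖ ≤ ‖v‖ :=
  abs_le_of_sq_le_sq' (by rw [norm_sq_V]; nlinarith [sq_nonneg ‖V.val v‖]) (norm_nonneg _) |>.2

lemma norm_sq_L2 {F : Type*} [NormedAddCommGroup F] [InnerProductSpace ℝ F]
    (f : Lp F 2 (volume : Measure T3)) : ‖f‖ ^ 2 = ∫ x, ‖f x‖ ^ 2 := by
  rw [← real_inner_self_eq_norm_sq, L2.inner_def]
  simp_rw [real_inner_self_eq_norm_sq]

/-- The Poincaré inequality on `V`. -/
lemma norm_val_sq_le (v : V) : ‖V.val v‖ ^ 2 ≤ 3 * ‖V.grad v‖ ^ 2 := by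
  refine V_induction (P := fun v => ‖V.val v‖ ^ 2 ≤ 3 * ‖V.grad v‖ ^ 2)
    (isClosed_le (valL.continuous.norm.pow 2) ((gradL.continuous.norm.pow 2).const_mul 3))
    (fun φ hφ => ?_) v
  rw [norm_sq_L2, norm_sq_L2]
  have hi : ∀ i, Integrable fun x => φ x i ^ 2 := fun i =>
    integrable_of_continuous ((hφ.1.apply i).continuous.pow 2)
  have hij : ∀ i, Integrable fun x => ∑ j, pderiv j (fun z => φ z i) x ^ 2 := fun i =>
    integrable_of_continuous (continuous_finsetSum _ fun j _ =>
      ((hφ.1.apply i).pderiv j).continuous.pow 2)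
  have e1 : ∫ x, ‖V.val (toV φ hφ) x‖ ^ 2 = ∑ i, ∫ x, φ x i ^ 2 := by
    rw [← integral_finsetSum _ fun i _ => hi i]
    refine integral_congr_ae ?_
    filter_upwards [toV_val hφ] with x hx
    rw [hx, EuclideanSpace.real_norm_sq_eq]
  have e2 : ∫ x, ‖V.grad (toV φ hφ) x‖ ^ 2
      = ∑ i, ∫ x, ∑ j, pderiv j (fun z => φ z i) x ^ 2 := by
    rw [← integral_finsetSum _ fun i _ => hij i]
    refine integral_congr_ae ?_
    filter_upwards [toV_grad hφ] with x hx
    rw [hx, EuclideanSpace.real_norm_sq_eq, Fintype.sum_prod_type]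
    rfl
  rw [e1, e2, Finset.mul_sum]
  refine Finset.sum_le_sum fun i _ => integral_sq_le_of_integral_eq_zero (hφ.1.apply i) ?_
  have := (EuclideanSpace.proj i : Vec →L[ℝ] ℝ).integral_comp_comm hφ.1.integrable
  rw [hφ.2.2, map_zero] at this
  exact this

lemma norm_sq_V_le (v : V) : ‖v‖ ^ 2 ≤ 4 * ‖V.grad v‖ ^ 2 := by
  rw [norm_sq_V]; linarith [norm_val_sq_le v]

lemma norm_V_le (v : V) : ‖v‖ ≤ 2 * ‖V.grad v‖ :=
  abs_le_of_sq_le_sq' (by nlinarith [norm_sq_V_le v]) (by positivity) |>.2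

/-- The Dirichlet form `⟨∇v, ∇w⟩` on `V`. -/
def dirichletForm : V →L[ℝ] V →L[ℝ] ℝ := ((innerSL ℝ).bilinearComp gradL gradL)

lemma dirichletForm_apply (v w : V) :
    dirichletForm v w = inner ℝ (V.grad v) (V.grad w) := rfl

/-- Coercivity is the Poincaré inequality. -/
lemma isCoercive_dirichletForm : IsCoercive dirichletForm := by
  refine ⟨1 / 4, by norm_num, fun v => ?_⟩
  rw [dirichletForm_apply, real_inner_self_eq_norm_sq]
  nlinarith [norm_sq_V_le v]

/-- The potential of a matrix field `J`: the field `g ∈ V` for which `∇g` is the orthogonal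
projection of `J` onto the gradients of elements of `V`. -/
def potential : L2Mat →L[ℝ] V :=
  (isCoercive_dirichletForm.continuousLinearEquivOfBilin.symm : V →L[ℝ] V).comp
    (ContinuousLinearMap.adjoint gradL)

lemma inner_grad_potential (J : L2Mat) (w : V) :
    inner ℝ (V.grad (potential J)) (V.grad w) = inner ℝ J (V.grad w) := by
  rw [← dirichletForm_apply, ← isCoercive_dirichletForm.continuousLinearEquivOfBilin_apply]
  simp [potential, ContinuousLinearMap.adjoint_inner_left, gradL_apply]

/-! #### The embedding in `L⁴` and the tensor product -/

lemma eLpNorm_four_le (v : V) : eLpNorm (V.val v) 4 volume ≤ ENNReal.ofReal (12 * ‖v‖) := by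
  have hs : ∀ φ (hφ : IsSolenoidal φ), eLpNorm (V.val (toV φ hφ)) 4 volume
      ≤ ENNReal.ofReal (12 * ‖toV φ hφ‖) := by
    intro φ hφ
    have hφc := hφ.1.continuous
    rw [eLpNorm_congr_ae (toV_val hφ), MemLp.eLpNorm_eq_integral_rpow_norm (by norm_num)
      (by norm_num) (memLp_of_continuous hφc 4)]
    refine ENNReal.ofReal_le_ofReal ?_
    have e : ∫ x, (‖φ x‖ ^ 2 + ‖gradV φ x‖ ^ 2) = ‖toV φ hφ‖ ^ 2 := by
      rw [norm_sq_V, norm_sq_L2, norm_sq_L2, integral_add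
        (integrable_of_continuous (hφc.norm.fun_pow 2))
        (integrable_of_continuous (hφ.1.gradV.continuous.norm.fun_pow 2))]
      congr 1 <;> refine integral_congr_ae ?_
      · filter_upwards [toV_val hφ] with x hx; rw [hx]
      · filter_upwards [toV_grad hφ] with x hx; rw [hx]
    have h4 := integral_norm_pow_four_le hφ.1
    rw [e] at h4
    have e4 : (ENNReal.toReal 4) = 4 := by norm_num
    rw [e4]
    have h5 : ∫ x, ‖φ x‖ ^ (4 : ℝ) ≤ (12 * ‖toV φ hφ‖) ^ (4 : ℝ) := by
      have : ∀ t : ℝ, t ^ (4 : ℝ) = t ^ 4 := fun t => by exact_mod_cast Real.rpow_natCast t 4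
      simp_rw [this]
      nlinarith [pow_nonneg (norm_nonneg (toV φ hφ)) 4]
    calc _ ≤ ((12 * ‖toV φ hφ‖) ^ (4 : ℝ)) ^ (4 : ℝ)⁻¹ :=
          Real.rpow_le_rpow (integral_nonneg fun x => by positivity) h5 (by norm_num)
      _ = _ := Real.rpow_rpow_inv (by positivity) (by norm_num)
  obtain ⟨φ, hφ, hlim⟩ := exists_tendsto_toV v
  have hlimv : Tendsto (fun n => V.val (toV (φ n) (hφ n))) atTop (𝓝 (V.val v)) :=
    (valL.continuous.tendsto v).comp hlim
  have hmeas : TendstoInMeasure volume (fun n => (V.val (toV (φ n) (hφ n)) : T3 → Vec)) atTop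
      (V.val v) := tendstoInMeasure_of_tendsto_Lp hlimv
  have hc : ∀ c > 12 * ‖v‖, eLpNorm (V.val v) 4 volume ≤ ENNReal.ofReal c := by
    intro c hc
    refine eLpNorm_le_of_tendstoInMeasure (u := atTop) ?_ hmeas
      fun n => Lp.aestronglyMeasurable _
    filter_upwards [(hlim.norm.const_mul 12).eventually (gt_mem_nhds hc)] with n hn
    exact (hs _ _).trans (ENNReal.ofReal_le_ofReal hn.le)
  refine ge_of_tendsto (x := 𝓝[>] (12 * ‖v‖)) (f := ENNReal.ofReal) ?_
    (by filter_upwards [self_mem_nhdsWithin] with c hc' using hc c hc')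
  exact (ENNReal.continuous_ofReal.tendsto _).mono_left nhdsWithin_le_nhds

lemma memLp_four (v : V) : MemLp (V.val v) 4 volume :=
  ⟨Lp.aestronglyMeasurable _, (eLpNorm_four_le v).trans_lt ENNReal.ofReal_lt_top⟩

/-- The embedding `V → L⁴`. -/
def valFour : V →L[ℝ] Lp Vec 4 (volume : Measure T3) :=
  LinearMap.mkContinuous
    { toFun := fun v => (memLp_four v).toLp (V.val v)
      map_add' := fun v w => by
        rw [← MemLp.toLp_add]
        exact MemLp.toLp_congr _ _ (Lp.coeFn_add (V.val v) (V.val w))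
      map_smul' := fun c v => by
        rw [RingHom.id_apply, ← MemLp.toLp_const_smul]
        exact MemLp.toLp_congr _ _ (Lp.coeFn_smul c (V.val v)) } 12 fun v => by
    refine (Lp.norm_toLp _ (memLp_four v)).trans_le ?_
    exact ENNReal.toReal_le_of_le_ofReal (by positivity) (eLpNorm_four_le v)

lemma coeFn_valFour (v : V) : valFour v =ᵐ[volume] V.val v := MemLp.coeFn_toLp (memLp_four v)

lemma norm_tensor (a b : Vec) : ‖tensor a b‖ = ‖a‖ * ‖b‖ := by
  rw [← sq_eq_sq₀ (norm_nonneg _) (by positivity), mul_pow, EuclideanSpace.real_norm_sq_eq,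
    EuclideanSpace.real_norm_sq_eq, EuclideanSpace.real_norm_sq_eq, Fintype.sum_prod_type,
    Finset.sum_mul_sum]
  simp [tensor, mul_pow]

/-- The tensor product as a continuous bilinear map. -/
def tensorL : Vec →L[ℝ] Vec →L[ℝ] Mat :=
  LinearMap.mkContinuous₂ (LinearMap.mk₂ ℝ tensor
    (fun a b c => by ext; simp [tensor, add_mul]) (fun r a b => by ext; simp [tensor, mul_assoc])
    (fun a b c => by ext; simp [tensor, mul_add])
    (fun r a b => by ext; simp [tensor, mul_left_comm])) 1
    fun a b => by simp [norm_tensor]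

/-- The quadratic expression `v ⊗ w ∈ L²` for `v, w ∈ V`. -/
def tensorV : V →L[ℝ] V →L[ℝ] L2Mat :=
  (tensorL.holderL (volume : Measure T3) 4 4 2).bilinearComp valFour valFour

lemma coeFn_tensorV (v w : V) :
    tensorV v w =ᵐ[volume] fun x => tensor (V.val v x) (V.val w x) := by
  filter_upwards [tensorL.coeFn_holder (r := 2) (valFour v) (valFour w), coeFn_valFour v,
    coeFn_valFour w] with x h1 h2 h3
  have : tensorV v w x = tensorL.holder 2 (valFour v) (valFour w) x := rfl
  rw [this, h1, h2, h3]; rfl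

end Spaces

/-! ### Convolution on the torus with kernels on `ℝ³` -/

section Convolution

variable {F G : Type*} [NormedAddCommGroup F] [NormedSpace ℝ F]
  [NormedAddCommGroup G] [NormedSpace ℝ G]

instance : (volume : Measure T3).IsNegInvariant :=
  Measure.IsAddHaarMeasure.isNegInvariant_of_regular volume

/-- Continuous kernels of compact support on `ℝ³`. -/
structure ConvKernel (k : Vec → ℝ) : Prop where
  continuous : Continuous k
  compact : HasCompactSupport k

/-- The convolution of a function on the torus with a kernel on `ℝ³`. -/
def conv {F : Type*} [NormedAddCommGroup F] [NormedSpace ℝ F] (k : Vec → ℝ) (f : T3 → F)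
    (x : T3) : F := ∫ y : Vec, k y • f (x - toTorus y)

lemma measurePreserving_toTorus (a : Vec) :
    MeasurePreserving toTorus
      (volume.restrict {y : Vec | ∀ i, y i ∈ Ioc (a i) (a i + 1)}) volume := by
  have h1 : MeasurePreserving (fun (y : Fin 3 → ℝ) (i : Fin 3) => (y i : UnitAddCircle))
      (Measure.pi fun i => volume.restrict (Ioc (a i) (a i + 1))) volume :=
    measurePreserving_pi _ _ fun i => UnitAddCircle.measurePreserving_mk (a i)
  rw [← Measure.restrict_pi_pi] at h1
  have h2 := (PiLp.volume_preserving_ofLp (Fin 3)).restrict_preimage_emb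
    (MeasurableEquiv.toLp 2 (Fin 3 → ℝ)).symm.measurableEmbedding
    (univ.pi fun i => Ioc (a i) (a i + 1))
  have h3 := h1.comp h2
  have hset : {y : Vec | ∀ i, y i ∈ Ioc (a i) (a i + 1)}
      = WithLp.ofLp ⁻¹' univ.pi fun i => Ioc (a i) (a i + 1) := by
    ext y; simp
  rw [hset]
  exact h3

/-- Over a compact set the covering map is finite-to-one, with a uniform bound. -/
lemma exists_map_restrict_le {K : Set Vec} (hK : IsCompact K) :
    ∃ C : ℝ≥0∞, C ≠ ⊤ ∧ (volume.restrict K).map toTorus ≤ C • (volume : Measure T3) := by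
  have hm : Measurable toTorus := continuous_toTorus.measurable
  refine hK.induction_on (p := fun s => ∃ C : ℝ≥0∞, C ≠ ⊤ ∧
    (volume.restrict s).map toTorus ≤ C • (volume : Measure T3)) ⟨0, by simp, by simp⟩ ?_ ?_ ?_
  · rintro s t hst ⟨C, hC, h⟩
    exact ⟨C, hC, (Measure.map_mono (Measure.restrict_mono hst le_rfl) hm).trans h⟩
  · rintro s t ⟨C, hC, h⟩ ⟨D, hD, h'⟩
    refine ⟨C + D, by simp [hC, hD], ?_⟩
    rw [add_smul]
    refine (Measure.map_mono (Measure.restrict_union_le s t) hm).trans ?_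
    rw [Measure.map_add _ _ hm]
    exact add_le_add h h'
  · intro x _
    set a : Vec := WithLp.toLp 2 fun i => x i - 1 / 2
    refine ⟨{y : Vec | ∀ i, y i ∈ Ioc (a i) (a i + 1)}, mem_nhdsWithin_of_mem_nhds ?_, 1,
      by simp, ?_⟩
    · rw [ofPred_forall]
      refine Filter.iInter_mem.2 fun i => ?_
      have hc : Continuous fun y : Vec => y i := by fun_prop
      refine hc.continuousAt (Ioc_mem_nhds ?_ ?_) <;> simp only [a] <;> linarith
    · rw [(measurePreserving_toTorus a).map_eq, one_smul]

lemma quasiMeasurePreserving_toTorus : Measure.QuasiMeasurePreserving toTorus volume volume := by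
  refine ⟨continuous_toTorus.measurable, Measure.AbsolutelyContinuous.mk fun s hs h0 => ?_⟩
  rw [Measure.map_apply continuous_toTorus.measurable hs]
  have hcov : toTorus ⁻¹' s = ⋃ n : ℕ, toTorus ⁻¹' s ∩ Metric.closedBall 0 n := by
    rw [← inter_iUnion, Metric.iUnion_closedBall_nat, inter_univ]
  rw [hcov]
  refine measure_iUnion_null fun n => ?_
  obtain ⟨C, hC, h⟩ := exists_map_restrict_le (isCompact_closedBall (0 : Vec) n)
  have := h s
  rw [Measure.map_apply continuous_toTorus.measurable hs,
    Measure.restrict_apply (continuous_toTorus.measurable hs)] at this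
  simpa [h0] using this

/-- Almost everywhere equality on the torus passes to the integrands of the convolutions. -/
lemma quasiMeasurePreserving_sub_toTorus (x : T3) :
    Measure.QuasiMeasurePreserving (fun y => x - toTorus y) volume volume :=
  (Measure.measurePreserving_sub_left volume x).quasiMeasurePreserving.comp quasiMeasurePreserving_toTorus

lemma conv_congr_ae {k : Vec → ℝ} {f g : T3 → F} (h : f =ᵐ[volume] g) : conv k f = conv k g := by
  ext x
  refine integral_congr_ae ?_
  filter_upwards [(quasiMeasurePreserving_sub_toTorus x).ae_eq_comp h] with y hy
  simp only [Function.comp] at hy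
  rw [hy]

lemma locallyIntegrable_comp_toTorus {F : Type*} [NormedAddCommGroup F] {f : T3 → F} (hf : Integrable f) :
    LocallyIntegrable fun y : Vec => f (toTorus y) := by
  refine locallyIntegrable_iff.2 fun K hK => ?_
  obtain ⟨C, hC, h⟩ := exists_map_restrict_le hK
  have h1 : Integrable f ((volume.restrict K).map toTorus) :=
    (hf.smul_measure hC).mono_measure h
  exact (integrable_map_measure h1.aestronglyMeasurable
    continuous_toTorus.aemeasurable).1 h1

lemma conv_toTorus (k : Vec → ℝ) (f : T3 → F) (x : Vec) :
    conv k f (toTorus x)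
      = convolution k (fun y => f (toTorus y)) (ContinuousLinearMap.lsmul ℝ ℝ) volume x := by
  simp only [conv, convolution_def, toTorus_sub, ContinuousLinearMap.lsmul_apply]

lemma ConvKernel.integrable_smul {k : Vec → ℝ} (hk : ConvKernel k) {f : T3 → F}
    (hf : Integrable f) (x : T3) : Integrable fun y : Vec => k y • f (x - toTorus y) := by
  obtain ⟨z, rfl⟩ := toTorus_surjective x
  have := hk.compact.convolutionExists_left (ContinuousLinearMap.lsmul ℝ ℝ) hk.continuous
    (locallyIntegrable_comp_toTorus hf) z
  simpa only [ConvolutionExistsAt, toTorus_sub, ContinuousLinearMap.lsmul_apply] using this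

lemma ConvKernel.integrable {k : Vec → ℝ} (hk : ConvKernel k) : Integrable k :=
  hk.continuous.integrable_of_hasCompactSupport hk.compact

lemma ConvKernel.continuous_conv {k : Vec → ℝ} (hk : ConvKernel k) {f : T3 → F}
    (hf : Integrable f) : Continuous (conv k f) := by
  refine isOpenQuotientMap_toTorus.isQuotientMap.continuous_iff.2 ?_
  have := hk.compact.continuous_convolution_left (ContinuousLinearMap.lsmul ℝ ℝ) hk.continuous
    (locallyIntegrable_comp_toTorus hf)
  exact this.congr fun x => (conv_toTorus k f x).symm

/-- The convolution with a kernel of compact support maps `L¹` to `L^∞`. -/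
lemma ConvKernel.exists_norm_conv_le {k : Vec → ℝ} (hk : ConvKernel k) :
    ∃ M : ℝ, 0 ≤ M ∧ ∀ {F : Type} [NormedAddCommGroup F] [NormedSpace ℝ F] (f : T3 → F),
      Integrable f → ∀ x, ‖conv k f x‖ ≤ M * ∫ z, ‖f z‖ := by
  obtain ⟨B, hB⟩ := hk.continuous.bounded_above_of_compact_support hk.compact
  have hB0 : 0 ≤ B := (norm_nonneg _).trans (hB 0)
  obtain ⟨C, hC, h⟩ := exists_map_restrict_le hk.compact.isCompact
  refine ⟨B * C.toReal, by positivity, fun {F} _ _ f hf x => ?_⟩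
  have hint : Integrable (fun z => ‖f (x - z)‖) := (hf.comp_sub_left x).norm
  have hintm : Integrable (fun z => ‖f (x - z)‖) ((volume.restrict (tsupport k)).map toTorus) :=
    (hint.smul_measure hC).mono_measure h
  have hint2 : Integrable (fun y => ‖f (x - toTorus y)‖) (volume.restrict (tsupport k)) :=
    (integrable_map_measure hintm.aestronglyMeasurable continuous_toTorus.aemeasurable).1 hintm
  have hset : conv k f x = ∫ y in tsupport k, k y • f (x - toTorus y) := by
    refine (setIntegral_eq_integral_of_forall_compl_eq_zero fun y hy => ?_).symm
    rw [image_eq_zero_of_notMem_tsupport hy, zero_smul]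
  calc ‖conv k f x‖ ≤ ∫ y in tsupport k, B * ‖f (x - toTorus y)‖ := by
        rw [hset]
        refine norm_integral_le_of_norm_le (hint2.const_mul B) (Eventually.of_forall fun y => ?_)
        rw [norm_smul]
        exact mul_le_mul_of_nonneg_right (hB y) (norm_nonneg _)
    _ = B * ∫ z, ‖f (x - z)‖ ∂((volume.restrict (tsupport k)).map toTorus) := by
        rw [integral_const_mul, integral_map continuous_toTorus.aemeasurable
          hintm.aestronglyMeasurable]
    _ ≤ B * ∫ z, ‖f (x - z)‖ ∂(C • volume) := by
        refine mul_le_mul_of_nonneg_left ?_ hB0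
        exact integral_mono_measure h (Eventually.of_forall fun z => norm_nonneg _)
          (hint.smul_measure hC)
    _ = B * C.toReal * ∫ z, ‖f z‖ := by
        rw [integral_smul_measure, integral_sub_left_eq_self (fun z => ‖f z‖), smul_eq_mul,
          mul_assoc]

lemma conv_clm [CompleteSpace F] [CompleteSpace G] (L : F →L[ℝ] G) {k : Vec → ℝ} (hk : ConvKernel k) {f : T3 → F}
    (hf : Integrable f) (x : T3) : conv k (fun z => L (f z)) x = L (conv k f x) := by
  rw [conv, conv, ← L.integral_comp_comm (hk.integrable_smul hf x)]
  simp

lemma conv_add {k : Vec → ℝ} (hk : ConvKernel k) {f g : T3 → F} (hf : Integrable f)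
    (hg : Integrable g) (x : T3) :
    conv k (fun z => f z + g z) x = conv k f x + conv k g x := by
  rw [conv, conv, conv, ← integral_add (hk.integrable_smul hf x) (hk.integrable_smul hg x)]
  simp

lemma conv_smul {k : Vec → ℝ} (c : ℝ) (f : T3 → F) (x : T3) :
    conv k (fun z => c • f z) x = c • conv k f x := by
  rw [conv, conv, ← integral_smul]
  congr 1; ext y; rw [smul_comm]

/-- The partial derivative of a kernel. -/
def kerDeriv (j : Fin 3) (k : Vec → ℝ) (y : Vec) : ℝ := fderiv ℝ k y (EuclideanSpace.single j 1)

lemma ConvKernel.kerDeriv {k : Vec → ℝ} (hk : ConvKernel k) (hs : ContDiff ℝ ∞ k) (j : Fin 3) :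
    ConvKernel (kerDeriv j k) :=
  ⟨(hs.continuous_fderiv (by simp)).clm_apply continuous_const,
    hk.compact.fderiv_apply ℝ _⟩

lemma ConvKernel.smoothT_conv {k : Vec → ℝ} (hk : ConvKernel k) (hs : ContDiff ℝ ∞ k)
    {f : T3 → F} (hf : Integrable f) : SmoothT (conv k f) := by
  have := hk.compact.contDiff_convolution_left (ContinuousLinearMap.lsmul ℝ ℝ) hs
    (locallyIntegrable_comp_toTorus hf)
  unfold SmoothT
  simp_rw [conv_toTorus]
  exact this

/-- A derivative of a convolution may be put on the kernel. -/
lemma pderiv_conv {k : Vec → ℝ} (hk : ConvKernel k) (hs : ContDiff ℝ ∞ k)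
    {f : T3 → F} (hf : Integrable f) (j : Fin 3) (x : T3) :
    pderiv j (conv k f) x = conv (kerDeriv j k) f x := by
  obtain ⟨y, rfl⟩ := toTorus_surjective x
  rw [pderiv_toTorus (hk.smoothT_conv hs hf)]
  have hl := locallyIntegrable_comp_toTorus hf
  have h := hk.compact.hasFDerivAt_convolution_left (ContinuousLinearMap.lsmul ℝ ℝ)
    (hs.of_le (by simp)) hl y
  simp_rw [conv_toTorus k f]
  rw [h.fderiv, conv_toTorus, convolution_def, convolution_def]
  have hex := (hk.compact.fderiv ℝ).convolutionExists_left
    ((ContinuousLinearMap.lsmul ℝ ℝ : ℝ →L[ℝ] F →L[ℝ] F).precompL Vec)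
    (hs.continuous_fderiv (by simp)) hl y
  rw [ContinuousLinearMap.integral_apply hex]
  rfl

/-- For a smooth function the derivative of a convolution may be put on the function. -/
lemma pderiv_conv_right {k : Vec → ℝ} (hk : ConvKernel k) {f : T3 → F} (hf : SmoothT f)
    (j : Fin 3) (x : T3) : pderiv j (conv k f) x = conv k (pderiv j f) x := by
  obtain ⟨C, hC0, hC⟩ := exists_bound_of_continuous (hf.pderiv j).continuous
  let c : ℝ → T3 := fun s => Pi.single j (s : UnitAddCircle)
  have hc0 : c 0 = 0 := by simp [c]
  have hcont : ∀ {g : T3 → F}, Continuous g → ∀ s, Continuous fun y : Vec =>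
      k y • g (x + c s - toTorus y) := fun hg s =>
    hk.continuous.smul (hg.comp (continuous_const.sub continuous_toTorus))
  have hd : HasDerivAt (fun s => ∫ y, k y • f (x + c s - toTorus y))
      (∫ y, k y • TorusNS.pderiv j f (x + c 0 - toTorus y)) 0 :=
    (hasDerivAt_integral_of_dominated_loc_of_deriv_le
      (F' := fun (s : ℝ) y => k y • TorusNS.pderiv j f (x + c s - toTorus y))
      (bound := fun y => ‖k y‖ * C) univ_mem
      (Eventually.of_forall fun s => (hcont hf.continuous s).aestronglyMeasurable)
      (hk.integrable_smul hf.integrable _) (hcont (hf.pderiv j).continuous 0).aestronglyMeasurable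
      (Eventually.of_forall fun y s _ => by
        rw [norm_smul]
        exact mul_le_mul_of_nonneg_left (hC _) (norm_nonneg _))
      (hk.integrable.norm.mul_const C)
      (Eventually.of_forall fun y s _ => by
        have := hf.hasDerivAt j (x - toTorus y) s
        simp only [c, add_sub_right_comm]
        exact this.const_smul (k y))).2
  rw [hc0, add_zero] at hd
  exact hd.deriv

end Convolution

section ConvolutionLTwo

variable {F : Type*} [NormedAddCommGroup F] [InnerProductSpace ℝ F]

lemma ConvKernel.lintegral_conv_sq_le {k : Vec → ℝ} (hk : ConvKernel k) {f : T3 → F}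
    (hf : StronglyMeasurable f) :
    ∫⁻ x, ‖conv k f x‖ₑ ^ (2 : ℝ) ≤ (∫⁻ y, ‖k y‖ₑ) ^ (2 : ℝ) * ∫⁻ x, ‖f x‖ₑ ^ (2 : ℝ) := by
  have hkm : Measurable fun y => ‖k y‖ₑ := hk.continuous.enorm.measurable
  have hfm : Measurable fun x => ‖f x‖ₑ := hf.enorm
  have hsub : Measurable fun p : T3 × Vec => p.1 - toTorus p.2 :=
    (continuous_fst.sub (continuous_toTorus.comp continuous_snd)).measurable
  have hpt : ∀ x, ‖conv k f x‖ₑ ^ (2 : ℝ)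
      ≤ (∫⁻ y, ‖k y‖ₑ) * ∫⁻ y, ‖k y‖ₑ * ‖f (x - toTorus y)‖ₑ ^ (2 : ℝ) := by
    intro x
    have hfx : Measurable fun y => ‖f (x - toTorus y)‖ₑ :=
      hfm.comp (continuous_const.sub continuous_toTorus).measurable
    have h1 : ‖conv k f x‖ₑ ≤ ∫⁻ y, ‖k y‖ₑ ^ (1 / 2 : ℝ)
        * (‖k y‖ₑ * ‖f (x - toTorus y)‖ₑ ^ (2 : ℝ)) ^ (1 / 2 : ℝ) := by
      refine (enorm_integral_le_lintegral_enorm _).trans (lintegral_mono fun y => ?_)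
      rw [enorm_smul, ENNReal.mul_rpow_of_nonneg _ _ (by norm_num), ← mul_assoc,
        ← ENNReal.rpow_add_of_nonneg _ _ (by norm_num) (by norm_num), ← ENNReal.rpow_mul]
      norm_num
    have h2 := ENNReal.lintegral_mul_norm_pow_le hkm.aemeasurable
      (hkm.mul (hfx.pow_const (2 : ℝ))).aemeasurable (μ := volume) (p := 1 / 2) (q := 1 / 2)
      (by norm_num) (by norm_num) (by norm_num)
    calc ‖conv k f x‖ₑ ^ (2 : ℝ) ≤ _ := ENNReal.rpow_le_rpow (h1.trans h2) (by norm_num)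
      _ = _ := by
        rw [ENNReal.mul_rpow_of_nonneg _ _ (by norm_num), ← ENNReal.rpow_mul, ← ENNReal.rpow_mul]
        norm_num
  calc ∫⁻ x, ‖conv k f x‖ₑ ^ (2 : ℝ)
      ≤ ∫⁻ x, (∫⁻ y, ‖k y‖ₑ) * ∫⁻ y, ‖k y‖ₑ * ‖f (x - toTorus y)‖ₑ ^ (2 : ℝ) := lintegral_mono hpt
    _ = (∫⁻ y, ‖k y‖ₑ) * ∫⁻ y, ∫⁻ x, ‖k y‖ₑ * ‖f (x - toTorus y)‖ₑ ^ (2 : ℝ) := by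
        rw [lintegral_const_mul, lintegral_lintegral_swap]
        · exact ((hkm.comp measurable_snd).mul
            ((hfm.comp hsub).pow_const (2 : ℝ))).aemeasurable
        · exact ((hkm.comp measurable_snd).mul
            ((hfm.comp hsub).pow_const (2 : ℝ))).lintegral_prod_right'
    _ = (∫⁻ y, ‖k y‖ₑ) * ∫⁻ y, ‖k y‖ₑ * ∫⁻ x, ‖f x‖ₑ ^ (2 : ℝ) := by
        congr 1; refine lintegral_congr fun y => ?_
        have hm : Measurable fun x => ‖f (x - toTorus y)‖ₑ ^ (2 : ℝ) :=
          (hfm.comp (continuous_id.sub continuous_const).measurable).pow_const (2 : ℝ)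
        rw [lintegral_const_mul _ hm, lintegral_sub_right_eq_self (fun x => ‖f x‖ₑ ^ (2 : ℝ))]
    _ = _ := by
        rw [lintegral_mul_const _ hkm, ← mul_assoc, show (2 : ℝ) = 1 + 1 by norm_num,
          ENNReal.rpow_add_of_nonneg _ _ zero_le_one zero_le_one]
        simp

lemma integrable_L2 {F : Type*} [NormedAddCommGroup F] (f : Lp F 2 (volume : Measure T3)) : Integrable f :=
  (Lp.memLp f).integrable (by norm_num)

lemma ConvKernel.memLp_conv {k : Vec → ℝ} (hk : ConvKernel k)
    (f : Lp F 2 (volume : Measure T3)) : MemLp (conv k f) 2 :=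
  memLp_of_continuous (hk.continuous_conv (integrable_L2 f)) 2

lemma ConvKernel.eLpNorm_conv_le {k : Vec → ℝ} (hk : ConvKernel k)
    (f : Lp F 2 (volume : Measure T3)) :
    eLpNorm (conv k f) 2 volume ≤ ENNReal.ofReal (∫ y, ‖k y‖) * eLpNorm f 2 volume := by
  have h := hk.lintegral_conv_sq_le (Lp.stronglyMeasurable f)
  have e : ∀ g : T3 → F, ∫⁻ x, ‖g x‖ₑ ^ (2 : ℝ) = eLpNorm g 2 volume ^ (2 : ℝ) := fun g =>
    (eLpNorm_nnreal_pow_eq_lintegral (p := 2) (by norm_num)).symm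
  rw [e, e, ← ENNReal.mul_rpow_of_nonneg _ _ (by norm_num),
    ENNReal.rpow_le_rpow_iff (by norm_num), ← ofReal_integral_norm_eq_lintegral_enorm
      hk.integrable] at h
  exact h

/-- Convolution as a bounded operator on `L²`. -/
def convL {k : Vec → ℝ} (hk : ConvKernel k) :
    Lp F 2 (volume : Measure T3) →L[ℝ] Lp F 2 (volume : Measure T3) :=
  LinearMap.mkContinuous
    { toFun := fun f => (hk.memLp_conv f).toLp (conv k f)
      map_add' := fun f g => by
        rw [← MemLp.toLp_add]
        refine MemLp.toLp_congr _ _ (Eventually.of_forall fun x => ?_)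
        rw [conv_congr_ae (Lp.coeFn_add f g)]
        exact conv_add hk (integrable_L2 f) (integrable_L2 g) x
      map_smul' := fun c f => by
        rw [RingHom.id_apply, ← MemLp.toLp_const_smul]
        refine MemLp.toLp_congr _ _ (Eventually.of_forall fun x => ?_)
        rw [conv_congr_ae (Lp.coeFn_smul c f)]
        exact conv_smul c f x } (∫ y, ‖k y‖) fun f => by
    refine (Lp.norm_toLp _ (hk.memLp_conv f)).trans_le ?_
    refine (ENNReal.toReal_mono (by finiteness) (hk.eLpNorm_conv_le f)).trans_eq ?_
    rw [ENNReal.toReal_mul, ENNReal.toReal_ofReal (by positivity), Lp.norm_def]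

lemma coeFn_convL {k : Vec → ℝ} (hk : ConvKernel k) (f : Lp F 2 (volume : Measure T3)) :
    convL hk f =ᵐ[volume] conv k f := MemLp.coeFn_toLp (hk.memLp_conv f)

lemma norm_convL_le {k : Vec → ℝ} (hk : ConvKernel k) (f : Lp F 2 (volume : Measure T3)) :
    ‖convL hk f‖ ≤ (∫ y, ‖k y‖) * ‖f‖ :=
  ContinuousLinearMap.le_of_opNorm_le _
    (LinearMap.mkContinuous_norm_le _ (integral_nonneg fun _ => norm_nonneg _) _) f

lemma norm_le_of_ae_le {F : Type*} [NormedAddCommGroup F] {f : Lp F 2 (volume : Measure T3)} {C : ℝ} (hC : 0 ≤ C)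
    (h : ∀ᵐ x, ‖f x‖ ≤ C) : ‖f‖ ≤ C := by
  have := Lp.norm_le_of_ae_bound hC h
  simpa [measureUnivNNReal] using this

/-- Convolution gains integrability: it is bounded from `L¹` to `L²`. -/
lemma ConvKernel.exists_norm_convL_le {k : Vec → ℝ} (hk : ConvKernel k) :
    ∃ M : ℝ, 0 ≤ M ∧ ∀ {F : Type} [NormedAddCommGroup F] [InnerProductSpace ℝ F]
      (f : Lp F 2 (volume : Measure T3)), ‖convL hk f‖ ≤ M * ∫ x, ‖f x‖ := by
  obtain ⟨M, hM, h⟩ := hk.exists_norm_conv_le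
  refine ⟨M, hM, fun f => norm_le_of_ae_le (by positivity) ?_⟩
  filter_upwards [coeFn_convL hk f] with x hx
  rw [hx]
  exact h _ (integrable_L2 f) x

/-- A continuous function as an element of `L²`. -/
abbrev toL2 (f : C(T3, F)) : Lp F 2 (volume : Measure T3) :=
  ContinuousMap.toLp 2 volume ℝ f

lemma coeFn_toL2 (f : C(T3, F)) : toL2 f =ᵐ[volume] f := ContinuousMap.coeFn_toLp volume f

lemma denseRange_toL2 : DenseRange (toL2 : C(T3, F) → Lp F 2 (volume : Measure T3)) :=
  ContinuousMap.toLp_denseRange F volume ℝ (by norm_num)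

lemma convL_toL2 {k : Vec → ℝ} (hk : ConvKernel k) (f : C(T3, F)) :
    convL hk (toL2 f) =ᵐ[volume] conv k f := by
  filter_upwards [coeFn_convL hk (toL2 f)] with x hx
  rw [hx, conv_congr_ae (coeFn_toL2 f)]

/-- Convolution with an even kernel is self-adjoint. -/
lemma inner_convL [CompleteSpace F] {k : Vec → ℝ} (hk : ConvKernel k) (heven : ∀ y, k (-y) = k y)
    (f g : Lp F 2 (volume : Measure T3)) :
    inner ℝ (convL hk f) g = inner ℝ f (convL hk g) := by
  refine denseRange_toL2.induction_on₂ (p := fun f g => inner ℝ (convL hk f) g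
    = inner ℝ f (convL hk g)) (isClosed_eq (by fun_prop) (by fun_prop)) (fun f g => ?_) f g
  have hcs : Continuous fun p : T3 × Vec => k p.2 * inner ℝ (f (p.1 - toTorus p.2)) (g p.1) := by
    have := hk.continuous
    have := continuous_toTorus
    fun_prop
  have hint : Integrable (Function.uncurry fun (x : T3) (y : Vec) =>
      k y * inner ℝ (f (x - toTorus y)) (g x)) ((volume : Measure T3).prod volume) := by
    refine hcs.integrable_of_hasCompactSupport (HasCompactSupport.intro
      (isCompact_univ.prod hk.compact.isCompact) fun p hp => ?_)
    have : p.2 ∉ tsupport k := fun h => hp ⟨mem_univ _, h⟩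
    rw [image_eq_zero_of_notMem_tsupport this, zero_mul]
  have hcs' : Continuous fun p : T3 × Vec => k p.2 * inner ℝ (f p.1) (g (p.1 - toTorus p.2)) := by
    have := hk.continuous
    have := continuous_toTorus
    fun_prop
  have hint' : Integrable (Function.uncurry fun (x : T3) (y : Vec) =>
      k y * inner ℝ (f x) (g (x - toTorus y))) ((volume : Measure T3).prod volume) := by
    refine hcs'.integrable_of_hasCompactSupport (HasCompactSupport.intro
      (isCompact_univ.prod hk.compact.isCompact) fun p hp => ?_)
    have : p.2 ∉ tsupport k := fun h => hp ⟨mem_univ _, h⟩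
    rw [image_eq_zero_of_notMem_tsupport this, zero_mul]
  have e1 : inner ℝ (convL hk (toL2 f)) (toL2 g)
      = ∫ x, ∫ y, k y * inner ℝ (f (x - toTorus y)) (g x) := by
    rw [L2.inner_def]
    refine integral_congr_ae ?_
    filter_upwards [convL_toL2 hk f, coeFn_toL2 g] with x h1 h2
    rw [h1, h2, conv, real_inner_comm, ← integral_inner
      (hk.integrable_smul (integrable_of_continuous f.continuous) x)]
    refine integral_congr_ae (Eventually.of_forall fun y => ?_)
    simp only [inner_smul_right]
    rw [real_inner_comm]
  have e2 : inner ℝ (toL2 f) (convL hk (toL2 g))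
      = ∫ x, ∫ y, k y * inner ℝ (f x) (g (x - toTorus y)) := by
    rw [L2.inner_def]
    refine integral_congr_ae ?_
    filter_upwards [convL_toL2 hk g, coeFn_toL2 f] with x h1 h2
    rw [h1, h2, conv, ← integral_inner
      (hk.integrable_smul (integrable_of_continuous g.continuous) x)]
    simp only [inner_smul_right]
  rw [e1, e2, integral_integral_swap hint, integral_integral_swap hint']
  rw [← integral_neg_eq_self]
  refine integral_congr_ae (Eventually.of_forall fun y => ?_)
  simp only [heven, toTorus_neg, sub_neg_eq_add]
  rw [← integral_sub_right_eq_self (fun x => k y * inner ℝ (f (x + toTorus y)) (g x)) (toTorus y)]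
  simp

/-! #### Mollification -/

/-- The rescaled kernel `η_δ`. -/
def mollKer (η : Vec → ℝ) (δ : ℝ) (y : Vec) : ℝ := (δ ^ 3)⁻¹ * η (δ⁻¹ • y)

lemma moll_eq_conv (η : Vec → ℝ) (δ : ℝ) (f : T3 → F) : moll η δ f = conv (mollKer η δ) f := rfl

lemma convKernel_mollKer {η : Vec → ℝ} (hη : IsKernel η) {δ : ℝ} (hδ : 0 < δ) :
    ConvKernel (mollKer η δ) := by
  refine ⟨continuous_const.mul (hη.smooth.continuous.comp (continuous_const_smul _)), ?_⟩
  have h := hη.compact.comp_smul (inv_ne_zero hδ.ne')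
  exact h.mul_left (f := fun _ => (δ ^ 3)⁻¹)

lemma contDiff_mollKer {η : Vec → ℝ} (hη : IsKernel η) (δ : ℝ) : ContDiff ℝ ∞ (mollKer η δ) :=
  contDiff_const.mul (hη.smooth.comp (contDiff_const_smul _))

lemma mollKer_nonneg {η : Vec → ℝ} (hη : IsKernel η) {δ : ℝ} (hδ : 0 < δ) (y : Vec) :
    0 ≤ mollKer η δ y :=
  mul_nonneg (by positivity) (hη.nonneg _)

lemma mollKer_neg {η : Vec → ℝ} (hη : IsKernel η) (δ : ℝ) (y : Vec) :
    mollKer η δ (-y) = mollKer η δ y := by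
  rw [mollKer, mollKer, hη.radial (δ⁻¹ • -y) (δ⁻¹ • y) (by simp)]

lemma integral_mollKer {η : Vec → ℝ} (hη : IsKernel η) {δ : ℝ} (hδ : 0 < δ) :
    ∫ y, mollKer η δ y = 1 := by
  simp only [mollKer]
  rw [integral_const_mul, Measure.integral_comp_smul, hη.mass, finrank_euclideanSpace_fin]
  have : 0 < δ ^ 3 := by positivity
  rw [inv_pow, inv_inv, abs_of_pos this, smul_eq_mul, mul_one, inv_mul_cancel₀ this.ne']

/-- Mollification `f ↦ η_δ * f` as a bounded operator on `L²`. -/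
def mollL {η : Vec → ℝ} (hη : IsKernel η) {δ : ℝ} (hδ : 0 < δ) :
    Lp F 2 (volume : Measure T3) →L[ℝ] Lp F 2 (volume : Measure T3) :=
  convL (convKernel_mollKer hη hδ)

lemma coeFn_mollL {η : Vec → ℝ} (hη : IsKernel η) {δ : ℝ} (hδ : 0 < δ)
    (f : Lp F 2 (volume : Measure T3)) : mollL hη hδ f =ᵐ[volume] moll η δ f :=
  coeFn_convL _ f

lemma norm_mollL_le {η : Vec → ℝ} (hη : IsKernel η) {δ : ℝ} (hδ : 0 < δ)
    (f : Lp F 2 (volume : Measure T3)) : ‖mollL hη hδ f‖ ≤ ‖f‖ := by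
  have h := norm_convL_le (convKernel_mollKer hη hδ) f
  simp_rw [Real.norm_of_nonneg (mollKer_nonneg hη hδ _)] at h
  rwa [integral_mollKer hη hδ, one_mul] at h

lemma inner_mollL [CompleteSpace F] {η : Vec → ℝ} (hη : IsKernel η) {δ : ℝ} (hδ : 0 < δ)
    (f g : Lp F 2 (volume : Measure T3)) :
    inner ℝ (mollL hη hδ f) g = inner ℝ f (mollL hη hδ g) :=
  inner_convL _ (mollKer_neg hη δ) f g

/-- The mollifications of a continuous function converge uniformly. -/
lemma eventually_norm_moll_sub_le [CompleteSpace F] {η : Vec → ℝ} (hη : IsKernel η) {δ : ℕ → ℝ}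
    (hδ : ∀ n, 0 < δ n) (hδ0 : Tendsto δ atTop (𝓝 0)) {f : T3 → F} (hf : Continuous f) {ε : ℝ}
    (hε : 0 < ε) : ∀ᶠ n in atTop, ∀ x, ‖moll η (δ n) f x - f x‖ ≤ ε := by
  obtain ⟨d, hd, hfd⟩ := Metric.uniformContinuous_iff.1
    (CompactSpace.uniformContinuous_of_continuous hf) ε hε
  obtain ⟨r, hr, hrd⟩ := Metric.continuousAt_iff.1 (continuous_toTorus.continuousAt (x := 0)) d hd
  obtain ⟨R, hR, hRη⟩ := hη.compact.isCompact.isBounded.exists_pos_norm_le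
  filter_upwards [(hδ0.mul_const R).eventually (gt_mem_nhds (by simpa using hr))] with n hn x
  have hk := convKernel_mollKer hη (hδ n)
  have hint := hk.integrable_smul (integrable_of_continuous hf) x
  have hconst : f x = ∫ y, mollKer η (δ n) y • f x := by
    rw [integral_smul_const, integral_mollKer hη (hδ n), one_smul]
  rw [moll_eq_conv, conv]
  rw [hconst]
  rw [← integral_sub hint (hk.integrable.smul_const _)]
  have hb : ∀ y, ‖mollKer η (δ n) y • f (x - toTorus y) - mollKer η (δ n) y • f x‖
      ≤ mollKer η (δ n) y * ε := by
    intro y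
    rw [← smul_sub, norm_smul, Real.norm_of_nonneg (mollKer_nonneg hη (hδ n) y)]
    by_cases hy : η ((δ n)⁻¹ • y) = 0
    · simp [mollKer, hy]
    · refine mul_le_mul_of_nonneg_left ?_ (mollKer_nonneg hη (hδ n) y)
      have h1 := hRη _ (subset_tsupport _ hy)
      rw [norm_smul, norm_inv, Real.norm_of_nonneg (hδ n).le, inv_mul_le_iff₀ (hδ n)] at h1
      have h2 : dist (toTorus y) (toTorus 0) < d := hrd (by simpa using h1.trans_lt hn)
      rw [toTorus_zero, dist_zero_right] at h2
      rw [← dist_eq_norm]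
      exact (hfd (by simpa [dist_eq_norm] using h2)).le
  calc _ ≤ ∫ y, mollKer η (δ n) y * ε :=
        norm_integral_le_of_norm_le (hk.integrable.mul_const ε) (Eventually.of_forall hb)
    _ = ε := by rw [integral_mul_const, integral_mollKer hη (hδ n), one_mul]

lemma tendsto_mollL [CompleteSpace F] {η : Vec → ℝ} (hη : IsKernel η) {δ : ℕ → ℝ}
    (hδ : ∀ n, 0 < δ n) (hδ0 : Tendsto δ atTop (𝓝 0)) (f : Lp F 2 (volume : Measure T3)) :
    Tendsto (fun n => mollL hη (hδ n) f) atTop (𝓝 f) := by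
  rw [Metric.tendsto_atTop']
  intro ε hε
  obtain ⟨g, hg⟩ := denseRange_toL2.exists_dist_lt f (ε := ε / 4) (by positivity)
  obtain ⟨N, hN⟩ := eventually_atTop.1
    (eventually_norm_moll_sub_le hη hδ hδ0 g.continuous (ε := ε / 4) (by positivity))
  refine ⟨N, fun n hn => ?_⟩
  have h1 : ‖mollL hη (hδ n) (toL2 g) - toL2 g‖ ≤ ε / 4 := by
    refine norm_le_of_ae_le (by positivity) ?_
    filter_upwards [Lp.coeFn_sub (mollL hη (hδ n) (toL2 g)) (toL2 g),
      convL_toL2 (convKernel_mollKer hη (hδ n)) g, coeFn_toL2 g] with x h1 h2 h3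
    rw [h1, Pi.sub_apply, h3]
    exact (congrArg (fun z => ‖z - g x‖) h2).trans_le (hN n hn.le x)
  have h2 := norm_mollL_le hη (hδ n) (f - toL2 g)
  rw [map_sub] at h2
  rw [dist_eq_norm] at hg ⊢
  calc ‖mollL hη (hδ n) f - f‖
      = ‖(mollL hη (hδ n) f - mollL hη (hδ n) (toL2 g)) + (mollL hη (hδ n) (toL2 g) - toL2 g)
        - (f - toL2 g)‖ := by congr 1; abel
    _ ≤ ‖mollL hη (hδ n) f - mollL hη (hδ n) (toL2 g)‖ + ‖mollL hη (hδ n) (toL2 g) - toL2 g‖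
        + ‖f - toL2 g‖ := (norm_sub_le _ _).trans (by gcongr; exact norm_add_le _ _)
    _ < ε := by linarith

end ConvolutionLTwo

/-! ### Mollification of solenoidal fields -/

section MollV

variable {F : Type*} [NormedAddCommGroup F] [InnerProductSpace ℝ F]

lemma ConvKernel.integral_conv [CompleteSpace F] {k : Vec → ℝ} (hk : ConvKernel k) {f : T3 → F}
    (hf : Continuous f) : ∫ x, conv k f x = (∫ y, k y) • ∫ x, f x := by
  have hcs : Continuous fun p : T3 × Vec => k p.2 • f (p.1 - toTorus p.2) := by
    have := hk.continuous
    have := continuous_toTorus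
    fun_prop
  have hint : Integrable (Function.uncurry fun (x : T3) (y : Vec) => k y • f (x - toTorus y))
      ((volume : Measure T3).prod volume) := by
    refine hcs.integrable_of_hasCompactSupport (HasCompactSupport.intro
      (isCompact_univ.prod hk.compact.isCompact) fun p hp => ?_)
    have : p.2 ∉ tsupport k := fun h => hp ⟨mem_univ _, h⟩
    rw [image_eq_zero_of_notMem_tsupport this, zero_smul]
  simp only [conv]
  rw [integral_integral_swap hint, ← integral_smul_const]
  refine integral_congr_ae (Eventually.of_forall fun y => ?_)
  simp only
  rw [integral_smul, integral_sub_right_eq_self]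

lemma SmoothT.conv_smooth [CompleteSpace F] {k : Vec → ℝ} (hk : ConvKernel k)
    (hs : ContDiff ℝ ∞ k) {f : T3 → F} (hf : SmoothT f) : SmoothT (conv k f) :=
  hk.smoothT_conv hs hf.integrable

lemma gradV_conv_right {k : Vec → ℝ} (hk : ConvKernel k) (hs : ContDiff ℝ ∞ k) {f : T3 → Vec}
    (hf : SmoothT f) (x : T3) : gradV (conv k f) x = conv k (gradV f) x := by
  ext ij
  have h1 := pderiv_apply (hf.conv_smooth hk hs) ij.1 ij.2 x
  have h2 := conv_clm (EuclideanSpace.proj ij : Mat →L[ℝ] ℝ) hk hf.gradV.integrable x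
  have h3 := conv_clm (EuclideanSpace.proj ij.1 : Vec →L[ℝ] ℝ) hk (hf.pderiv ij.2).integrable x
  change conv k (fun z => gradV f z ij) x = conv k (gradV f) x ij at h2
  change conv k (fun z => pderiv ij.2 f z ij.1) x = conv k (pderiv ij.2 f) x ij.1 at h3
  rw [← h2]
  change pderiv ij.2 (fun z => conv k f z ij.1) x = _
  rw [h1, pderiv_conv_right hk hf, ← h3]
  congr 1; ext z
  exact (pderiv_apply hf ij.1 ij.2 z).symm

lemma divV_eq_sum_gradV (f : T3 → Vec) (x : T3) : divV f x = ∑ j, gradV f x (j, j) := rfl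

/-- The trace of a matrix. -/
def traceL : Mat →L[ℝ] ℝ := ∑ j, EuclideanSpace.proj (j, j)

lemma traceL_apply (A : Mat) : traceL A = ∑ j, A (j, j) := by
  simp [traceL]

lemma divV_eq_traceL (f : T3 → Vec) (x : T3) : divV f x = traceL (gradV f x) := by
  rw [traceL_apply]; rfl

lemma IsSolenoidal.conv {k : Vec → ℝ} (hk : ConvKernel k) (hs : ContDiff ℝ ∞ k) {f : T3 → Vec}
    (hf : IsSolenoidal f) : IsSolenoidal (conv k f) := by
  refine ⟨hf.1.conv_smooth hk hs, fun x => ?_, ?_⟩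
  · rw [divV_eq_traceL, gradV_conv_right hk hs hf.1, ← conv_clm traceL hk hf.1.gradV.integrable]
    simp_rw [← divV_eq_traceL, hf.2.1]
    simp [TorusNS.conv]
  · rw [hk.integral_conv hf.1.continuous, hf.2.2, smul_zero]

/-- Convolution acts on pairs `(f, A) ∈ L² × L²`. -/
def convW {k : Vec → ℝ} (hk : ConvKernel k) : W →L[ℝ] W :=
  ((WithLp.prodContinuousLinearEquiv 2 ℝ L2Vec L2Mat).symm : (L2Vec × L2Mat) →L[ℝ] W).comp
    (((convL hk).prodMap (convL hk)).comp
      (WithLp.prodContinuousLinearEquiv 2 ℝ L2Vec L2Mat : W →L[ℝ] (L2Vec × L2Mat)))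

lemma convW_toV {k : Vec → ℝ} (hk : ConvKernel k) (hs : ContDiff ℝ ∞ k) {φ : T3 → Vec}
    (hφ : IsSolenoidal φ) : convW hk (toV φ hφ) = toV (conv k φ) (hφ.conv hk hs) := by
  refine (WithLp.ext_iff 2).2 (Prod.ext ?_ ?_) <;> refine Lp.ext ?_
  · filter_upwards [coeFn_convL hk (V.val (toV φ hφ)), toV_val (hφ.conv hk hs)] with x h1 h2
    exact h1.trans ((congrFun (conv_congr_ae (toV_val hφ)) x).trans h2.symm)
  · filter_upwards [coeFn_convL hk (V.grad (toV φ hφ)), toV_grad (hφ.conv hk hs)] with x h1 h2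
    refine h1.trans ((congrFun (conv_congr_ae (toV_grad hφ)) x).trans ?_)
    rw [← gradV_conv_right hk hs hφ.1]
    exact h2.symm

lemma convW_mem {k : Vec → ℝ} (hk : ConvKernel k) (hs : ContDiff ℝ ∞ k) (v : V) :
    convW hk (v : W) ∈ V := by
  refine V_induction (P := fun v => convW hk (v : W) ∈ V) ?_ (fun φ hφ => ?_) v
  · have hV : IsClosed (V : Set W) := Submodule.isClosed_topologicalClosure _
    exact hV.preimage ((convW hk).continuous.comp continuous_subtype_val)
  · rw [convW_toV hk hs hφ]
    exact (toV _ _).2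

/-- Mollification as an operator on `V`. -/
def mollV {η : Vec → ℝ} (hη : IsKernel η) {δ : ℝ} (hδ : 0 < δ) : V →L[ℝ] V :=
  ((convW (convKernel_mollKer hη hδ)).comp V.subtypeL).codRestrict V
    fun v => convW_mem _ (contDiff_mollKer hη δ) v

lemma val_mollV {η : Vec → ℝ} (hη : IsKernel η) {δ : ℝ} (hδ : 0 < δ) (v : V) :
    V.val (mollV hη hδ v) = mollL hη hδ (V.val v) := rfl

lemma grad_mollV {η : Vec → ℝ} (hη : IsKernel η) {δ : ℝ} (hδ : 0 < δ) (v : V) :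
    V.grad (mollV hη hδ v) = mollL hη hδ (V.grad v) := rfl

lemma norm_mollV_le {η : Vec → ℝ} (hη : IsKernel η) {δ : ℝ} (hδ : 0 < δ) (v : V) :
    ‖mollV hη hδ v‖ ≤ ‖v‖ := by
  refine abs_le_of_sq_le_sq' ?_ (norm_nonneg _) |>.2
  rw [norm_sq_V, norm_sq_V, val_mollV, grad_mollV]
  gcongr <;> exact norm_mollL_le _ _ _

lemma tendsto_mollV {η : Vec → ℝ} (hη : IsKernel η) {δ : ℕ → ℝ}
    (hδ : ∀ n, 0 < δ n) (hδ0 : Tendsto δ atTop (𝓝 0)) (v : V) :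
    Tendsto (fun n => mollV hη (hδ n) v) atTop (𝓝 v) := by
  rw [tendsto_iff_norm_sub_tendsto_zero]
  have h1 := (tendsto_iff_norm_sub_tendsto_zero.1 (tendsto_mollL hη hδ hδ0 (V.grad v))).const_mul 2
  rw [mul_zero] at h1
  exact squeeze_zero (fun _ => norm_nonneg _) (fun n => norm_V_le _) h1

lemma integral_norm_le_norm {F : Type*} [NormedAddCommGroup F]
    (f : Lp F 2 (volume : Measure T3)) : ∫ x, ‖f x‖ ≤ ‖f‖ := by
  rw [integral_norm_eq_lintegral_enorm (Lp.aestronglyMeasurable f), ← eLpNorm_one_eq_lintegral_enorm,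
    Lp.norm_def]
  exact ENNReal.toReal_mono (Lp.memLp f).eLpNorm_ne_top
    (eLpNorm_le_eLpNorm_of_exponent_le (by norm_num) (Lp.aestronglyMeasurable f))

/-- The operator `f ↦ ∇(k * f)`, which is bounded on `L²` for a smooth kernel `k`. -/
def gradConvL {k : Vec → ℝ} (hk : ConvKernel k) (hs : ContDiff ℝ ∞ k) : L2Vec →L[ℝ] L2Mat :=
  have hsm : ∀ f : L2Vec, SmoothT (conv k f) := fun f => hk.smoothT_conv hs (integrable_L2 f)
  LinearMap.mkContinuousOfExistsBound
    { toFun := fun f => (memLp_of_continuous (hsm f).gradV.continuous 2).toLp (gradV (conv k f))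
      map_add' := fun f g => by
        rw [← MemLp.toLp_add]
        refine MemLp.toLp_congr _ _ (Eventually.of_forall fun x => ?_)
        rw [conv_congr_ae (Lp.coeFn_add f g), Pi.add_apply, ← gradV_add (hsm f) (hsm g)]
        congr 1; ext1 z
        exact conv_add hk (integrable_L2 f) (integrable_L2 g) z
      map_smul' := fun c f => by
        rw [RingHom.id_apply, ← MemLp.toLp_const_smul]
        refine MemLp.toLp_congr _ _ (Eventually.of_forall fun x => ?_)
        rw [conv_congr_ae (Lp.coeFn_smul c f), Pi.smul_apply, ← gradV_const_smul c (hsm f)]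
        congr 1; ext1 z
        exact conv_smul c f z } <| by
    choose M hM hMb using fun j => (hk.kerDeriv hs j).exists_norm_conv_le
    refine ⟨∑ ij : Fin 3 × Fin 3, M ij.2, fun f => norm_le_of_ae_le ?_ ?_⟩
    · exact mul_nonneg (Finset.sum_nonneg fun ij _ => hM _) (norm_nonneg _)
    filter_upwards [MemLp.coeFn_toLp (memLp_of_continuous (hsm f).gradV.continuous 2)] with x hx
    refine (congrArg norm hx).trans_le ?_
    rw [Finset.sum_mul]
    have hsum : ‖gradV (conv k f) x‖ ≤ ∑ ij : Fin 3 × Fin 3, ‖gradV (conv k f) x ij‖ := by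
      have := (EuclideanSpace.basisFun (Fin 3 × Fin 3) ℝ).sum_repr (gradV (conv k f) x)
      conv_lhs => rw [← this]
      refine (norm_sum_le _ _).trans (Finset.sum_le_sum fun ij _ => ?_)
      simp [norm_smul]
    refine hsum.trans (Finset.sum_le_sum fun ij _ => ?_)
    have h1 : gradV (conv k f) x ij = conv (kerDeriv ij.2 k) f x ij.1 := by
      rw [← pderiv_conv hk hs (integrable_L2 f)]
      exact pderiv_apply (hsm f) ij.1 ij.2 x
    rw [h1]
    refine (PiLp.norm_apply_le _ _).trans ((hMb ij.2 f (integrable_L2 f) x).trans ?_)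
    exact mul_le_mul_of_nonneg_left (integral_norm_le_norm f) (hM _)

lemma coeFn_gradConvL {k : Vec → ℝ} (hk : ConvKernel k) (hs : ContDiff ℝ ∞ k) (f : L2Vec) :
    gradConvL hk hs f =ᵐ[volume] gradV (conv k f) :=
  MemLp.coeFn_toLp
    (memLp_of_continuous (hk.smoothT_conv hs (integrable_L2 f)).gradV.continuous 2)

/-- For fields of `V` the gradient commutes with convolution. -/
lemma gradConvL_val {k : Vec → ℝ} (hk : ConvKernel k) (hs : ContDiff ℝ ∞ k) (v : V) :
    gradConvL hk hs (V.val v) = convL hk (V.grad v) := by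
  refine V_induction (P := fun v => gradConvL hk hs (V.val v) = convL hk (V.grad v))
    (isClosed_eq ((gradConvL hk hs).continuous.comp valL.continuous)
      ((convL hk).continuous.comp gradL.continuous)) (fun φ hφ => Lp.ext ?_) v
  filter_upwards [coeFn_gradConvL hk hs (V.val (toV φ hφ)),
    coeFn_convL hk (V.grad (toV φ hφ))] with x h1 h2
  rw [h1, h2, conv_congr_ae (toV_val hφ), conv_congr_ae (toV_grad hφ), gradV_conv_right hk hs hφ.1]

/-- The flux `J = ν ∇w - R`, with `w` the mollified field and `R` the cumulant, as a function
`V → L²`. -/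
def fluxV (ν : ℝ) {η : Vec → ℝ} (hη : IsKernel η) {δ : ℝ} (hδ : 0 < δ) (v : V) : L2Mat :=
  ν • V.grad (mollV hη hδ v)
    - (mollL hη hδ (tensorV v v) - tensorV (mollV hη hδ v) (mollV hη hδ v))

lemma coeFn_fluxV (ν : ℝ) {η : Vec → ℝ} (hη : IsKernel η) {δ : ℝ} (hδ : 0 < δ) (v : V) :
    fluxV ν hη hδ v =ᵐ[volume] flux ν η δ (V.val v) := by
  have hk := convKernel_mollKer hη hδ
  have hs := contDiff_mollKer hη δ
  have e0 : V.grad (mollV hη hδ v) = gradConvL hk hs (V.val v) := (gradConvL_val hk hs v).symm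
  filter_upwards [Lp.coeFn_sub (ν • V.grad (mollV hη hδ v))
      (mollL hη hδ (tensorV v v) - tensorV (mollV hη hδ v) (mollV hη hδ v)),
    Lp.coeFn_sub (mollL hη hδ (tensorV v v)) (tensorV (mollV hη hδ v) (mollV hη hδ v)),
    Lp.coeFn_smul ν (V.grad (mollV hη hδ v)), coeFn_gradConvL hk hs (V.val v),
    coeFn_mollL hη hδ (tensorV v v), coeFn_tensorV (mollV hη hδ v) (mollV hη hδ v),
    coeFn_mollL hη hδ (V.val v)] with x h1 h2 h3 h4 h5 h6 h7
  rw [fluxV, h1, Pi.sub_apply, h2, h3, Pi.sub_apply, Pi.smul_apply, e0, h4, h5, h6, val_mollV, h7,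
    flux, cumulant]
  congr 2
  exact congrFun (conv_congr_ae (coeFn_tensorV v v)) x

lemma continuous_fluxV (ν : ℝ) {η : Vec → ℝ} (hη : IsKernel η) {δ : ℝ} (hδ : 0 < δ) :
    Continuous (fluxV ν hη hδ) := by
  have h1 : Continuous fun v : V => V.grad (mollV hη hδ v) :=
    gradL.continuous.comp (mollV hη hδ).continuous
  unfold fluxV
  fun_prop

lemma integral_norm_tensorV (v : V) : ∫ x, ‖tensorV v v x‖ = ‖V.val v‖ ^ 2 := by
  rw [norm_sq_L2]
  refine integral_congr_ae ?_
  filter_upwards [coeFn_tensorV v v] with x hx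
  rw [hx, norm_tensor, sq]

/-- The flux is bounded in terms of the energy and the gradient only. -/
lemma exists_norm_fluxV_le (ν : ℝ) {η : Vec → ℝ} (hη : IsKernel η) {δ : ℝ} (hδ : 0 < δ) :
    ∃ C, ∀ v, ‖fluxV ν hη hδ v‖ ≤ |ν| * ‖V.grad v‖ + C * ‖V.val v‖ ^ 2 := by
  obtain ⟨M, hM, h⟩ := (convKernel_mollKer hη hδ).exists_norm_convL_le
  obtain ⟨N, hN, h'⟩ := (convKernel_mollKer hη hδ).exists_norm_conv_le
  refine ⟨M + N ^ 2, fun v => ?_⟩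
  have h1 : ‖ν • V.grad (mollV hη hδ v)‖ ≤ |ν| * ‖V.grad v‖ := by
    rw [norm_smul, Real.norm_eq_abs, grad_mollV]
    gcongr
    exact norm_mollL_le _ _ _
  have h2 : ‖mollL hη hδ (tensorV v v)‖ ≤ M * ‖V.val v‖ ^ 2 :=
    (h (tensorV v v)).trans_eq (by rw [integral_norm_tensorV])
  have h3 : ‖tensorV (mollV hη hδ v) (mollV hη hδ v)‖ ≤ N ^ 2 * ‖V.val v‖ ^ 2 := by
    refine norm_le_of_ae_le (by positivity) ?_
    filter_upwards [coeFn_tensorV (mollV hη hδ v) (mollV hη hδ v), coeFn_mollL hη hδ (V.val v)]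
      with x hx hx'
    rw [hx, norm_tensor, val_mollV, hx', ← sq, ← mul_pow]
    gcongr
    exact (h' _ (integrable_L2 _) x).trans (by gcongr; exact integral_norm_le_norm _)
  calc ‖fluxV ν hη hδ v‖ ≤ _ := (norm_sub_le _ _).trans (add_le_add h1 (norm_sub_le _ _))
    _ ≤ _ := by linarith

end MollV

/-! ### Fourier modes -/

section Modes

/-- The function `cos (2π k·x)` on the torus. -/
def cosMode (k : Fin 3 → ℤ) (x : T3) : ℝ := (UnitAddTorus.mFourier k x).re

/-- The function `sin (2π k·x)` on the torus. -/
def sinMode (k : Fin 3 → ℤ) (x : T3) : ℝ := (UnitAddTorus.mFourier k x).im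

lemma mFourier_toTorus (k : Fin 3 → ℤ) (y : Vec) :
    UnitAddTorus.mFourier k (toTorus y)
      = Complex.exp ((2 * Real.pi * ∑ i, k i * y i : ℝ) * Complex.I) := by
  simp only [UnitAddTorus.mFourier, ContinuousMap.coe_mk, toTorus, fourier_coe_apply]
  rw [← Complex.exp_sum]
  congr 1
  push_cast
  rw [Finset.mul_sum, Finset.sum_mul]
  refine Finset.sum_congr rfl fun i _ => ?_
  ring

lemma cosMode_toTorus (k : Fin 3 → ℤ) (y : Vec) :
    cosMode k (toTorus y) = Real.cos (2 * Real.pi * ∑ i, k i * y i) := by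
  rw [cosMode, mFourier_toTorus, Complex.exp_ofReal_mul_I_re]

lemma sinMode_toTorus (k : Fin 3 → ℤ) (y : Vec) :
    sinMode k (toTorus y) = Real.sin (2 * Real.pi * ∑ i, k i * y i) := by
  rw [sinMode, mFourier_toTorus, Complex.exp_ofReal_mul_I_im]

lemma smoothT_cosMode (k : Fin 3 → ℤ) : SmoothT (cosMode k) := by
  unfold SmoothT
  simp_rw [cosMode_toTorus]
  fun_prop

lemma smoothT_sinMode (k : Fin 3 → ℤ) : SmoothT (sinMode k) := by
  unfold SmoothT
  simp_rw [sinMode_toTorus]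
  fun_prop

lemma hasDerivAt_phase (k : Fin 3 → ℤ) (y : Vec) (j : Fin 3) :
    HasDerivAt (fun s : ℝ => 2 * Real.pi * ∑ i, k i * (y + s • EuclideanSpace.single j 1 : Vec) i)
      (2 * Real.pi * k j) 0 := by
  have h : ∀ s : ℝ, 2 * Real.pi * ∑ i, k i * (y + s • EuclideanSpace.single j 1 : Vec) i
      = 2 * Real.pi * (∑ i, k i * y i) + s * (2 * Real.pi * k j) := by
    intro s
    have : ∀ i, (k i : ℝ) * (y + s • EuclideanSpace.single j 1 : Vec) i
        = k i * y i + s * (k i * (EuclideanSpace.single j 1 : Vec) i) := fun i => by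
      simp only [PiLp.add_apply, PiLp.smul_apply, smul_eq_mul]; ring
    simp_rw [this, Finset.sum_add_distrib, ← Finset.mul_sum]
    simp
    ring
  simp_rw [h]
  simpa using ((hasDerivAt_id (0 : ℝ)).mul_const (2 * Real.pi * k j)).const_add
    (2 * Real.pi * ∑ i, k i * y i)

lemma pderiv_cosMode (k : Fin 3 → ℤ) (j : Fin 3) (x : T3) :
    pderiv j (cosMode k) x = -(2 * Real.pi * k j) * sinMode k x := by
  obtain ⟨y, rfl⟩ := toTorus_surjective x
  have h := (hasDerivAt_phase k y j).cos.deriv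
  simp_rw [← cosMode_toTorus, ← sinMode_toTorus, toTorus_add, toTorus_single] at h
  rw [pderiv, h]
  simp [mul_comm]

lemma pderiv_sinMode (k : Fin 3 → ℤ) (j : Fin 3) (x : T3) :
    pderiv j (sinMode k) x = (2 * Real.pi * k j) * cosMode k x := by
  obtain ⟨y, rfl⟩ := toTorus_surjective x
  have h := (hasDerivAt_phase k y j).sin.deriv
  simp_rw [← cosMode_toTorus, ← sinMode_toTorus, toTorus_add, toTorus_single] at h
  rw [pderiv, h]
  simp [mul_comm]

/-- The real trigonometric functions. -/
def IsMode (k : Fin 3 → ℤ) (m : T3 → ℝ) : Prop := m = cosMode k ∨ m = sinMode k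

lemma IsMode.smoothT {k : Fin 3 → ℤ} {m : T3 → ℝ} (h : IsMode k m) : SmoothT m := by
  rcases h with rfl | rfl
  exacts [smoothT_cosMode k, smoothT_sinMode k]

/-- The eigenvalue `4π²|k|²` of `-Δ` on the modes of frequency `k`. -/
def modeEigenvalue (k : Fin 3 → ℤ) : ℝ := ∑ j, (2 * Real.pi * k j) ^ 2

lemma IsMode.pderiv_pderiv {k : Fin 3 → ℤ} {m : T3 → ℝ} (h : IsMode k m) (i j : Fin 3) (x : T3) :
    pderiv i (pderiv j m) x = -(2 * Real.pi * k i) * (2 * Real.pi * k j) * m x := by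
  rcases h with rfl | rfl
  · rw [funext (pderiv_cosMode k j), pderiv_const_mul _ (smoothT_sinMode k), pderiv_sinMode]
    ring
  · rw [funext (pderiv_sinMode k j), pderiv_const_mul _ (smoothT_cosMode k), pderiv_cosMode]
    ring

lemma IsMode.lapS {k : Fin 3 → ℤ} {m : T3 → ℝ} (h : IsMode k m) (x : T3) :
    lapS m x = -modeEigenvalue k * m x := by
  simp only [TorusNS.lapS, h.pderiv_pderiv, modeEigenvalue, ← Finset.sum_mul, neg_mul,
    Finset.sum_neg_distrib, sq]

lemma modeEigenvalue_nonneg (k : Fin 3 → ℤ) : 0 ≤ modeEigenvalue k :=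
  Finset.sum_nonneg fun _ _ => sq_nonneg _

lemma modeEigenvalue_pos {k : Fin 3 → ℤ} (hk : k ≠ 0) : 0 < modeEigenvalue k := by
  obtain ⟨j, hj⟩ := Function.ne_iff.1 hk
  refine Finset.sum_pos' (fun _ _ => sq_nonneg _) ⟨j, Finset.mem_univ j, ?_⟩
  have : (k j : ℝ) ≠ 0 := by exact_mod_cast hj
  have := Real.pi_pos
  positivity

lemma IsMode.zero {m : T3 → ℝ} (h : IsMode 0 m) : (m = fun _ => 1) ∨ (m = fun _ => 0) := by
  rcases h with rfl | rfl
  · left; ext x; simp [cosMode, UnitAddTorus.mFourier_zero]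
  · right; ext x; simp [sinMode, UnitAddTorus.mFourier_zero]

/-- An integrable function without Fourier coefficients vanishes: it is orthogonal to all continuous
functions, since the trigonometric polynomials are dense in these. -/
lemma ae_eq_zero_of_forall_mode {f : T3 → ℝ} (hf : Integrable f)
    (h : ∀ k m, IsMode k m → ∫ x, f x * m x = 0) : f =ᵐ[volume] 0 := by
  have hbd : ∀ {g : T3 → ℂ}, Continuous g → Integrable fun x => (f x : ℂ) * g x := fun {g} hg => by
    obtain ⟨C, -, hC⟩ := exists_bound_of_continuous hg
    exact hf.ofReal.mul_bdd hg.aestronglyMeasurable (Eventually.of_forall hC)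
  have hbr : ∀ {g : T3 → ℝ}, Continuous g → Integrable fun x => f x * g x := fun {g} hg => by
    obtain ⟨C, -, hC⟩ := exists_bound_of_continuous hg
    exact hf.mul_bdd hg.aestronglyMeasurable (Eventually.of_forall hC)
  let Λ : C(T3, ℂ) →L[ℂ] ℂ := LinearMap.mkContinuous
    { toFun := fun g => ∫ x, (f x : ℂ) * g x
      map_add' := fun g g' => by
        rw [← integral_add (hbd g.continuous) (hbd g'.continuous)]
        simp [mul_add]
      map_smul' := fun c g => by
        rw [RingHom.id_apply, smul_eq_mul, ← integral_const_mul]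
        congr 1; ext x; simp; ring } (∫ x, ‖f x‖) fun g => by
      rw [← integral_mul_const]
      refine norm_integral_le_of_norm_le (hf.norm.mul_const _) (Eventually.of_forall fun x => ?_)
      rw [norm_mul, Complex.norm_real]
      gcongr
      exact g.norm_coe_le_norm x
  have hΛ : ∀ g, Λ g = 0 := by
    intro g
    have hle : (Submodule.span ℂ (range (UnitAddTorus.mFourier (d := Fin 3)))).topologicalClosure
        ≤ LinearMap.ker (Λ : C(T3, ℂ) →ₗ[ℂ] ℂ) := by
      refine Submodule.topologicalClosure_minimal _ (Submodule.span_le.2 ?_) Λ.isClosed_ker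
      rintro _ ⟨k, rfl⟩
      have e : ∀ x, (f x : ℂ) * UnitAddTorus.mFourier k x
          = ((f x * cosMode k x : ℝ) : ℂ) + ((f x * sinMode k x : ℝ) : ℂ) * Complex.I := by
        intro x
        apply Complex.ext <;> simp [cosMode, sinMode]
      change ∫ x, (f x : ℂ) * UnitAddTorus.mFourier k x = 0
      simp_rw [e]
      rw [integral_add (hbr (smoothT_cosMode k).continuous).ofReal
        ((hbr (smoothT_sinMode k).continuous).ofReal.mul_const _), integral_mul_const,
        integral_complex_ofReal, integral_complex_ofReal, h k _ (Or.inl rfl), h k _ (Or.inr rfl)]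
      simp
    rw [UnitAddTorus.span_mFourier_closure_eq_top] at hle
    exact hle Submodule.mem_top
  have hreal : ∀ g : T3 → ℝ, Continuous g → ∫ x, f x * g x = 0 := by
    intro g hg
    have := hΛ ⟨fun x => (g x : ℂ), by fun_prop⟩
    change ∫ x, (f x : ℂ) * (g x : ℂ) = 0 at this
    simp_rw [← Complex.ofReal_mul] at this
    rw [integral_complex_ofReal] at this
    exact_mod_cast this
  refine ae_eq_zero_of_forall_setIntegral_isClosed_eq_zero hf fun s hs => ?_
  have hpos : ∀ n : ℕ, 0 < 1 / ((n : ℝ) + 1) := fun n => by positivity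
  have hlim := thickenedIndicator_tendsto_indicator_closure hpos
    tendsto_one_div_add_atTop_nhds_zero_nat s
  rw [tendsto_pi_nhds, hs.closure_eq] at hlim
  have hdct : Tendsto (fun n : ℕ => ∫ x, f x * thickenedIndicator (hpos n) s x) atTop
      (𝓝 (∫ x, s.indicator f x)) := by
    refine tendsto_integral_of_dominated_convergence (fun x => ‖f x‖) (fun n => ?_) hf.norm
      (fun n => Eventually.of_forall fun x => ?_) (Eventually.of_forall fun x => ?_)
    · exact (hbr (g := fun x => (thickenedIndicator (hpos n) s x : ℝ))
        (NNReal.continuous_coe.comp (thickenedIndicator (hpos n) s).continuous)).1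
    · rw [norm_mul, Real.norm_of_nonneg (r := ((thickenedIndicator (hpos n) s x : NNReal) : ℝ))
        NNReal.zero_le_coe]
      exact mul_le_of_le_one_right (norm_nonneg _)
        (by exact_mod_cast thickenedIndicator_le_one (hpos n) s x)
    · have h1 := (NNReal.continuous_coe.tendsto _).comp (hlim x)
      have h2 : s.indicator f x = f x * ((s.indicator (fun _ => (1 : NNReal)) x : NNReal) : ℝ) := by
        by_cases hx : x ∈ s <;> simp [hx]
      rw [h2]
      exact h1.const_mul (f x)
  rw [← integral_indicator hs.measurableSet]
  refine tendsto_nhds_unique hdct ?_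
  have e0 : ∀ n : ℕ, ∫ x, f x * (thickenedIndicator (hpos n) s x : ℝ) = 0 := fun n =>
    hreal _ (NNReal.continuous_coe.comp (thickenedIndicator (hpos n) s).continuous)
  simp_rw [e0]
  exact tendsto_const_nhds

/-! ### The space `H¹` of all periodic fields -/

/-- The closure in `H¹` of all smooth vector fields, as a space of pairs `(f, ∇f)`. -/
def H1 : Submodule ℝ W :=
  (Submodule.span ℝ {w : W | ∃ f, ∃ hf : SmoothT f, w = smoothPair f hf}).topologicalClosure

lemma smoothPair_mem_H1 {f : T3 → Vec} (hf : SmoothT f) : smoothPair f hf ∈ H1 :=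
  Submodule.le_topologicalClosure _ (Submodule.subset_span ⟨f, hf, rfl⟩)

lemma H1_le {M : Submodule ℝ W} (hM : IsClosed (M : Set W))
    (h : ∀ f (hf : SmoothT f), smoothPair f hf ∈ M) : H1 ≤ M := by
  refine Submodule.topologicalClosure_minimal _ (Submodule.span_le.2 ?_) hM
  rintro _ ⟨f, hf, rfl⟩
  exact h f hf

lemma inner_toL2 {F : Type*} [NormedAddCommGroup F] [InnerProductSpace ℝ F] (g : C(T3, F))
    (f : Lp F 2 (volume : Measure T3)) : inner ℝ (toL2 g) f = ∫ x, inner ℝ (g x) (f x) := by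
  rw [L2.inner_def]
  refine integral_congr_ae ?_
  filter_upwards [coeFn_toL2 g] with x hx
  rw [hx]

/-- The second component of an element of `H¹` is the weak gradient of the first. -/
lemma weak_gradient {w : W} (hw : w ∈ H1) {ψ : T3 → ℝ} (hψ : SmoothT ψ) (i j : Fin 3) :
    ∫ x, w.snd x (i, j) * ψ x = -∫ x, w.fst x i * pderiv j ψ x := by
  let g1 : C(T3, Mat) := ⟨fun x => ψ x • EuclideanSpace.single (i, j) 1,
    hψ.continuous.smul continuous_const⟩
  let g2 : C(T3, Vec) := ⟨fun x => pderiv j ψ x • EuclideanSpace.single i 1,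
    (hψ.pderiv j).continuous.smul continuous_const⟩
  let L : W →L[ℝ] ℝ := (innerSL ℝ (toL2 g1)).comp (WithLp.sndL 2 ℝ L2Vec L2Mat)
    + (innerSL ℝ (toL2 g2)).comp (WithLp.fstL 2 ℝ L2Vec L2Mat)
  have hL : ∀ w, L w = (∫ x, w.snd x (i, j) * ψ x) + ∫ x, w.fst x i * pderiv j ψ x := by
    intro w
    change inner ℝ (toL2 g1) w.snd + inner ℝ (toL2 g2) w.fst = _
    rw [inner_toL2, inner_toL2]
    congr 1 <;> refine integral_congr_ae (Eventually.of_forall fun x => ?_) <;>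
      simp [g1, g2, inner_smul_left, EuclideanSpace.inner_single_left, mul_comm]
  have hle : H1 ≤ LinearMap.ker (L : W →ₗ[ℝ] ℝ) := by
    refine H1_le L.isClosed_ker fun f hf => ?_
    change L _ = 0
    rw [hL]
    have e1 : ∫ x, (smoothPair f hf).snd x (i, j) * ψ x
        = ∫ x, pderiv j (fun z => f z i) x * ψ x := by
      refine integral_congr_ae ?_
      filter_upwards [smoothPair_snd hf] with x hx
      rw [hx]; rfl
    have e2 : ∫ x, (smoothPair f hf).fst x i * pderiv j ψ x = ∫ x, f x i * pderiv j ψ x := by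
      refine integral_congr_ae ?_
      filter_upwards [smoothPair_fst hf] with x hx
      rw [hx]
    rw [e1, e2, integral_mul_pderiv (hf.apply i) hψ]
    ring
  have := hle hw
  change L w = 0 at this
  rw [hL] at this
  linarith

end Modes

section Density

lemma integrable_mul_of_continuous {f g : T3 → ℝ} (hf : Integrable f) (hg : Continuous g) :
    Integrable fun x => f x * g x := by
  obtain ⟨C, -, hC⟩ := exists_bound_of_continuous hg
  exact hf.mul_bdd hg.aestronglyMeasurable (Eventually.of_forall hC)

lemma integrable_apply {ι : Type*} [Fintype ι] (f : Lp (EuclideanSpace ℝ ι) 2 (volume : Measure T3))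
    (i : ι) : Integrable fun x => f x i :=
  (EuclideanSpace.proj i : EuclideanSpace ℝ ι →L[ℝ] ℝ).integrable_comp (integrable_L2 f)

lemma inner_smoothPair {f : T3 → Vec} (hf : SmoothT f) (w : W) :
    inner ℝ (smoothPair f hf) w
      = (∫ x, inner ℝ (f x) (w.fst x)) + ∫ x, inner ℝ (gradV f x) (w.snd x) := by
  rw [WithLp.prod_inner_apply]
  change inner ℝ (smoothPair f hf).fst w.fst + inner ℝ (smoothPair f hf).snd w.snd = _
  rw [L2.inner_def, L2.inner_def]
  congr 1 <;> refine integral_congr_ae ?_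
  · filter_upwards [smoothPair_fst hf] with x hx
    rw [hx]
  · filter_upwards [smoothPair_snd hf] with x hx
    rw [hx]

lemma gradV_smul_const {m : T3 → ℝ} (hm : SmoothT m) (a : Vec) (x : T3) (i j : Fin 3) :
    gradV (fun x => m x • a) x (i, j) = pderiv j m x * a i := by
  change pderiv j (fun z => m z * a i) x = _
  have := pderiv_smul hm (smoothT_const (a i)) j x
  rw [pderiv_const] at this
  simpa using this

lemma smoothT_smul_const {m : T3 → ℝ} (hm : SmoothT m) (a : Vec) : SmoothT fun x => m x • a :=
  hm.smul (smoothT_const a)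

/-- The trigonometric fields are dense in `H¹`: an element `(f, ∇f)` of `H¹` orthogonal to the mode
`m` in the direction `i` satisfies `(1 + 4π²|k|²) ∫ fᵢ m = 0`. -/
lemma H1_le_of_modes {M : Submodule ℝ W} (hM : IsClosed (M : Set W))
    (h : ∀ k m (hm : IsMode k m) (a : Vec), smoothPair _ (smoothT_smul_const hm.smoothT a) ∈ M) :
    H1 ≤ M := by
  let S : Set W := {w | ∃ k m, ∃ hm : IsMode k m, ∃ a : Vec,
    w = smoothPair _ (smoothT_smul_const hm.smoothT a)}
  let E := (Submodule.span ℝ S).topologicalClosure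
  have hEM : E ≤ M := by
    refine Submodule.topologicalClosure_minimal _ (Submodule.span_le.2 ?_) hM
    rintro _ ⟨k, m, hm, a, rfl⟩
    exact h k m hm a
  have hEH : E ≤ H1 := by
    refine Submodule.topologicalClosure_mono (Submodule.span_mono ?_)
    rintro _ ⟨k, m, hm, a, rfl⟩
    exact ⟨_, _, rfl⟩
  have : CompleteSpace E := (Submodule.isClosed_topologicalClosure _).completeSpace_coe
  intro w hw
  refine hEM ?_
  rw [← Submodule.starProjection_eq_self_iff, ← sub_eq_zero, ← neg_eq_zero, neg_sub]
  set y := w - E.starProjection w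
  have hyH : y ∈ H1 := H1.sub_mem hw (hEH (E.starProjection_apply_mem w))
  have hyE : ∀ k m (hm : IsMode k m) (a : Vec),
      inner ℝ (smoothPair _ (smoothT_smul_const hm.smoothT a)) y = 0 := fun k m hm a =>
    (Submodule.mem_orthogonal _ _).1 (E.sub_starProjection_mem_orthogonal w) _
      (Submodule.le_topologicalClosure _ (Submodule.subset_span ⟨k, m, hm, a, rfl⟩))
  have hfst : ∀ i, (fun x => y.fst x i) =ᵐ[volume] 0 := by
    intro i
    refine ae_eq_zero_of_forall_mode (integrable_apply _ i) fun k m hm => ?_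
    have h0 := hyE k m hm (EuclideanSpace.single i 1)
    rw [inner_smoothPair] at h0
    have e1 : ∫ x, inner ℝ (m x • (EuclideanSpace.single i 1 : Vec)) (y.fst x)
        = ∫ x, y.fst x i * m x := by
      refine integral_congr_ae (Eventually.of_forall fun x => ?_)
      simp [inner_smul_left, EuclideanSpace.inner_single_left, mul_comm]
    have e2 : ∫ x, inner ℝ (gradV (fun x => m x • (EuclideanSpace.single i 1 : Vec)) x) (y.snd x)
        = ∑ j, ∫ x, y.snd x (i, j) * pderiv j m x := by
      rw [← integral_finsetSum _ fun j _ => integrable_mul_of_continuous (integrable_apply _ _)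
        (hm.smoothT.pderiv j).continuous]
      refine integral_congr_ae (Eventually.of_forall fun x => ?_)
      simp only [PiLp.inner_apply, Fintype.sum_prod_type, gradV_smul_const hm.smoothT]
      simp [mul_comm]
    have e3 : ∀ j, ∫ x, y.snd x (i, j) * pderiv j m x
        = (2 * Real.pi * k j) ^ 2 * ∫ x, y.fst x i * m x := by
      intro j
      rw [weak_gradient hyH (hm.smoothT.pderiv j), ← integral_const_mul, ← integral_neg]
      refine integral_congr_ae (Eventually.of_forall fun x => ?_)
      simp only [hm.pderiv_pderiv]
      ring
    rw [e1, e2, Finset.sum_congr rfl fun j _ => e3 j, ← Finset.sum_mul] at h0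
    have hk0 := modeEigenvalue_nonneg k
    rw [modeEigenvalue] at hk0
    have h1 : (1 + ∑ j, (2 * Real.pi * k j) ^ 2) * ∫ x, y.fst x i * m x = 0 := by linarith
    exact (mul_eq_zero.1 h1).resolve_left (by positivity)
  have hsnd : ∀ i j, (fun x => y.snd x (i, j)) =ᵐ[volume] 0 := by
    intro i j
    refine ae_eq_zero_of_forall_mode (integrable_apply _ (i, j)) fun k m hm => ?_
    rw [weak_gradient hyH hm.smoothT, neg_eq_zero]
    refine integral_eq_zero_of_ae ?_
    filter_upwards [hfst i] with x hx
    rw [hx]; simp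
  refine (WithLp.ext_iff 2).2 (Prod.ext ?_ ?_) <;> refine Lp.ext ?_
  · have h1 := ae_all_iff.2 hfst
    filter_upwards [h1, Lp.coeFn_zero Vec 2 (volume : Measure T3)] with x hx h0
    refine Eq.trans ?_ h0.symm
    ext i; exact hx i
  · have h1 := ae_all_iff.2 fun i => ae_all_iff.2 (hsnd i)
    filter_upwards [h1, Lp.coeFn_zero Mat 2 (volume : Measure T3)] with x hx h0
    refine Eq.trans ?_ h0.symm
    ext ij; exact hx ij.1 ij.2

end Density

/-! ### The pressure -/

section Pressure

/-- `L²(𝕋³; ℝ)`. -/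
abbrev L2Real : Type := Lp ℝ 2 (volume : Measure T3)

/-- The Hessian of a scalar function. -/
def hess (ψ : T3 → ℝ) (x : T3) : Mat :=
  WithLp.toLp 2 fun ij : Fin 3 × Fin 3 => pderiv ij.1 (pderiv ij.2 ψ) x

lemma SmoothT.hess {ψ : T3 → ℝ} (hψ : SmoothT ψ) : SmoothT (hess ψ) :=
  SmoothT.toLp fun ij => (hψ.pderiv ij.2).pderiv ij.1

/-- The pair `(Δψ, D²ψ)`. -/
def hessPair (ψ : T3 → ℝ) (hψ : SmoothT ψ) : WithLp 2 (L2Real × L2Mat) :=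
  WithLp.toLp 2 (toL2 ⟨lapS ψ, hψ.lapS.continuous⟩, toL2 ⟨hess ψ, hψ.hess.continuous⟩)

/-- On the torus `‖Δψ‖ = ‖D²ψ‖`, here in polarised form. -/
lemma integral_inner_hess {ψ χ : T3 → ℝ} (hψ : SmoothT ψ) (hχ : SmoothT χ) :
    ∫ x, inner ℝ (hess ψ x) (hess χ x) = ∫ x, lapS ψ x * lapS χ x := by
  have hc : ∀ {f : T3 → ℝ}, SmoothT f → ∀ i j, SmoothT (pderiv i (pderiv j f)) :=
    fun hf i j => (hf.pderiv j).pderiv i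
  have key : ∀ i j, ∫ x, pderiv i (pderiv j ψ) x * pderiv i (pderiv j χ) x
      = ∫ x, pderiv i (pderiv i ψ) x * pderiv j (pderiv j χ) x := by
    intro i j
    have e : pderiv i (pderiv i (pderiv j ψ)) = pderiv j (pderiv i (pderiv i ψ)) := by
      funext x
      rw [← pderiv_comm (hψ.pderiv i) i j x]
      congr 1; ext z; exact pderiv_comm hψ i j z
    rw [integral_mul_pderiv (hc hψ i j) (hχ.pderiv j),
      integral_mul_pderiv (hc hψ i i) (hχ.pderiv j), e]
  have hi : ∀ {f g : T3 → ℝ}, SmoothT f → SmoothT g → Integrable fun x => f x * g x :=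
    fun hf hg => (hf.mul hg).integrable
  simp only [PiLp.inner_apply, Fintype.sum_prod_type, lapS, Finset.sum_mul_sum]
  have hi' : ∀ i j, Integrable fun x => inner ℝ (TorusNS.hess ψ x (i, j)) (TorusNS.hess χ x (i, j)) :=
    fun i j => hi (hc hχ i j) (hc hψ i j)
  rw [integral_finsetSum _ fun i _ => integrable_finsetSum _ fun j _ => hi' i j,
    integral_finsetSum _ fun i _ => integrable_finsetSum _ fun j _ => hi (hc hψ i i) (hc hχ j j)]
  refine Finset.sum_congr rfl fun i _ => ?_
  rw [integral_finsetSum _ fun j _ => hi (hc hψ i i) (hc hχ j j),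
    integral_finsetSum _ fun j _ => hi' i j]
  refine Finset.sum_congr rfl fun j _ => ?_
  rw [← key i j]
  exact integral_congr_ae (Eventually.of_forall fun x => mul_comm _ _)

/-- The closure in `L²` of the pairs `(Δψ, D²ψ)`. -/
def hessPairs : Submodule ℝ (WithLp 2 (L2Real × L2Mat)) :=
  (Submodule.span ℝ {w | ∃ ψ, ∃ hψ : SmoothT ψ, w = hessPair ψ hψ}).topologicalClosure

instance : CompleteSpace hessPairs :=
  (Submodule.isClosed_topologicalClosure _).completeSpace_coe

lemma hessPair_mem {ψ : T3 → ℝ} (hψ : SmoothT ψ) : hessPair ψ hψ ∈ hessPairs :=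
  Submodule.le_topologicalClosure _ (Submodule.subset_span ⟨ψ, hψ, rfl⟩)

lemma hessPairs_le_ker {L : WithLp 2 (L2Real × L2Mat) →L[ℝ] ℝ}
    (h : ∀ ψ (hψ : SmoothT ψ), L (hessPair ψ hψ) = 0) {w : WithLp 2 (L2Real × L2Mat)}
    (hw : w ∈ hessPairs) : L w = 0 := by
  have hle : hessPairs ≤ LinearMap.ker (L : WithLp 2 (L2Real × L2Mat) →ₗ[ℝ] ℝ) := by
    refine Submodule.topologicalClosure_minimal _ (Submodule.span_le.2 ?_) L.isClosed_ker
    rintro _ ⟨ψ, hψ, rfl⟩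
    exact h ψ hψ
  exact hle hw

lemma inner_fst_hessPair {w : WithLp 2 (L2Real × L2Mat)} (hw : w ∈ hessPairs) {ψ : T3 → ℝ}
    (hψ : SmoothT ψ) :
    inner ℝ (hessPair ψ hψ).fst w.fst = inner ℝ (hessPair ψ hψ).snd w.snd := by
  let L : WithLp 2 (L2Real × L2Mat) →L[ℝ] ℝ :=
    (innerSL ℝ (hessPair ψ hψ).fst).comp (WithLp.fstL 2 ℝ L2Real L2Mat)
      - (innerSL ℝ (hessPair ψ hψ).snd).comp (WithLp.sndL 2 ℝ L2Real L2Mat)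
  have h : L w = 0 := by
    refine hessPairs_le_ker (fun χ hχ => ?_) hw
    change inner ℝ (toL2 ⟨lapS ψ, hψ.lapS.continuous⟩) (toL2 ⟨lapS χ, hχ.lapS.continuous⟩)
      - inner ℝ (toL2 ⟨hess ψ, hψ.hess.continuous⟩) (toL2 ⟨hess χ, hχ.hess.continuous⟩) = 0
    rw [inner_toL2, inner_toL2, sub_eq_zero]
    have e1 : ∫ x, inner ℝ (hess ψ x) (toL2 ⟨hess χ, hχ.hess.continuous⟩ x)
        = ∫ x, inner ℝ (hess ψ x) (hess χ x) := by
      refine integral_congr_ae ?_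
      filter_upwards [coeFn_toL2 ⟨hess χ, hχ.hess.continuous⟩] with x hx
      rw [hx]; rfl
    refine Eq.trans ?_ ((integral_inner_hess hψ hχ).symm.trans e1.symm)
    refine integral_congr_ae ?_
    filter_upwards [coeFn_toL2 ⟨lapS χ, hχ.lapS.continuous⟩] with x hx
    rw [hx]
    exact mul_comm _ _
  exact sub_eq_zero.1 h

/-- The pressure operator, which maps a matrix field `F ∈ L²` to the mean zero solution `q ∈ L²` of
`-Δq = ∑ ∂ᵢ∂ⱼ Fᵢⱼ`. As `‖Δψ‖ = ‖D²ψ‖`, the solution is twice the first component of the projection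
of `(0, -F)` onto the closure of the pairs `(Δψ, D²ψ)`. -/
def pressureL : L2Mat →L[ℝ] L2Real :=
  (2 : ℝ) • (WithLp.fstL 2 ℝ L2Real L2Mat).comp (hessPairs.starProjection.comp
    (((WithLp.prodContinuousLinearEquiv 2 ℝ L2Real L2Mat).symm :
      (L2Real × L2Mat) →L[ℝ] WithLp 2 (L2Real × L2Mat)).comp
        (-(ContinuousLinearMap.inr ℝ L2Real L2Mat))))

lemma inner_lap_pressureL (F : L2Mat) {ψ : T3 → ℝ} (hψ : SmoothT ψ) :
    inner ℝ (hessPair ψ hψ).fst (pressureL F) = -inner ℝ (hessPair ψ hψ).snd F := by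
  set p : WithLp 2 (L2Real × L2Mat) := WithLp.toLp 2 (0, -F)
  have e : pressureL F = (2 : ℝ) • (hessPairs.starProjection p).fst := by
    have : p = WithLp.toLp 2 (-(0, F) : L2Real × L2Mat) := by simp [p]
    rw [this]; rfl
  have h1 := inner_fst_hessPair (hessPairs.starProjection_apply_mem p) hψ
  have h2 : inner ℝ (hessPair ψ hψ) (hessPairs.starProjection p) = inner ℝ (hessPair ψ hψ) p := by
    rw [← Submodule.inner_starProjection_left_eq_right,
      Submodule.starProjection_eq_self_iff.2 (hessPair_mem hψ)]
  rw [WithLp.prod_inner_apply, WithLp.prod_inner_apply] at h2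
  change inner ℝ (hessPair ψ hψ).fst (hessPairs.starProjection p).fst
    + inner ℝ (hessPair ψ hψ).snd (hessPairs.starProjection p).snd
      = inner ℝ (hessPair ψ hψ).fst 0 + inner ℝ (hessPair ψ hψ).snd (-F) at h2
  rw [e, inner_smul_right]
  rw [inner_zero_right, inner_neg_right] at h2
  linarith

lemma integral_lapS {ψ : T3 → ℝ} (hψ : SmoothT ψ) : ∫ x, lapS ψ x = 0 := by
  simp only [lapS]
  rw [integral_finsetSum _ fun j _ => ((hψ.pderiv j).pderiv j).integrable]
  exact Finset.sum_eq_zero fun j _ => integral_pderiv (hψ.pderiv j) j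

lemma integral_pressureL (F : L2Mat) : ∫ x, pressureL F x = 0 := by
  let L : WithLp 2 (L2Real × L2Mat) →L[ℝ] ℝ :=
    (innerSL ℝ (toL2 (1 : C(T3, ℝ)))).comp (WithLp.fstL 2 ℝ L2Real L2Mat)
  have hL : ∀ w : WithLp 2 (L2Real × L2Mat), L w = ∫ x, w.fst x := by
    intro w
    change inner ℝ (toL2 (1 : C(T3, ℝ))) w.fst = _
    rw [inner_toL2]
    simp
  set p : WithLp 2 (L2Real × L2Mat) := WithLp.toLp 2 (-(0, F) : L2Real × L2Mat)
  have h0 : L (hessPairs.starProjection p) = 0 := by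
    refine hessPairs_le_ker (fun ψ hψ => ?_) (hessPairs.starProjection_apply_mem p)
    rw [hL, ← integral_lapS hψ]
    exact integral_congr_ae (coeFn_toL2 ⟨lapS ψ, hψ.lapS.continuous⟩)
  have e : pressureL F = ((2 : ℝ) • hessPairs.starProjection p).fst := rfl
  rw [e, ← hL, map_smul, h0, smul_zero]

lemma integral_pressureL_mul_lapS (F : L2Mat) {ψ : T3 → ℝ} (hψ : SmoothT ψ) :
    -(∫ x, pressureL F x * lapS ψ x) = ∫ x, inner ℝ (hess ψ x) (F x) := by
  have h := inner_lap_pressureL F hψ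
  change inner ℝ (toL2 ⟨lapS ψ, hψ.lapS.continuous⟩) (pressureL F)
    = -inner ℝ (toL2 ⟨hess ψ, hψ.hess.continuous⟩) F at h
  rw [inner_toL2, inner_toL2] at h
  rw [← neg_eq_iff_eq_neg] at h
  exact h

/-- A mean zero function annihilated by `Δ` vanishes. -/
lemma ae_eq_zero_of_integral_mul_lapS {f : T3 → ℝ} (hf : Integrable f) (h0 : ∫ x, f x = 0)
    (h : ∀ ψ : T3 → ℝ, SmoothT ψ → ∫ x, f x * lapS ψ x = 0) : f =ᵐ[volume] 0 := by
  refine ae_eq_zero_of_forall_mode hf fun k m hm => ?_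
  rcases eq_or_ne k 0 with rfl | hk
  · rcases hm.zero with rfl | rfl
    · simpa using h0
    · simp
  · have h1 := h m hm.smoothT
    simp only [hm.lapS] at h1
    have h2 : ∫ x, f x * (-modeEigenvalue k * m x) = -modeEigenvalue k * ∫ x, f x * m x := by
      rw [← integral_const_mul]
      exact integral_congr_ae (Eventually.of_forall fun x => by simp only []; ring)
    have h3 := (modeEigenvalue_pos hk).ne'
    rw [h2] at h1
    exact (mul_eq_zero.1 h1).resolve_left (neg_ne_zero.2 h3)

end Pressure

/-! ### The evolution of the mollified field -/

section Force

lemma H_le_ker {L : L2Vec →L[ℝ] ℝ} (h : ∀ φ (hφ : IsSolenoidal φ), L (V.val (toV φ hφ)) = 0)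
    {f : L2Vec} (hf : f ∈ H) : L f = 0 := by
  have hle : H ≤ LinearMap.ker (L : L2Vec →ₗ[ℝ] ℝ) := by
    refine Submodule.topologicalClosure_minimal _ (Submodule.span_le.2 ?_) L.isClosed_ker
    rintro f ⟨φ, hφ, hf⟩
    have e : f = V.val (toV φ hφ) := Lp.ext (hf.trans (toV_val hφ).symm)
    rw [e]
    exact h φ hφ
  exact hle hf

lemma val_mem_H (v : V) : V.val v ∈ H := by
  refine V_induction (P := fun v => V.val v ∈ H) ?_ (fun φ hφ => ?_) v
  · have hH : IsClosed (H : Set L2Vec) := Submodule.isClosed_topologicalClosure _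
    exact hH.preimage valL.continuous
  · exact Submodule.le_topologicalClosure _ (Submodule.subset_span ⟨φ, hφ, toV_val hφ⟩)

/-- A continuous function as an element of `L²`, tested against a field of `H`. -/
lemma inner_eq_zero_of_mem_H {ψ : C(T3, Vec)}
    (h : ∀ φ, IsSolenoidal φ → ∫ x, inner ℝ (ψ x) (φ x) = 0) {f : L2Vec} (hf : f ∈ H) :
    inner ℝ (toL2 ψ) f = 0 := by
  refine H_le_ker (L := innerSL ℝ (toL2 ψ)) (fun φ hφ => ?_) hf
  change inner ℝ (toL2 ψ) (V.val (toV φ hφ)) = 0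
  rw [inner_toL2, ← h φ hφ]
  refine integral_congr_ae ?_
  filter_upwards [toV_val hφ] with x hx
  rw [hx]

lemma integral_inner_gradS {χ : T3 → ℝ} (hχ : SmoothT χ) {φ : T3 → Vec} (hφ : IsSolenoidal φ) :
    ∫ x, inner ℝ (gradS χ x) (φ x) = 0 := by
  have e : ∀ x, inner ℝ (gradS χ x) (φ x) = ∑ j, φ x j * pderiv j χ x := fun x => by
    simp [PiLp.inner_apply, gradS]
  simp_rw [e]
  rw [integral_finsetSum _ fun j _ => ((hφ.1.apply j).mul (hχ.pderiv j)).integrable]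
  have e1 : ∀ j, ∫ x, φ x j * pderiv j χ x = -∫ x, pderiv j (fun z => φ z j) x * χ x :=
    fun j => integral_mul_pderiv (hφ.1.apply j) hχ j
  rw [Finset.sum_congr rfl fun j _ => e1 j, Finset.sum_neg_distrib,
    ← integral_finsetSum _ fun j _ => (((hφ.1.apply j).pderiv j).mul hχ).integrable, neg_eq_zero]
  simp_rw [← Finset.sum_mul]
  have h := hφ.2.1
  simp only [divV] at h
  simp [h]

lemma inner_const_of_mem_H (a : Vec) {f : L2Vec} (hf : f ∈ H) :
    inner ℝ (toL2 (ContinuousMap.const T3 a)) f = 0 := by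
  refine inner_eq_zero_of_mem_H (fun φ hφ => ?_) hf
  simp only [ContinuousMap.const_apply]
  rw [integral_inner hφ.1.integrable, hφ.2.2, inner_zero_right]

/-- The trace of a matrix field in `L²`. -/
def traceLp : L2Mat →L[ℝ] L2Real := traceL.compLpL 2 volume

lemma coeFn_traceLp (A : L2Mat) : traceLp A =ᵐ[volume] fun x => traceL (A x) :=
  traceL.coeFn_compLpL A

/-- Fields of `V` are divergence free. -/
lemma traceLp_grad (v : V) : traceLp (V.grad v) = 0 := by
  refine V_induction (P := fun v => traceLp (V.grad v) = 0)
    (isClosed_eq (traceLp.continuous.comp gradL.continuous) continuous_const)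
    (fun φ hφ => Lp.ext ?_) v
  filter_upwards [coeFn_traceLp (V.grad (toV φ hφ)), toV_grad hφ,
    Lp.coeFn_zero ℝ 2 (volume : Measure T3)] with x h1 h2 h3
  rw [h1, h2, h3, ← divV_eq_traceL, hφ.2.1]; rfl

lemma gradV_gradS {χ : T3 → ℝ} (hχ : SmoothT χ) : gradV (gradS χ) = hess χ := by
  funext x
  ext ij
  exact pderiv_comm hχ ij.2 ij.1 x

/-- The gradients of solenoidal fields are orthogonal to the Hessians. -/
lemma inner_hess_grad {χ : T3 → ℝ} (hχ : SmoothT χ) (v : V) :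
    inner ℝ (toL2 ⟨hess χ, hχ.hess.continuous⟩) (V.grad v) = 0 := by
  refine V_induction (P := fun v => inner ℝ (toL2 ⟨hess χ, hχ.hess.continuous⟩) (V.grad v) = 0)
    (isClosed_eq (Continuous.inner continuous_const gradL.continuous) continuous_const)
    (fun φ hφ => ?_) v
  have hi : ∀ i j, Integrable fun x => pderiv j (fun z => φ z i) x * pderiv i (pderiv j χ) x :=
    fun i j => (((hφ.1.apply i).pderiv j).mul ((hχ.pderiv j).pderiv i)).integrable
  -- Move the derivative `j` to the Hessian; the sum over `i` is then the pairing of the solenoidal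
  -- field `φ` with a gradient.
  have e1 : ∀ i j, ∫ x, pderiv j (fun z => φ z i) x * pderiv i (pderiv j χ) x
      = -∫ x, φ x i * pderiv i (pderiv j (pderiv j χ)) x := by
    intro i j
    rw [← neg_eq_iff_eq_neg, ← integral_mul_pderiv (hφ.1.apply i) ((hχ.pderiv j).pderiv i)]
    simp_rw [pderiv_comm (hχ.pderiv j) i j]
  have e2 : ∀ j, ∑ i, ∫ x, φ x i * pderiv i (pderiv j (pderiv j χ)) x = 0 := by
    intro j
    rw [← integral_inner_gradS ((hχ.pderiv j).pderiv j) hφ, ← integral_finsetSum _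
      fun i _ => ((hφ.1.apply i).mul (((hχ.pderiv j).pderiv j).pderiv i)).integrable]
    simp [PiLp.inner_apply, gradS]
  rw [inner_toL2]
  calc ∫ x, inner ℝ (hess χ x) (V.grad (toV φ hφ) x)
      = ∫ x, ∑ i, ∑ j, pderiv j (fun z => φ z i) x * pderiv i (pderiv j χ) x := by
        refine integral_congr_ae ?_
        filter_upwards [toV_grad hφ] with x hx
        rw [hx, PiLp.inner_apply, Fintype.sum_prod_type]
        rfl
    _ = 0 := by
        rw [integral_finsetSum _ fun i _ => integrable_finsetSum _ fun j _ => hi i j]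
        simp_rw [fun i => integral_finsetSum Finset.univ fun j _ => hi i j, e1]
        rw [Finset.sum_comm]
        simp_rw [Finset.sum_neg_distrib, e2]
        simp

/-- Differentiation exchanges the cosine and the sine of a frequency. -/
lemma IsMode.exists_conj {k : Fin 3 → ℤ} {m : T3 → ℝ} (h : IsMode k m) :
    ∃ m', ∃ c : ℝ, c ^ 2 = 1 ∧ IsMode k m' ∧ (∀ j x, pderiv j m x = c * (2 * Real.pi * k j) * m' x) ∧
      ∀ j x, pderiv j m' x = -c * (2 * Real.pi * k j) * m x := by
  rcases h with rfl | rfl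
  · exact ⟨sinMode k, -1, by norm_num, Or.inr rfl,
      fun j x => by rw [pderiv_cosMode]; ring, fun j x => by rw [pderiv_sinMode]; ring⟩
  · exact ⟨cosMode k, 1, by norm_num, Or.inl rfl,
      fun j x => by rw [pderiv_sinMode]; ring, fun j x => by rw [pderiv_cosMode]; ring⟩

lemma IsMode.integral_eq_zero {k : Fin 3 → ℤ} {m : T3 → ℝ} (h : IsMode k m) (hk : k ≠ 0) :
    ∫ x, m x = 0 := by
  obtain ⟨j, hj⟩ := Function.ne_iff.1 hk
  obtain ⟨m', c, hc, hm', -, h2⟩ := h.exists_conj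
  have h3 := integral_pderiv hm'.smoothT j
  simp_rw [h2, integral_const_mul] at h3
  have hc0 : c ≠ 0 := fun h => by simp [h] at hc
  have hj0 : (k j : ℝ) ≠ 0 := by simpa using hj
  exact (mul_eq_zero.1 h3).resolve_left
    (mul_ne_zero (neg_ne_zero.2 hc0) (mul_ne_zero (by positivity) hj0))

/-- The frequency of a mode as a vector. -/
def freqVec (k : Fin 3 → ℤ) : Vec := WithLp.toLp 2 fun j => (k j : ℝ)

lemma IsMode.isSolenoidal {k : Fin 3 → ℤ} {m : T3 → ℝ} (h : IsMode k m) (hk : k ≠ 0) {a : Vec}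
    (ha : inner ℝ (freqVec k) a = 0) : IsSolenoidal fun x => m x • a := by
  refine ⟨smoothT_smul_const h.smoothT a, fun x => ?_, ?_⟩
  · obtain ⟨m', c, -, -, h1, -⟩ := h.exists_conj
    rw [divV_eq_sum_gradV]
    simp_rw [gradV_smul_const h.smoothT, h1]
    simp only [PiLp.inner_apply, freqVec, RCLike.inner_apply, conj_trivial] at ha
    calc _ = c * (2 * Real.pi) * m' x * ∑ j, a j * k j := by
          rw [Finset.mul_sum]; exact Finset.sum_congr rfl fun j _ => by ring
      _ = 0 := by rw [ha, mul_zero]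
  · rw [integral_smul_const, h.integral_eq_zero hk, zero_smul]

lemma IsMode.exists_gradS {k : Fin 3 → ℤ} {m : T3 → ℝ} (h : IsMode k m) :
    ∃ χ : T3 → ℝ, SmoothT χ ∧ gradS χ = fun x => m x • freqVec k := by
  obtain ⟨m', c, hc, hm', -, h2⟩ := h.exists_conj
  refine ⟨fun x => (-c / (2 * Real.pi)) * m' x, hm'.smoothT.const_smul _, ?_⟩
  funext x
  ext j
  change pderiv j (fun x => (-c / (2 * Real.pi)) * m' x) x = m x * k j
  rw [pderiv_const_mul _ hm'.smoothT, h2]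
  have := Real.pi_pos.ne'
  field_simp
  linear_combination (k j * m x) * hc

lemma smoothPair_add {f g : T3 → Vec} (hf : SmoothT f) (hg : SmoothT g) :
    smoothPair (fun x => f x + g x) (hf.add hg) = smoothPair f hf + smoothPair g hg := by
  rw [smoothPair, smoothPair, smoothPair, ← WithLp.toLp_add, Prod.mk_add_mk, ← MemLp.toLp_add,
    ← MemLp.toLp_add]
  congr 3
  exact funext fun x => gradV_add hf hg x

lemma smoothPair_const_smul (c : ℝ) {f : T3 → Vec} (hf : SmoothT f) :
    smoothPair (fun x => c • f x) (hf.const_smul c) = c • smoothPair f hf := by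
  rw [smoothPair, smoothPair, ← WithLp.toLp_smul, Prod.smul_mk, ← MemLp.toLp_const_smul,
    ← MemLp.toLp_const_smul]
  congr 3
  exact funext fun x => gradV_const_smul c hf x

/-- The Helmholtz decomposition: a continuous functional on `H¹` which vanishes on `V`, on the
gradients and on the constants vanishes. -/
lemma H1_functional_eq_zero {L : W →L[ℝ] ℝ} (hV : ∀ v : V, L v = 0)
    (hG : ∀ χ (hχ : SmoothT χ), L (smoothPair (gradS χ) hχ.gradS) = 0)
    (hC : ∀ a : Vec, L (smoothPair (fun _ => a) (smoothT_const a)) = 0) {w : W} (hw : w ∈ H1) :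
    L w = 0 := by
  refine (H1_le_of_modes (M := LinearMap.ker (L : W →ₗ[ℝ] ℝ)) L.isClosed_ker
    fun k m hm a => ?_) hw
  change L _ = 0
  rcases eq_or_ne k 0 with rfl | hk
  · rcases hm.zero with rfl | rfl
    · simpa using hC a
    · simpa using hC 0
  set n := freqVec k
  have hn : inner ℝ n n ≠ 0 := by
    rw [inner_self_ne_zero]
    intro h0
    refine hk (funext fun j => ?_)
    have : n j = 0 := by rw [h0]; rfl
    simpa [n, freqVec] using this
  -- Split the amplitude into its parts parallel to the frequency (a gradient) and orthogonal to it
  -- (a solenoidal field).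
  set r := inner ℝ n a / inner ℝ n n
  have hs := hm.isSolenoidal hk (a := a - r • n) (by
    rw [inner_sub_right, inner_smul_right, div_mul_cancel₀ _ hn, sub_self])
  obtain ⟨χ, hχ, hχm⟩ := hm.exists_gradS (k := k)
  have hsplit : smoothPair _ (smoothT_smul_const hm.smoothT a)
      = (toV _ hs : W) + r • smoothPair (gradS χ) hχ.gradS := by
    rw [← smoothPair_const_smul]
    refine Eq.trans ?_ (smoothPair_add hs.1 (hχ.gradS.const_smul r))
    congr 1
    funext x
    rw [hχm, smul_sub, smul_comm, sub_add_cancel]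
  rw [hsplit, map_add, map_smul, hV, hG χ hχ, smul_zero, add_zero]

/-- The time derivative of the mollified field at an instant at which the velocity is `v`: the
functional `h ↦ ⟨v ⊗ v - ν ∇v, ∇(η_δ * h)⟩`, represented in `H`. -/
def force (ν : ℝ) {η : Vec → ℝ} (hη : IsKernel η) {δ : ℝ} (hδ : 0 < δ) (v : V) : L2Vec :=
  H.starProjection (ContinuousLinearMap.adjoint
    (gradConvL (convKernel_mollKer hη hδ) (contDiff_mollKer hη δ)) (tensorV v v - ν • V.grad v))

lemma force_mem_H (ν : ℝ) {η : Vec → ℝ} (hη : IsKernel η) {δ : ℝ} (hδ : 0 < δ) (v : V) :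
    force ν hη hδ v ∈ H := H.starProjection_apply_mem _

lemma inner_force_of_mem_H (ν : ℝ) {η : Vec → ℝ} (hη : IsKernel η) {δ : ℝ} (hδ : 0 < δ) (v : V)
    {h : L2Vec} (hh : h ∈ H) : inner ℝ (force ν hη hδ v) h
      = inner ℝ (tensorV v v - ν • V.grad v)
        (gradConvL (convKernel_mollKer hη hδ) (contDiff_mollKer hη δ) h) := by
  rw [force, Submodule.inner_starProjection_left_eq_right,
    Submodule.starProjection_eq_self_iff.2 hh, ContinuousLinearMap.adjoint_inner_left]

/-- For solenoidal `h` the Reynolds stress in the flux turns `η_δ * (v ⊗ v)` into `w ⊗ w`, and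
`∇g` may replace the flux, of which it is the projection. -/
lemma inner_force_val (ν : ℝ) {η : Vec → ℝ} (hη : IsKernel η) {δ : ℝ} (hδ : 0 < δ) (v h : V) :
    inner ℝ (force ν hη hδ v) (V.val h)
      = inner ℝ (tensorV (mollV hη hδ v) (mollV hη hδ v)) (V.grad h)
        - inner ℝ (V.grad (potential (fluxV ν hη hδ v))) (V.grad h) := by
  have e : convL (convKernel_mollKer hη hδ) (V.grad h) = mollL hη hδ (V.grad h) := rfl
  rw [inner_force_of_mem_H ν hη hδ v (val_mem_H h), gradConvL_val, inner_grad_potential, e,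
    ← inner_mollL, fluxV, map_sub, map_smul, grad_mollV, ← inner_sub_left]
  congr 1
  abel

/-- The balance of momentum of the mollified field `w`: for every `h ∈ H¹`, solenoidal or not,
`⟨∂ₜw, h⟩ = ⟨w ⊗ w, ∇h⟩ + ⟨Π(w ⊗ w), ∇·h⟩ - ⟨∇g, ∇h⟩`, where `g` is the potential of the flux. -/
lemma inner_force (ν : ℝ) {η : Vec → ℝ} (hη : IsKernel η) {δ : ℝ} (hδ : 0 < δ) (v : V) {h : W}
    (hh : h ∈ H1) : inner ℝ (force ν hη hδ v) h.fst
      = inner ℝ (tensorV (mollV hη hδ v) (mollV hη hδ v)) h.snd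
        + inner ℝ (pressureL (tensorV (mollV hη hδ v) (mollV hη hδ v))) (traceLp h.snd)
        - inner ℝ (V.grad (potential (fluxV ν hη hδ v))) h.snd := by
  set B := tensorV (mollV hη hδ v) (mollV hη hδ v)
  set g := potential (fluxV ν hη hδ v)
  let fstW := WithLp.fstL 2 ℝ L2Vec L2Mat
  let sndW := WithLp.sndL 2 ℝ L2Vec L2Mat
  let L : W →L[ℝ] ℝ := (innerSL ℝ (force ν hη hδ v)).comp fstW - (innerSL ℝ B).comp sndW
    - (innerSL ℝ (pressureL B)).comp (traceLp.comp sndW) + (innerSL ℝ (V.grad g)).comp sndW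
  have hL : ∀ w, L w = inner ℝ (force ν hη hδ v) w.fst - inner ℝ B w.snd
    - inner ℝ (pressureL B) (traceLp w.snd) + inner ℝ (V.grad g) w.snd := fun w => rfl
  have hsnd : ∀ {f : T3 → Vec} (hf : SmoothT f),
      (smoothPair f hf).snd = toL2 ⟨gradV f, hf.gradV.continuous⟩ := fun hf =>
    Lp.ext ((smoothPair_snd hf).trans (coeFn_toL2 ⟨gradV _, hf.gradV.continuous⟩).symm)
  have hfst : ∀ {f : T3 → Vec} (hf : SmoothT f),
      (smoothPair f hf).fst = toL2 ⟨f, hf.continuous⟩ := fun hf =>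
    Lp.ext ((smoothPair_fst hf).trans (coeFn_toL2 ⟨_, hf.continuous⟩).symm)
  have h0 : L h = 0 := by
    refine H1_functional_eq_zero (fun w => ?_) (fun χ hχ => ?_) (fun a => ?_) hh
    · rw [hL]
      have h1 := inner_force_val ν hη hδ v w
      have h2 := traceLp_grad w
      change inner ℝ (force ν hη hδ v) (V.val w) - inner ℝ B (V.grad w)
        - inner ℝ (pressureL B) (traceLp (V.grad w)) + inner ℝ (V.grad g) (V.grad w) = 0
      rw [h1, h2, inner_zero_right]
      ring
    · rw [hL, hsnd, hfst, real_inner_comm, inner_eq_zero_of_mem_H (fun φ hφ =>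
        integral_inner_gradS hχ hφ) (force_mem_H ν hη hδ v)]
      have e : (⟨gradV (gradS χ), hχ.gradS.gradV.continuous⟩ : C(T3, Mat))
          = ⟨hess χ, hχ.hess.continuous⟩ := ContinuousMap.ext fun x => congrFun (gradV_gradS hχ) x
      have e2 : traceLp (toL2 ⟨hess χ, hχ.hess.continuous⟩)
          = toL2 ⟨lapS χ, hχ.lapS.continuous⟩ := by
        refine Lp.ext ?_
        filter_upwards [coeFn_traceLp (toL2 ⟨hess χ, hχ.hess.continuous⟩),
          coeFn_toL2 ⟨hess χ, hχ.hess.continuous⟩,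
          coeFn_toL2 ⟨lapS χ, hχ.lapS.continuous⟩] with x h1 h2 h3
        rw [h1, h2, h3, traceL_apply]; rfl
      have h2 := inner_lap_pressureL B hχ
      change inner ℝ (toL2 ⟨lapS χ, hχ.lapS.continuous⟩) (pressureL B)
        = -inner ℝ (toL2 ⟨hess χ, hχ.hess.continuous⟩) B at h2
      have h3 := inner_hess_grad hχ g
      rw [e, e2, real_inner_comm _ B, real_inner_comm _ (pressureL B), real_inner_comm _ (V.grad g),
        h2, h3]
      ring
    · have e : (⟨gradV fun _ => a, (smoothT_const a).gradV.continuous⟩ : C(T3, Mat)) = 0 := by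
        ext x ij
        exact pderiv_const (a ij.1) ij.2 x
      have e0 : toL2 (0 : C(T3, Mat)) = 0 :=
        Lp.ext ((coeFn_toL2 (0 : C(T3, Mat))).trans (Lp.coeFn_zero Mat 2 volume).symm)
      rw [hL, hsnd, hfst, real_inner_comm, e, e0, map_zero, inner_zero_right,
        inner_zero_right, inner_zero_right]
      have := inner_const_of_mem_H a (force_mem_H ν hη hδ v)
      rw [sub_zero, sub_zero, add_zero]
      exact this
  rw [hL] at h0
  linarith

end Force

/-! ### Products with smooth functions -/

section Products

variable {E A G : Type*} [NormedAddCommGroup E] [NormedSpace ℝ E] [NormedAddCommGroup A]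
  [NormedSpace ℝ A] [NormedAddCommGroup G] [NormedSpace ℝ G]

/-- The product, given by a bilinear map `b`, of an `L²` function and a continuous function. -/
def pairL (b : E →L[ℝ] A →L[ℝ] G) :
    C(T3, A) →L[ℝ] Lp E 2 (volume : Measure T3) →L[ℝ] Lp G 2 (volume : Measure T3) :=
  (b.holderL (volume : Measure T3) 2 ⊤ 2).flip.comp (ContinuousMap.toLp ⊤ volume ℝ)

lemma coeFn_pairL (b : E →L[ℝ] A →L[ℝ] G) (a : C(T3, A)) (f : Lp E 2 (volume : Measure T3)) :
    pairL b a f =ᵐ[volume] fun x => b (f x) (a x) := by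
  filter_upwards [b.coeFn_holder (r := 2) f (ContinuousMap.toLp ⊤ volume ℝ a),
    ContinuousMap.coeFn_toLp (p := ⊤) (𝕜 := ℝ) volume a] with x h1 h2
  have : pairL b a f x = b.holder 2 f (ContinuousMap.toLp ⊤ volume ℝ a) x := rfl
  rw [this, h1, h2]

/-- The product of a continuous scalar function and an `L²` function. -/
def mulL : C(T3, ℝ) →L[ℝ] Lp E 2 (volume : Measure T3) →L[ℝ] Lp E 2 (volume : Measure T3) :=
  pairL (ContinuousLinearMap.lsmul ℝ ℝ).flip

lemma coeFn_mulL (a : C(T3, ℝ)) (f : Lp E 2 (volume : Measure T3)) :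
    mulL a f =ᵐ[volume] fun x => a x • f x := coeFn_pairL _ a f

/-- `v ↦ v ⊗ a` for a continuous field `a`. -/
def outerL : C(T3, Vec) →L[ℝ] L2Vec →L[ℝ] L2Mat := pairL tensorL

lemma coeFn_outerL (a : C(T3, Vec)) (f : L2Vec) :
    outerL a f =ᵐ[volume] fun x => tensor (f x) (a x) := coeFn_pairL _ a f

/-- `v ↦ a ⊗ v` for a continuous field `a`. -/
def outerRightL : C(T3, Vec) →L[ℝ] L2Vec →L[ℝ] L2Mat := pairL tensorL.flip

lemma coeFn_outerRightL (a : C(T3, Vec)) (f : L2Vec) :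
    outerRightL a f =ᵐ[volume] fun x => tensor (a x) (f x) := coeFn_pairL _ a f

/-- `v ↦ v · a` for a continuous field `a`. -/
def dotL : C(T3, Vec) →L[ℝ] L2Vec →L[ℝ] L2Real := pairL (innerSL ℝ)

lemma coeFn_dotL (a : C(T3, Vec)) (f : L2Vec) :
    dotL a f =ᵐ[volume] fun x => inner ℝ (f x) (a x) := coeFn_pairL _ a f

/-- A smooth function as a continuous function. -/
def SmoothT.toC {f : T3 → E} (hf : SmoothT f) : C(T3, E) := ⟨f, hf.continuous⟩

lemma gradV_mul {φ : T3 → ℝ} (hφ : SmoothT φ) {f : T3 → Vec} (hf : SmoothT f) (x : T3) :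
    gradV (fun z => φ z • f z) x = φ x • gradV f x + tensor (f x) (gradS φ x) := by
  ext ij
  have := pderiv_mul hφ (hf.apply ij.1) ij.2 x
  change pderiv ij.2 (fun z => φ z * f z ij.1) x = φ x * pderiv ij.2 (fun z => f z ij.1) x
    + f x ij.1 * pderiv ij.2 φ x
  rw [this]
  ring

/-- The gradient `φ ∇v + v ⊗ ∇φ` of `φ v`. -/
def gradMul {φ : T3 → ℝ} (hφ : SmoothT φ) : V →L[ℝ] L2Mat :=
  (mulL hφ.toC).comp gradL + (outerL hφ.gradS.toC).comp valL

lemma gradMul_apply {φ : T3 → ℝ} (hφ : SmoothT φ) (v : V) :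
    gradMul hφ v = mulL hφ.toC (V.grad v) + outerL hφ.gradS.toC (V.val v) := rfl

/-- Multiplication by a smooth function maps `V` to `H¹`. -/
lemma mul_mem_H1 {φ : T3 → ℝ} (hφ : SmoothT φ) (v : V) :
    (WithLp.toLp 2 (mulL hφ.toC (V.val v), gradMul hφ v) : W) ∈ H1 := by
  have hH : IsClosed (H1 : Set W) := Submodule.isClosed_topologicalClosure _
  let S : V →L[ℝ] W := ((WithLp.prodContinuousLinearEquiv 2 ℝ L2Vec L2Mat).symm :
    (L2Vec × L2Mat) →L[ℝ] W).comp (((mulL hφ.toC).comp valL).prod (gradMul hφ))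
  refine V_induction (P := fun v => S v ∈ H1) (hH.preimage S.continuous) (fun f hf => ?_) v
  convert smoothPair_mem_H1 (hφ.smul hf.1) using 1
  refine (WithLp.ext_iff 2).2 (Prod.ext ?_ ?_) <;> refine Lp.ext ?_
  · filter_upwards [coeFn_mulL hφ.toC (V.val (toV f hf)), smoothPair_fst (hφ.smul hf.1),
      toV_val hf] with x h1 h2 h3
    exact h1.trans (Eq.trans (by rw [h3]; rfl) h2.symm)
  · filter_upwards [Lp.coeFn_add (mulL hφ.toC (V.grad (toV f hf)))
        (outerL hφ.gradS.toC (V.val (toV f hf))), coeFn_mulL hφ.toC (V.grad (toV f hf)),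
      coeFn_outerL hφ.gradS.toC (V.val (toV f hf)), smoothPair_snd (hφ.smul hf.1), toV_val hf,
      toV_grad hf] with x h1 h2 h3 h4 h5 h6
    refine h1.trans (Eq.trans ?_ (h4.trans (gradV_mul hφ hf.1 x)).symm)
    rw [Pi.add_apply, h2, h3, h5, h6]; rfl

lemma traceL_tensor (a b : Vec) : traceL (tensor a b) = inner ℝ a b := by
  rw [traceL_apply, PiLp.inner_apply]
  exact Finset.sum_congr rfl fun j _ => mul_comm _ _

lemma traceLp_gradMul {φ : T3 → ℝ} (hφ : SmoothT φ) (v : V) :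
    traceLp (gradMul hφ v) = dotL hφ.gradS.toC (V.val v) := by
  have h0 : traceLp (mulL hφ.toC (V.grad v)) = mulL hφ.toC (traceLp (V.grad v)) := by
    refine Lp.ext ?_
    filter_upwards [coeFn_traceLp (mulL hφ.toC (V.grad v)), coeFn_mulL hφ.toC (V.grad v),
      coeFn_mulL hφ.toC (traceLp (V.grad v)), coeFn_traceLp (V.grad v)] with x h1 h2 h3 h4
    rw [h1, h2, h3, h4, map_smul]
  rw [gradMul_apply, map_add, h0, traceLp_grad, map_zero, zero_add]
  refine Lp.ext ?_
  filter_upwards [coeFn_traceLp (outerL hφ.gradS.toC (V.val v)),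
    coeFn_outerL hφ.gradS.toC (V.val v), coeFn_dotL hφ.gradS.toC (V.val v)] with x h1 h2 h3
  rw [h1, h2, h3, traceL_tensor]

lemma inner_tensor (A : Mat) (a b : Vec) : inner ℝ A (tensor a b) = ∑ i, ∑ j, A (i, j) * (a i * b j) := by
  rw [PiLp.inner_apply, Fintype.sum_prod_type]
  exact Finset.sum_congr rfl fun i _ => Finset.sum_congr rfl fun j _ => mul_comm _ _

/-- The transport term: `∫ φ (v ⊗ v) : ∇v = -½ ∫ |v|² v · ∇φ`. -/
lemma inner_tensorV_mulL_grad {φ : T3 → ℝ} (hφ : SmoothT φ) (v : V) :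
    inner ℝ (tensorV v v) (mulL hφ.toC (V.grad v))
      = -(1 / 2) * inner ℝ (tensorV v v) (outerL hφ.gradS.toC (V.val v)) := by
  have hc : Continuous fun v : V => tensorV v v := by fun_prop
  refine V_induction (P := fun v => inner ℝ (tensorV v v) (mulL hφ.toC (V.grad v))
      = -(1 / 2) * inner ℝ (tensorV v v) (outerL hφ.gradS.toC (V.val v)))
    (isClosed_eq (hc.inner ((mulL hφ.toC).continuous.comp gradL.continuous))
      ((hc.inner ((outerL hφ.gradS.toC).continuous.comp valL.continuous)).const_mul _))
    (fun f hf => ?_) v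
  have hfi := hf.1.apply
  have hij : ∀ i j, SmoothT fun x => φ x * f x j * (f x i * f x i) := fun i j =>
    (hφ.mul (hfi j)).mul ((hfi i).mul (hfi i))
  have hd : ∀ i j x, pderiv j (fun x => φ x * f x j * (f x i * f x i)) x
      = pderiv j φ x * f x j * (f x i * f x i) + φ x * pderiv j (fun z => f z j) x * (f x i * f x i)
        + 2 * (φ x * f x j * f x i * pderiv j (fun z => f z i) x) := by
    intro i j x
    rw [pderiv_mul (hφ.mul (hfi j)) ((hfi i).mul (hfi i)), pderiv_mul hφ (hfi j),
      pderiv_mul (hfi i) (hfi i)]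
    ring
  have h0 : ∫ x, ∑ i, ∑ j, pderiv j (fun x => φ x * f x j * (f x i * f x i)) x = 0 := by
    rw [integral_finsetSum _ fun i _ => integrable_finsetSum _ fun j _ => ((hij i j).pderiv j).integrable]
    refine Finset.sum_eq_zero fun i _ => ?_
    rw [integral_finsetSum _ fun j _ => ((hij i j).pderiv j).integrable]
    exact Finset.sum_eq_zero fun j _ => integral_pderiv (hij i j) j
  have e1 : ∀ x, ∑ i, ∑ j, pderiv j (fun x => φ x * f x j * (f x i * f x i)) x
      = inner ℝ (tensor (f x) (f x)) (tensor (f x) (gradS φ x))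
        + 2 * inner ℝ (tensor (f x) (f x)) (φ x • gradV f x) := by
    intro x
    have hdiv : ∑ i, ∑ j, φ x * pderiv j (fun z => f z j) x * (f x i * f x i) = 0 := by
      refine Finset.sum_eq_zero fun i _ => ?_
      rw [← Finset.sum_mul, ← Finset.mul_sum]
      have := hf.2.1 x
      rw [divV] at this
      rw [this]; simp
    simp only [hd, Finset.sum_add_distrib, hdiv, add_zero]
    rw [inner_tensor, inner_smul_right, PiLp.inner_apply, Fintype.sum_prod_type, Finset.mul_sum,
      Finset.mul_sum]
    simp only [Finset.mul_sum]
    congr 1 <;> refine Finset.sum_congr rfl fun i _ => Finset.sum_congr rfl fun j _ => ?_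
    · simp only [tensor, gradS]; ring
    · simp only [tensor, gradV, RCLike.inner_apply, conj_trivial]; ring
  have hi1 : Integrable fun x => inner ℝ (tensor (f x) (f x)) (tensor (f x) (gradS φ x)) :=
    (SmoothT.bilin (innerSL ℝ) (hf.1.bilin tensorL hf.1) (hf.1.bilin tensorL hφ.gradS)).integrable
  have hi2 : Integrable fun x => inner ℝ (tensor (f x) (f x)) (φ x • gradV f x) :=
    (SmoothT.bilin (innerSL ℝ) (hf.1.bilin tensorL hf.1) (hφ.smul hf.1.gradV)).integrable
  simp_rw [e1] at h0
  rw [integral_add hi1 (hi2.const_mul 2), integral_const_mul] at h0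
  have e2 : inner ℝ (tensorV (toV f hf) (toV f hf)) (mulL hφ.toC (V.grad (toV f hf)))
      = ∫ x, inner ℝ (tensor (f x) (f x)) (φ x • gradV f x) := by
    rw [L2.inner_def]
    refine integral_congr_ae ?_
    filter_upwards [coeFn_tensorV (toV f hf) (toV f hf), coeFn_mulL hφ.toC (V.grad (toV f hf)),
      toV_val hf, toV_grad hf] with x h1 h2 h3 h4
    rw [h1, h2, h3, h4]; rfl
  have e3 : inner ℝ (tensorV (toV f hf) (toV f hf)) (outerL hφ.gradS.toC (V.val (toV f hf)))
      = ∫ x, inner ℝ (tensor (f x) (f x)) (tensor (f x) (gradS φ x)) := by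
    rw [L2.inner_def]
    refine integral_congr_ae ?_
    filter_upwards [coeFn_tensorV (toV f hf) (toV f hf),
      coeFn_outerL hφ.gradS.toC (V.val (toV f hf)), toV_val hf] with x h1 h2 h3
    rw [h1, h2, h3]; rfl
  rw [e2, e3]
  linarith

lemma inner_tensorV_gradMul {φ : T3 → ℝ} (hφ : SmoothT φ) (v : V) :
    inner ℝ (tensorV v v) (gradMul hφ v)
      = 1 / 2 * inner ℝ (tensorV v v) (outerL hφ.gradS.toC (V.val v)) := by
  rw [gradMul_apply, inner_add_right, inner_tensorV_mulL_grad]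
  ring

/-- The viscous term: `∫ ∇v : (v ⊗ ∇φ) = -½ ∫ |v|² Δφ`. -/
lemma inner_grad_outerL {φ : T3 → ℝ} (hφ : SmoothT φ) (v : V) :
    inner ℝ (V.grad v) (outerL hφ.gradS.toC (V.val v))
      = -(1 / 2) * inner ℝ (mulL hφ.lapS.toC (V.val v)) (V.val v) := by
  refine V_induction (P := fun v => inner ℝ (V.grad v) (outerL hφ.gradS.toC (V.val v))
      = -(1 / 2) * inner ℝ (mulL hφ.lapS.toC (V.val v)) (V.val v))
    (isClosed_eq (gradL.continuous.inner ((outerL hφ.gradS.toC).continuous.comp valL.continuous))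
      ((((mulL hφ.lapS.toC).continuous.comp valL.continuous).inner valL.continuous).const_mul _))
    (fun f hf => ?_) v
  have hfi := hf.1.apply
  have e : ∀ i j, ∫ x, pderiv j (fun z => f z i) x * (f x i * pderiv j φ x)
      = -(1 / 2) * ∫ x, f x i * f x i * pderiv j (pderiv j φ) x := by
    intro i j
    have h1 := integral_mul_pderiv ((hfi i).mul (hfi i)) (hφ.pderiv j) j
    have h2 : ∀ x, pderiv j (fun x => f x i * f x i) x * pderiv j φ x
        = 2 * (pderiv j (fun z => f z i) x * (f x i * pderiv j φ x)) := fun x => by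
      rw [pderiv_mul (hfi i) (hfi i)]; ring
    simp_rw [h2, integral_const_mul] at h1
    linarith
  have hi1 : ∀ i j, Integrable fun x => pderiv j (fun z => f z i) x * (f x i * pderiv j φ x) :=
    fun i j => (((hfi i).pderiv j).mul ((hfi i).mul (hφ.pderiv j))).integrable
  have hi2 : ∀ i j, Integrable fun x => f x i * f x i * pderiv j (pderiv j φ) x :=
    fun i j => (((hfi i).mul (hfi i)).mul ((hφ.pderiv j).pderiv j)).integrable
  have e1 : inner ℝ (V.grad (toV f hf)) (outerL hφ.gradS.toC (V.val (toV f hf)))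
      = ∫ x, ∑ i, ∑ j, pderiv j (fun z => f z i) x * (f x i * pderiv j φ x) := by
    rw [L2.inner_def]
    refine integral_congr_ae ?_
    filter_upwards [toV_grad hf, toV_val hf, coeFn_outerL hφ.gradS.toC (V.val (toV f hf))]
      with x h1 h2 h3
    rw [h1, h3, h2, inner_tensor]; rfl
  have e2 : inner ℝ (mulL hφ.lapS.toC (V.val (toV f hf))) (V.val (toV f hf))
      = ∫ x, ∑ i, ∑ j, f x i * f x i * pderiv j (pderiv j φ) x := by
    rw [L2.inner_def]
    refine integral_congr_ae ?_
    filter_upwards [toV_val hf, coeFn_mulL hφ.lapS.toC (V.val (toV f hf))] with x h1 h2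
    rw [h2, h1, inner_smul_left, PiLp.inner_apply, Finset.mul_sum]
    refine Finset.sum_congr rfl fun i _ => ?_
    rw [← Finset.mul_sum]
    simp only [RCLike.inner_apply, conj_trivial]
    exact mul_comm _ _
  rw [e1, e2, integral_finsetSum _ fun i _ => integrable_finsetSum _ fun j _ => hi1 i j,
    integral_finsetSum _ fun i _ => integrable_finsetSum _ fun j _ => hi2 i j, Finset.mul_sum]
  refine Finset.sum_congr rfl fun i _ => ?_
  rw [integral_finsetSum _ fun j _ => hi1 i j, integral_finsetSum _ fun j _ => hi2 i j,
    Finset.mul_sum]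
  exact Finset.sum_congr rfl fun j _ => e i j

/-- The convective term in divergence form: `∫ (v · ∇)v · ψ = -∫ (v ⊗ v) : ∇ψ`. -/
lemma inner_grad_outerRightL {ψ : T3 → Vec} (hψ : SmoothT ψ) (v : V) :
    inner ℝ (V.grad v) (outerRightL hψ.toC (V.val v))
      = -inner ℝ (tensorV v v) (toL2 hψ.gradV.toC) := by
  have hc : Continuous fun v : V => tensorV v v := by fun_prop
  refine V_induction (P := fun v => inner ℝ (V.grad v) (outerRightL hψ.toC (V.val v))
      = -inner ℝ (tensorV v v) (toL2 hψ.gradV.toC))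
    (isClosed_eq (gradL.continuous.inner ((outerRightL hψ.toC).continuous.comp valL.continuous))
      (hc.inner continuous_const).neg) (fun f hf => ?_) v
  have hfi := hf.1.apply
  have hψi := hψ.apply
  have hij : ∀ i j, SmoothT fun x => f x i * f x j * ψ x i := fun i j =>
    ((hfi i).mul (hfi j)).mul (hψi i)
  have hd : ∀ i j x, pderiv j (fun x => f x i * f x j * ψ x i) x
      = pderiv j (fun z => f z i) x * (ψ x i * f x j)
        + f x i * pderiv j (fun z => f z j) x * ψ x i
        + pderiv j (fun z => ψ z i) x * (f x i * f x j) := by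
    intro i j x
    rw [pderiv_mul ((hfi i).mul (hfi j)) (hψi i), pderiv_mul (hfi i) (hfi j)]
    ring
  have h0 : ∫ x, ∑ i, ∑ j, pderiv j (fun x => f x i * f x j * ψ x i) x = 0 := by
    rw [integral_finsetSum _ fun i _ => integrable_finsetSum _ fun j _ => ((hij i j).pderiv j).integrable]
    refine Finset.sum_eq_zero fun i _ => ?_
    rw [integral_finsetSum _ fun j _ => ((hij i j).pderiv j).integrable]
    exact Finset.sum_eq_zero fun j _ => integral_pderiv (hij i j) j
  have e1 : ∀ x, ∑ i, ∑ j, pderiv j (fun x => f x i * f x j * ψ x i) x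
      = inner ℝ (gradV f x) (tensor (ψ x) (f x)) + inner ℝ (gradV ψ x) (tensor (f x) (f x)) := by
    intro x
    have hdiv : ∑ i, ∑ j, f x i * pderiv j (fun z => f z j) x * ψ x i = 0 := by
      refine Finset.sum_eq_zero fun i _ => ?_
      rw [← Finset.sum_mul, ← Finset.mul_sum]
      have := hf.2.1 x
      rw [divV] at this
      rw [this]; simp
    simp only [hd, Finset.sum_add_distrib, hdiv, add_zero]
    rw [inner_tensor, inner_tensor]
    rfl
  have hi1 : Integrable fun x => inner ℝ (gradV f x) (tensor (ψ x) (f x)) :=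
    (SmoothT.bilin (innerSL ℝ) hf.1.gradV (hψ.bilin tensorL hf.1)).integrable
  have hi2 : Integrable fun x => inner ℝ (gradV ψ x) (tensor (f x) (f x)) :=
    (SmoothT.bilin (innerSL ℝ) hψ.gradV (hf.1.bilin tensorL hf.1)).integrable
  simp_rw [e1] at h0
  rw [integral_add hi1 hi2] at h0
  have e2 : inner ℝ (V.grad (toV f hf)) (outerRightL hψ.toC (V.val (toV f hf)))
      = ∫ x, inner ℝ (gradV f x) (tensor (ψ x) (f x)) := by
    rw [L2.inner_def]
    refine integral_congr_ae ?_
    filter_upwards [toV_grad hf, toV_val hf, coeFn_outerRightL hψ.toC (V.val (toV f hf))]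
      with x h1 h2 h3
    rw [h1, h3, h2]; rfl
  have e3 : inner ℝ (tensorV (toV f hf) (toV f hf)) (toL2 hψ.gradV.toC)
      = ∫ x, inner ℝ (gradV ψ x) (tensor (f x) (f x)) := by
    rw [real_inner_comm, inner_toL2]
    refine integral_congr_ae ?_
    filter_upwards [coeFn_tensorV (toV f hf) (toV f hf), toV_val hf] with x h1 h2
    rw [h1, h2]; rfl
  rw [e2, e3]
  linarith

end Products

/-! ### Primitives of integrable functions of time -/

section Primitives

variable {X Y Z : Type*} [NormedAddCommGroup X] [NormedSpace ℝ X] [NormedAddCommGroup Y]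
  [NormedSpace ℝ Y] [NormedAddCommGroup Z] [NormedSpace ℝ Z]

/-- On `[0, T]`, the function `a` is a primitive of the integrable function `α`. -/
structure IsPrimitive (T : ℝ) (a α : ℝ → X) : Prop where
  integrable : IntervalIntegrable α volume 0 T
  eq_add : ∀ t ∈ Icc 0 T, a t = a 0 + ∫ s in (0 : ℝ)..t, α s

lemma absolutelyContinuous_integral {α : ℝ → X} {T : ℝ} (h : IntervalIntegrable α volume 0 T) :
    AbsolutelyContinuousOnInterval (fun t => ∫ s in (0 : ℝ)..t, α s) 0 T := by
  refine squeeze_zero' (Eventually.of_forall fun E => Finset.sum_nonneg fun i _ => dist_nonneg) ?_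
    (h.norm.absolutelyContinuousOnInterval_intervalIntegral left_mem_uIcc)
  have hmem : ∀ᶠ E in AbsolutelyContinuousOnInterval.totalLengthFilter ⊓
      𝓟 (AbsolutelyContinuousOnInterval.disjWithin 0 T),
      E ∈ AbsolutelyContinuousOnInterval.disjWithin 0 T :=
    eventually_inf_principal.2 (Eventually.of_forall fun _ => id)
  filter_upwards [hmem] with E hE
  refine Finset.sum_le_sum fun i hi => ?_
  obtain ⟨h1, h2⟩ := hE.1 i hi
  have hsub : ∀ {t}, t ∈ uIcc 0 T → IntervalIntegrable α volume 0 t := fun ht =>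
    h.mono_set (uIcc_subset_uIcc left_mem_uIcc ht)
  rw [dist_eq_norm, dist_eq_norm, intervalIntegral.integral_interval_sub_left (hsub h1) (hsub h2),
    intervalIntegral.integral_interval_sub_left (hsub h1).norm (hsub h2).norm, Real.norm_eq_abs]
  exact intervalIntegral.norm_integral_le_abs_integral_norm

lemma absolutelyContinuous_bilin (B : X →L[ℝ] Y →L[ℝ] Z) {a : ℝ → X} {b : ℝ → Y} {T : ℝ}
    (ha : AbsolutelyContinuousOnInterval a 0 T) (hb : AbsolutelyContinuousOnInterval b 0 T) :
    AbsolutelyContinuousOnInterval (fun t => B (a t) (b t)) 0 T := by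
  obtain ⟨M, hM⟩ := ha.exists_bound
  obtain ⟨N, hN⟩ := hb.exists_bound
  have hlim := (Tendsto.const_mul (‖B‖ * N) ha).add (Tendsto.const_mul (‖B‖ * M) hb)
  rw [mul_zero, mul_zero, add_zero] at hlim
  refine squeeze_zero' (Eventually.of_forall fun E => Finset.sum_nonneg fun i _ => dist_nonneg) ?_
    hlim
  have hmem : ∀ᶠ E in AbsolutelyContinuousOnInterval.totalLengthFilter ⊓
      𝓟 (AbsolutelyContinuousOnInterval.disjWithin 0 T),
      E ∈ AbsolutelyContinuousOnInterval.disjWithin 0 T :=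
    eventually_inf_principal.2 (Eventually.of_forall fun _ => id)
  filter_upwards [hmem] with E hE
  rw [Finset.mul_sum, Finset.mul_sum, ← Finset.sum_add_distrib]
  refine Finset.sum_le_sum fun i hi => ?_
  obtain ⟨h1, h2⟩ := hE.1 i hi
  set s := (E.2 i).1
  set t := (E.2 i).2
  have e : B (a s) (b s) - B (a t) (b t) = B (a s - a t) (b s) + B (a t) (b s - b t) := by
    simp
  rw [dist_eq_norm, dist_eq_norm, dist_eq_norm, e]
  refine (norm_add_le _ _).trans (add_le_add ?_ ?_)
  · calc _ ≤ ‖B‖ * ‖a s - a t‖ * ‖b s‖ := B.le_opNorm₂ _ _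
      _ ≤ ‖B‖ * ‖a s - a t‖ * N := by gcongr; exact hN s h1
      _ = _ := by ring
  · calc _ ≤ ‖B‖ * ‖a t‖ * ‖b s - b t‖ := B.le_opNorm₂ _ _
      _ ≤ ‖B‖ * M * ‖b s - b t‖ := by gcongr; exact hM t h2

lemma IsPrimitive.continuousOn [CompleteSpace X] {T : ℝ} (hT : 0 ≤ T) {a α : ℝ → X}
    (ha : IsPrimitive T a α) : ContinuousOn a (Icc 0 T) := by
  have h : ContinuousOn (fun t => a 0 + ∫ s in (0 : ℝ)..t, α s) (Icc 0 T) := by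
    have := (absolutelyContinuous_integral ha.integrable).continuousOn
    rw [uIcc_of_le hT] at this
    exact continuousOn_const.add this
  exact h.congr ha.eq_add

lemma intervalIntegrable_bilin (B : X →L[ℝ] Y →L[ℝ] Z) {T : ℝ} (hT : 0 ≤ T) {a : ℝ → X}
    {β : ℝ → Y} (ha : ContinuousOn a (Icc 0 T)) (hb : IntervalIntegrable β volume 0 T) :
    IntervalIntegrable (fun t => B (a t) (β t)) volume 0 T := by
  rw [intervalIntegrable_iff, uIoc_of_le hT] at hb ⊢
  obtain ⟨M, hM⟩ := isCompact_Icc.exists_bound_of_continuousOn ha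
  refine Integrable.mono' (hb.norm.const_mul (‖B‖ * M)) ?_ ?_
  · exact B.aestronglyMeasurable_comp₂ ((ha.aestronglyMeasurable measurableSet_Icc).mono_measure
      (Measure.restrict_mono Ioc_subset_Icc_self le_rfl)) hb.aestronglyMeasurable
  · refine (ae_restrict_iff' measurableSet_Ioc).2 (Eventually.of_forall fun t ht => ?_)
    calc _ ≤ ‖B‖ * ‖a t‖ * ‖β t‖ := B.le_opNorm₂ _ _
      _ ≤ ‖B‖ * M * ‖β t‖ := by gcongr; exact hM t (Ioc_subset_Icc_self ht)

lemma absolutelyContinuous_const_add {F : Type*} [NormedAddCommGroup F] {a : ℝ → F} {T : ℝ} (c : F)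
    (ha : AbsolutelyContinuousOnInterval a 0 T) :
    AbsolutelyContinuousOnInterval (fun t => c + a t) 0 T := by
  simpa only [AbsolutelyContinuousOnInterval, dist_add_left] using ha

/-- The product rule. -/
lemma IsPrimitive.bilin [CompleteSpace X] [CompleteSpace Y] [CompleteSpace Z]
    (B : X →L[ℝ] Y →L[ℝ] Z) {T : ℝ} (hT : 0 ≤ T) {a α : ℝ → X} {b β : ℝ → Y}
    (ha : IsPrimitive T a α) (hb : IsPrimitive T b β) :
    IsPrimitive T (fun t => B (a t) (b t)) fun t => B (α t) (b t) + B (a t) (β t) := by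
  have hU : uIcc 0 T = Icc 0 T := uIcc_of_le hT
  have hint : IntervalIntegrable (fun t => B (α t) (b t) + B (a t) (β t)) volume 0 T :=
    (intervalIntegrable_bilin B.flip hT (hb.continuousOn hT) ha.integrable).add
      (intervalIntegrable_bilin B hT (ha.continuousOn hT) hb.integrable)
  refine ⟨hint, ?_⟩
  -- The difference of the two sides is absolutely continuous with derivative `0` almost everywhere.
  have hac := (absolutelyContinuous_bilin B
    (absolutelyContinuous_const_add (a 0) (absolutelyContinuous_integral ha.integrable))
    (absolutelyContinuous_const_add (b 0) (absolutelyContinuous_integral hb.integrable))).fun_sub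
      (absolutelyContinuous_integral hint)
  have hderiv : ∀ᵐ t, t ∈ uIcc 0 T → HasDerivAt (fun t =>
      B (a 0 + ∫ s in (0 : ℝ)..t, α s) (b 0 + ∫ s in (0 : ℝ)..t, β s)
        - ∫ s in (0 : ℝ)..t, (B (α s) (b s) + B (a s) (β s))) 0 t := by
    filter_upwards [ha.integrable.ae_hasDerivAt_integral, hb.integrable.ae_hasDerivAt_integral,
      hint.ae_hasDerivAt_integral] with t h1 h2 h3 ht
    have d1 := (h1 ht 0 left_mem_uIcc).const_add (a 0)
    have d2 := (h2 ht 0 left_mem_uIcc).const_add (b 0)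
    have d3 := h3 ht 0 left_mem_uIcc
    have d := (B.hasFDerivAt_of_bilinear d1.hasFDerivAt d2.hasFDerivAt).hasDerivAt.sub d3
    refine d.congr_deriv ?_
    rw [ha.eq_add t (hU ▸ ht), hb.eq_add t (hU ▸ ht)]
    simp [add_comm]
  obtain ⟨C, hC⟩ := hac.const_of_ae_hasDerivAt_zero hderiv
  intro t ht
  have h0 := hC 0 left_mem_uIcc
  have h1 := hC t (hU ▸ ht)
  simp only [intervalIntegral.integral_same, add_zero, sub_zero] at h0
  rw [sub_eq_iff_eq_add, ← h0] at h1
  rw [ha.eq_add t ht, hb.eq_add t ht]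
  exact h1

end Primitives

/-! ### The equation of the mollified velocity -/

section Evolution

lemma interval_eq_timeMeasure {X : Type*} [NormedAddCommGroup X] [NormedSpace ℝ X] {T : ℝ}
    (hT : 0 ≤ T) (f : ℝ → X) : ∫ t in (0 : ℝ)..T, f t = ∫ t, f t ∂timeMeasure T := by
  rw [intervalIntegral.integral_of_le hT, integral_Ioc_eq_integral_Ioo]

lemma intervalIntegrable_iff_timeMeasure {X : Type*} [NormedAddCommGroup X] {T : ℝ}
    (hT : 0 ≤ T) {f : ℝ → X} : IntervalIntegrable f volume 0 T ↔ Integrable f (timeMeasure T) := by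
  rw [intervalIntegrable_iff_integrableOn_Ioo_of_le hT]; rfl

lemma integrable_norm_sq {T : ℝ} (U : L2V T) : Integrable (fun t => ‖U t‖ ^ 2) (timeMeasure T) :=
  (memLp_two_iff_integrable_sq_norm (Lp.aestronglyMeasurable U)).1 (Lp.memLp U)

lemma integrable_comp_L2V {X : Type*} [NormedAddCommGroup X] {T : ℝ} (U : L2V T) {g : V → X}
    (hg : Continuous g) {C : ℝ} (hC : ∀ v, ‖g v‖ ≤ C * (1 + ‖v‖ ^ 2)) :
    Integrable (fun t => g (U t)) (timeMeasure T) := by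
  refine Integrable.mono' (((integrable_const (1 : ℝ)).add (integrable_norm_sq U)).const_mul C)
    (hg.comp_aestronglyMeasurable (Lp.aestronglyMeasurable U)) (Eventually.of_forall fun t => ?_)
  exact hC _

/-- The nonlinear and the viscous term of the weak equation, integrated by parts. -/
def momentum (ν : ℝ) (v : V) : L2Mat := tensorV v v - ν • V.grad v

lemma continuous_momentum (ν : ℝ) : Continuous (momentum ν) := by
  have h1 : Continuous fun v : V => V.grad v := gradL.continuous
  unfold momentum
  fun_prop

lemma exists_norm_tensorV_le : ∃ C, 0 ≤ C ∧ ∀ v w : V, ‖tensorV v w‖ ≤ C * ‖v‖ * ‖w‖ := by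
  have h : ∃ C, ∀ v w : V, ‖tensorV v w‖ ≤ C * ‖v‖ * ‖w‖ := ⟨_, tensorV.le_opNorm₂⟩
  obtain ⟨C, hC⟩ := h
  exact ⟨|C|, abs_nonneg C, fun v w => (hC v w).trans (by gcongr; exact le_abs_self C)⟩

lemma exists_norm_momentum_le (ν : ℝ) : ∃ C, ∀ v, ‖momentum ν v‖ ≤ C * (1 + ‖v‖ ^ 2) := by
  obtain ⟨C, hC, h⟩ := exists_norm_tensorV_le
  refine ⟨C + |ν|, fun v => ?_⟩
  have h2 : ‖ν • V.grad v‖ ≤ |ν| * ‖v‖ := by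
    rw [norm_smul, Real.norm_eq_abs]; gcongr; exact norm_grad_le v
  have h3 : ‖v‖ ≤ 1 + ‖v‖ ^ 2 := by nlinarith [sq_nonneg (‖v‖ - 1)]
  have h4 := mul_le_mul_of_nonneg_left h3 (abs_nonneg ν)
  calc _ ≤ _ := (norm_sub_le _ _).trans (add_le_add (h v v) h2)
    _ ≤ _ := by nlinarith

lemma integrable_momentum {T : ℝ} (ν : ℝ) (U : L2V T) :
    Integrable (fun t => momentum ν (U t)) (timeMeasure T) := by
  obtain ⟨C, hC⟩ := exists_norm_momentum_le ν
  exact integrable_comp_L2V U (continuous_momentum ν) hC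

lemma integrable_tensorV {T : ℝ} (U : L2V T) :
    Integrable (fun t => tensorV (U t) (U t)) (timeMeasure T) := by
  obtain ⟨C, hC, h⟩ := exists_norm_tensorV_le
  refine integrable_comp_L2V U (g := fun v => tensorV v v) (by fun_prop) (C := C) fun v =>
    (h v v).trans ?_
  nlinarith

lemma integrable_grad {T : ℝ} (U : L2V T) :
    Integrable (fun t => V.grad (U t)) (timeMeasure T) := by
  refine integrable_comp_L2V U (g := V.grad) gradL.continuous (C := 1) fun v =>
    (norm_grad_le v).trans ?_
  nlinarith [sq_nonneg (‖v‖ - 1)]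

/-- The product of a continuous and an integrable function of time. -/
lemma integrable_continuous_mul {T : ℝ} (hT : 0 ≤ T) {θ f : ℝ → ℝ} (hθ : ContinuousOn θ (Icc 0 T))
    (hf : Integrable f (timeMeasure T)) : Integrable (fun t => θ t * f t) (timeMeasure T) := by
  rw [← intervalIntegrable_iff_timeMeasure hT] at hf ⊢
  exact intervalIntegrable_bilin (ContinuousLinearMap.mul ℝ ℝ) hT hθ hf

variable {ν T : ℝ} {u₀ : L2Vec} {u : ℝ → L2Vec} {U : L2V T}

lemma divV_smul (c : ℝ) {ψ : T3 → Vec} (hψ : IsSolenoidal ψ) (x : T3) :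
    divV (fun z => c • ψ z) x = 0 := by
  rw [divV_const_smul c hψ.1, hψ.2.1, mul_zero]

/-- The weak equation for the test field `θ(t) ψ(x)`. -/
lemma IsWeakSolution.equation_smul (hT : 0 ≤ T) (hu : IsWeakSolution ν T u₀ u U) {θ : ℝ → ℝ}
    (hθ : ContDiff ℝ ∞ θ) {T' : ℝ} (hT' : T' < T) (hθ0 : ∀ t, T' ≤ t → θ t = 0) {ψ : T3 → Vec}
    (hψ : IsSolenoidal ψ) :
    -(∫ t, deriv θ t * inner ℝ (u t) (V.val (toV ψ hψ)) ∂timeMeasure T)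
      = θ 0 * inner ℝ u₀ (V.val (toV ψ hψ))
        + ∫ t, θ t * inner ℝ (momentum ν (U t)) (V.grad (toV ψ hψ)) ∂timeMeasure T := by
  have htest : IsTest T fun t x => θ t • ψ x := by
    refine ⟨?_, T', hT', fun t ht x => by simp [hθ0 t ht]⟩
    exact (hθ.comp contDiff_fst).smul (hψ.1.comp contDiff_snd)
  have heq := hu.equation _ htest fun t x => divV_smul (θ t) hψ x
  have e1 : ∀ t, ∫ x, inner ℝ (u t x) (deriv (fun s => θ s • ψ x) t)
      = deriv θ t * inner ℝ (u t) (V.val (toV ψ hψ)) := by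
    intro t
    rw [L2.inner_def, ← integral_const_mul]
    refine integral_congr_ae ?_
    filter_upwards [toV_val hψ] with x hx
    rw [hx, deriv_smul_const (hθ.differentiable (by simp)).differentiableAt, inner_smul_right]
  have e2 : ∀ᵐ t ∂timeMeasure T,
      ∫ x, ∑ i, ∑ j, u t x j * V.grad (U t) x (i, j) * (θ t • ψ x) i
        = θ t * -inner ℝ (tensorV (U t) (U t)) (V.grad (toV ψ hψ)) := by
    filter_upwards [hu.val_eq] with t ht
    have h1 := inner_grad_outerRightL hψ.1 (U t)
    have h2 : toL2 hψ.1.gradV.toC = V.grad (toV ψ hψ) :=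
      Lp.ext ((coeFn_toL2 hψ.1.gradV.toC).trans (toV_grad hψ).symm)
    rw [h2] at h1
    rw [← h1, L2.inner_def, ← integral_const_mul]
    refine integral_congr_ae ?_
    filter_upwards [coeFn_outerRightL hψ.1.toC (V.val (U t))] with x hx
    rw [hx, ht, inner_tensor, Finset.mul_sum]
    refine Finset.sum_congr rfl fun i _ => ?_
    rw [Finset.mul_sum]
    refine Finset.sum_congr rfl fun j _ => ?_
    change _ * _ * (θ t * ψ x i) = θ t * (_ * (ψ x i * _))
    ring
  have e3 : ∀ t, ∫ x, inner ℝ (V.grad (U t) x) (gradV (fun x => θ t • ψ x) x)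
      = θ t * inner ℝ (V.grad (U t)) (V.grad (toV ψ hψ)) := by
    intro t
    rw [L2.inner_def, ← integral_const_mul]
    refine integral_congr_ae ?_
    filter_upwards [toV_grad hψ] with x hx
    rw [hx, gradV_const_smul (θ t) hψ.1, inner_smul_right]
  have e4 : ∫ x, inner ℝ (u₀ x) (θ 0 • ψ x) = θ 0 * inner ℝ u₀ (V.val (toV ψ hψ)) := by
    rw [L2.inner_def, ← integral_const_mul]
    refine integral_congr_ae ?_
    filter_upwards [toV_val hψ] with x hx
    rw [hx, inner_smul_right]
  simp only [e1, e3] at heq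
  rw [integral_congr_ae e2, e4] at heq
  set Ψ := toV ψ hψ
  have hi : ∀ {F : ℝ → L2Mat}, Integrable F (timeMeasure T) →
      Integrable (fun t => θ t * inner ℝ (F t) (V.grad Ψ)) (timeMeasure T) := fun hF =>
    integrable_continuous_mul hT hθ.continuous.continuousOn (hF.inner_const _)
  have e5 : ∫ t, θ t * inner ℝ (momentum ν (U t)) (V.grad Ψ) ∂timeMeasure T
      = -(∫ t, θ t * -inner ℝ (tensorV (U t) (U t)) (V.grad Ψ) ∂timeMeasure T)
        - ν * ∫ t, θ t * inner ℝ (V.grad (U t)) (V.grad Ψ) ∂timeMeasure T := by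
    rw [← integral_neg, ← integral_const_mul, ← integral_sub]
    · refine integral_congr_ae (Eventually.of_forall fun t => ?_)
      simp only [momentum, inner_sub_left, inner_smul_left, conj_trivial]
      ring
    · simpa using hi (integrable_tensorV U)
    · exact (hi (integrable_grad U)).const_mul ν
  rw [e5]
  linarith

/-- A function supported in `(0, T)` has a smooth primitive that vanishes near `T`. -/
lemma exists_primitive_zero_near {g : ℝ → ℝ} (hg : ContDiff ℝ ∞ g) (hc : HasCompactSupport g)
    (hsub : tsupport g ⊆ Ioo 0 T) : ∃ θ : ℝ → ℝ, ContDiff ℝ ∞ θ ∧ (∀ t, HasDerivAt θ (g t) t) ∧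
      ∃ T' < T, ∀ t, T' ≤ t → θ t = 0 := by
  have hd : ∀ t, HasDerivAt (fun t => ∫ s in T..t, g s) (g t) t := fun t =>
    intervalIntegral.integral_hasDerivAt_right (hg.continuous.intervalIntegrable _ _)
      (hg.continuous.stronglyMeasurableAtFilter _ _) hg.continuous.continuousAt
  -- Integrating from `T` makes the primitive vanish to the right of the support of `g`.
  refine ⟨fun t => ∫ s in T..t, g s, ?_, hd, ?_⟩
  · rw [contDiff_infty_iff_deriv]
    exact ⟨fun t => (hd t).differentiableAt, by rwa [funext fun t => (hd t).deriv]⟩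
  · obtain ⟨T', hT', h⟩ : ∃ T' < T, ∀ t ∈ tsupport g, t ≤ T' := by
      rcases (tsupport g).eq_empty_or_nonempty with he | hne
      · exact ⟨T - 1, by linarith, by simp [he]⟩
      · obtain ⟨m, hm, hmax⟩ := hc.isCompact.exists_isGreatest hne
        exact ⟨m, (hsub hm).2, fun t ht => hmax ht⟩
    refine ⟨(T' + T) / 2, by linarith, fun t ht => ?_⟩
    refine intervalIntegral.integral_zero_ae (Eventually.of_forall fun s hs => ?_)
    refine image_eq_zero_of_notMem_tsupport fun hs' => ?_
    have h1 := h s hs'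
    have h2 : min T t < s := hs.1
    rcases min_cases T t with h3 | h3 <;> linarith

/-- The weak equation in integrated form. -/
lemma IsWeakSolution.isPrimitive_inner (hT : 0 < T) (hu : IsWeakSolution ν T u₀ u U)
    {ψ : T3 → Vec} (hψ : IsSolenoidal ψ) :
    IsPrimitive T (fun t => inner ℝ (u t) (V.val (toV ψ hψ)))
      fun t => inner ℝ (momentum ν (U t)) (V.grad (toV ψ hψ)) := by
  set f : ℝ → ℝ := fun t => inner ℝ (u t) (V.val (toV ψ hψ))
  set N : ℝ → ℝ := fun t => inner ℝ (momentum ν (U t)) (V.grad (toV ψ hψ))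
  have hN : IntervalIntegrable N volume 0 T :=
    (intervalIntegrable_iff_timeMeasure hT.le).2 ((integrable_momentum ν U).inner_const _)
  set G : ℝ → ℝ := fun t => f 0 + ∫ s in (0 : ℝ)..t, N s
  have hG : IsPrimitive T G N := ⟨hN, fun t _ => by simp [G]⟩
  have hGc := hG.continuousOn hT.le
  have hfc : ContinuousOn f (Icc 0 T) := hu.weak_continuous _
  -- The difference `f - G` is orthogonal to all test functions `g` on `(0, T)`: the weak equation
  -- is tested with the primitive `θ` of `g` that vanishes near `T`. As `θ 0` need not vanish, the term
  -- with the initial velocity enters and is cancelled by the choice of `G 0`.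
  have hae : ∀ᵐ t, t ∈ Ioo 0 T → f t - G t = 0 := by
    refine isOpen_Ioo.ae_eq_zero_of_integral_contDiff_smul_eq_zero
      (((hfc.sub hGc).mono Ioo_subset_Icc_self).locallyIntegrableOn measurableSet_Ioo)
      fun g hg hgc hgs => ?_
    obtain ⟨θ, hθ, hθd, T', hT', hθ0⟩ := exists_primitive_zero_near hg hgc hgs
    have h1 := hu.equation_smul hT.le hθ hT' hθ0 hψ
    have hθp : IsPrimitive T θ g := ⟨hg.continuous.intervalIntegrable _ _, fun t _ => by
      rw [intervalIntegral.integral_eq_sub_of_hasDerivAt (fun s _ => hθd s)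
        (hg.continuous.intervalIntegrable _ _)]; ring⟩
    have h2 := (hθp.bilin (ContinuousLinearMap.mul ℝ ℝ) hT.le hG).eq_add T (right_mem_Icc.2 hT.le)
    simp only [ContinuousLinearMap.mul_apply'] at h2
    rw [hθ0 T hT'.le, zero_mul, interval_eq_timeMeasure hT.le] at h2
    have hG0 : G 0 = inner ℝ u₀ (V.val (toV ψ hψ)) := by simp [G, f, hu.initial]
    have hi : ∀ {k : ℝ → ℝ}, ContinuousOn k (Icc 0 T) →
        Integrable (fun t => g t * k t) (timeMeasure T) := fun hk =>
      integrable_continuous_mul hT.le hg.continuous.continuousOn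
        ((hk.integrableOn_Icc).mono_set Ioo_subset_Icc_self)
    have hi2 : Integrable (fun t => θ t * N t) (timeMeasure T) :=
      integrable_continuous_mul hT.le hθ.continuous.continuousOn
        ((intervalIntegrable_iff_timeMeasure hT.le).1 hN)
    rw [integral_add (hi hGc) hi2, hG0] at h2
    simp only [(hθd _).deriv] at h1
    have h3 : ∫ t, g t • (f t - G t) = ∫ t, g t • (f t - G t) ∂timeMeasure T := by
      refine (setIntegral_eq_integral_of_forall_compl_eq_zero fun t ht => ?_).symm
      rw [image_eq_zero_of_notMem_tsupport fun h => ht (hgs h), zero_smul]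
    rw [h3]
    simp only [smul_eq_mul, mul_sub]
    rw [integral_sub (hi hfc) (hi hGc)]
    linarith
  refine ⟨hN, fun t ht => ?_⟩
  have h4 : f =ᵐ[volume.restrict (Icc 0 T)] G := by
    rw [restrict_Ioo_eq_restrict_Icc.symm]
    refine (ae_restrict_iff' measurableSet_Ioo).2 ?_
    filter_upwards [hae] with t h ht using sub_eq_zero.1 (h ht)
  exact Measure.eqOn_Icc_of_ae_eq volume hT.ne h4 hfc hGc ht

lemma mollL_mem_H {η : Vec → ℝ} (hη : IsKernel η) {δ : ℝ} (hδ : 0 < δ) {f : L2Vec} (hf : f ∈ H) :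
    mollL hη hδ f ∈ H := by
  rw [← Submodule.starProjection_eq_self_iff, ← sub_eq_zero]
  refine ext_inner_right ℝ fun y => ?_
  let L : L2Vec →L[ℝ] ℝ := (innerSL ℝ y).comp ((H.starProjection - 1).comp (mollL hη hδ))
  have hL : L f = 0 := by
    refine H_le_ker (fun φ hφ => ?_) hf
    have h : mollL hη hδ (V.val (toV φ hφ)) ∈ H := val_mem_H (mollV hη hδ (toV φ hφ))
    change inner ℝ y (H.starProjection (mollL hη hδ (V.val (toV φ hφ))) - mollL hη hδ _) = 0
    rw [Submodule.starProjection_eq_self_iff.2 h, sub_self, inner_zero_right]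
  rw [inner_zero_left, real_inner_comm]
  exact hL

lemma integrable_force {η : Vec → ℝ} (hη : IsKernel η) {δ : ℝ} (hδ : 0 < δ) (U : L2V T) :
    Integrable (fun t => force ν hη hδ (U t)) (timeMeasure T) :=
  ContinuousLinearMap.integrable_comp (H.starProjection.comp (ContinuousLinearMap.adjoint
    (gradConvL (convKernel_mollKer hη hδ) (contDiff_mollKer hη δ)))) (integrable_momentum ν U)

/-- The mollified velocity is absolutely continuous with values in `L²`, with derivative `force`. -/
lemma IsWeakSolution.isPrimitive_moll (hT : 0 < T) (hu : IsWeakSolution ν T u₀ u U) {η : Vec → ℝ}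
    (hη : IsKernel η) {δ : ℝ} (hδ : 0 < δ) :
    IsPrimitive T (fun t => mollL hη hδ (u t)) fun t => force ν hη hδ (U t) := by
  have hF := (intervalIntegrable_iff_timeMeasure hT.le).2 (integrable_force (ν := ν) hη hδ U)
  refine ⟨hF, fun t ht => ?_⟩
  have hFt : IntervalIntegrable (fun t => force ν hη hδ (U t)) volume 0 t :=
    hF.mono_set (uIcc_subset_uIcc left_mem_uIcc (by rwa [uIcc_of_le hT.le]))
  set d := mollL hη hδ (u t) - (mollL hη hδ (u 0) + ∫ s in (0 : ℝ)..t, force ν hη hδ (U s))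
  -- The defect `d` of the integrated equation lies in `H` and is orthogonal to all smooth
  -- solenoidal fields.
  have hdH : d ∈ H := by
    refine H.sub_mem (mollL_mem_H hη hδ (hu.mem_H t ht))
      (H.add_mem (mollL_mem_H hη hδ (hu.mem_H 0 (left_mem_Icc.2 hT.le))) ?_)
    rw [← Submodule.starProjection_eq_self_iff,
      ← ContinuousLinearMap.intervalIntegral_comp_comm _ hFt]
    simp_rw [Submodule.starProjection_eq_self_iff.2 (force_mem_H ν hη hδ _)]
  have hd0 : innerSL ℝ d d = 0 := by
    refine H_le_ker (fun ψ hψ => ?_) hdH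
    have hk := convKernel_mollKer hη hδ
    have hs := contDiff_mollKer hη δ
    have e : mollV hη hδ (toV ψ hψ) = toV _ (hψ.conv hk hs) :=
      Subtype.ext (convW_toV hk hs hψ)
    have h1 := (hu.isPrimitive_inner hT (hψ.conv hk hs)).eq_add t ht
    simp only [← e, val_mollV] at h1
    have h2 : ∀ s, inner ℝ (momentum ν (U s)) (V.grad (mollV hη hδ (toV ψ hψ)))
        = inner ℝ (V.val (toV ψ hψ)) (force ν hη hδ (U s)) := by
      intro s
      rw [real_inner_comm (force ν hη hδ (U s)), inner_force_of_mem_H ν hη hδ _ (val_mem_H _), gradConvL_val]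
      rfl
    have h3 : ∫ s in (0 : ℝ)..t, inner ℝ (V.val (toV ψ hψ)) (force ν hη hδ (U s))
        = inner ℝ (V.val (toV ψ hψ)) (∫ s in (0 : ℝ)..t, force ν hη hδ (U s)) :=
      (innerSL ℝ (V.val (toV ψ hψ))).intervalIntegral_comp_comm hFt
    simp only [h2, h3] at h1
    rw [innerSL_apply_apply, inner_sub_left, inner_add_left, inner_mollL, inner_mollL, h1,
      real_inner_comm (V.val (toV ψ hψ)) (∫ s in (0 : ℝ)..t, _)]
    ring
  rw [innerSL_apply_apply, inner_self_eq_zero] at hd0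
  exact sub_eq_zero.1 hd0

end Evolution

/-! ### Smooth functions of time and space -/

section Families

variable {F : Type*} [NormedAddCommGroup F] [NormedSpace ℝ F]

/-- Smooth functions on `ℝ × 𝕋³`. -/
def SmoothFamily (f : ℝ → T3 → F) : Prop :=
  ContDiff ℝ ∞ fun z : ℝ × Vec => f z.1 (toTorus z.2)

lemma SmoothFamily.smoothT {f : ℝ → T3 → F} (hf : SmoothFamily f) (t : ℝ) : SmoothT (f t) :=
  hf.comp (contDiff_const.prodMk contDiff_id)

/-- A smooth function on `ℝ × 𝕋³` as a curve of continuous functions. -/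
def SmoothFamily.curve {f : ℝ → T3 → F} (hf : SmoothFamily f) (t : ℝ) : C(T3, F) :=
  (hf.smoothT t).toC

lemma SmoothFamily.continuous {f : ℝ → T3 → F} (hf : SmoothFamily f) :
    Continuous fun p : ℝ × T3 => f p.1 p.2 :=
  (IsOpenQuotientMap.id.prodMap isOpenQuotientMap_toTorus).isQuotientMap.continuous_iff.2
    (ContDiff.continuous hf)

lemma SmoothFamily.continuous_curve {f : ℝ → T3 → F} (hf : SmoothFamily f) :
    Continuous hf.curve :=
  (ContinuousMap.curry ⟨_, hf.continuous⟩).continuous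

lemma SmoothFamily.hasDerivAt {f : ℝ → T3 → F} (hf : SmoothFamily f) (t : ℝ) (y : Vec) :
    HasDerivAt (fun s => f s (toTorus y))
      (fderiv ℝ (fun z : ℝ × Vec => f z.1 (toTorus z.2)) (t, y) (1, 0)) t := by
  have h1 := (ContDiff.differentiable hf (by simp)).differentiableAt (x := (t, y)) |>.hasFDerivAt
  have h2 : HasDerivAt (fun s : ℝ => (s, y)) ((1 : ℝ), (0 : Vec)) t :=
    (hasDerivAt_id t).prodMk (hasDerivAt_const t y)
  exact h1.comp_hasDerivAt t h2

lemma SmoothFamily.timeDeriv {f : ℝ → T3 → F} (hf : SmoothFamily f) :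
    SmoothFamily fun t x => deriv (fun s => f s x) t := by
  have h : (fun z : ℝ × Vec => deriv (fun s => f s (toTorus z.2)) z.1)
      = fun z => fderiv ℝ (fun z : ℝ × Vec => f z.1 (toTorus z.2)) z (1, 0) :=
    funext fun z => (hf.hasDerivAt z.1 z.2).deriv
  rw [SmoothFamily, h]
  exact (ContDiff.fderiv_right (m := ∞) hf (by simp)).clm_apply contDiff_const

lemma SmoothFamily.pderiv {f : ℝ → T3 → F} (hf : SmoothFamily f) (j : Fin 3) :
    SmoothFamily fun t => pderiv j (f t) := by
  have h : (fun z : ℝ × Vec => TorusNS.pderiv j (f z.1) (toTorus z.2))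
      = fun z => fderiv ℝ (fun z : ℝ × Vec => f z.1 (toTorus z.2)) z
        (0, EuclideanSpace.single j 1) := by
    funext z
    rw [pderiv_toTorus (hf.smoothT z.1)]
    have h1 := (ContDiff.differentiable hf (by simp)).differentiableAt (x := z) |>.hasFDerivAt
    have h2 : HasFDerivAt (fun y : Vec => (z.1, y)) (ContinuousLinearMap.inr ℝ ℝ Vec) z.2 :=
      hasFDerivAt_prodMk_right z.1 z.2
    have h3 := (HasFDerivAt.comp z.2 h1 h2).fderiv
    change fderiv ℝ (fun y : Vec => f z.1 (toTorus y)) z.2 = _ at h3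
    rw [h3]; rfl
  rw [SmoothFamily, h]
  exact (ContDiff.fderiv_right (m := ∞) hf (by simp)).clm_apply contDiff_const

lemma SmoothFamily.gradS {φ : ℝ → T3 → ℝ} (hφ : SmoothFamily φ) :
    SmoothFamily fun t => gradS (φ t) :=
  contDiff_piLp' 2 fun j => hφ.pderiv j

lemma SmoothFamily.lapS {φ : ℝ → T3 → ℝ} (hφ : SmoothFamily φ) :
    SmoothFamily fun t => lapS (φ t) :=
  ContDiff.sum fun j _ => (hφ.pderiv j).pderiv j

lemma SmoothFamily.isPrimitive [CompleteSpace F] {f : ℝ → T3 → F} (hf : SmoothFamily f) (T : ℝ) :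
    IsPrimitive T hf.curve hf.timeDeriv.curve := by
  have hc := hf.timeDeriv.continuous_curve
  refine ⟨hc.intervalIntegrable _ _, fun t _ => ContinuousMap.ext fun x => ?_⟩
  have h1 := (ContinuousMap.evalCLM ℝ x : C(T3, F) →L[ℝ] F).intervalIntegral_comp_comm
    (hc.intervalIntegrable (μ := volume) 0 t)
  obtain ⟨y, rfl⟩ := toTorus_surjective x
  have h2 : ∫ s in (0 : ℝ)..t, deriv (fun r => f r (toTorus y)) s
      = f t (toTorus y) - f 0 (toTorus y) := by
    refine intervalIntegral.integral_eq_sub_of_hasDerivAt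
      (fun s _ => (hf.hasDerivAt s y).differentiableAt.hasDerivAt) ?_
    refine Continuous.intervalIntegrable ?_ _ _
    exact hf.timeDeriv.continuous.comp (continuous_id.prodMk continuous_const)
  change ∫ s in (0 : ℝ)..t, deriv (fun r => f r (toTorus y)) s = _ at h1
  rw [h2] at h1
  change f t (toTorus y) = f 0 (toTorus y) + (∫ s in (0 : ℝ)..t, hf.timeDeriv.curve s) (toTorus y)
  change _ = (∫ s in (0 : ℝ)..t, hf.timeDeriv.curve s) (toTorus y) at h1
  rw [← h1]
  abel

end Families

/-! ### The local energy balance of the mollified velocity -/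

section MollifiedEnergy

/-- The flux of energy of `v` through a field `a` (the gradient of a test function): the transport
of kinetic energy and the work of the pressure, `½ ∫ |v|² v · a + ∫ Π(v ⊗ v) v · a`. -/
def energyFlux (a : C(T3, Vec)) (v : V) : ℝ :=
  1 / 2 * inner ℝ (tensorV v v) (outerL a (V.val v))
    + inner ℝ (pressureL (tensorV v v)) (dotL a (V.val v))

lemma inner_mulL_comm (a : C(T3, ℝ)) (f g : L2Vec) :
    inner ℝ (mulL a f) g = inner ℝ f (mulL a g) := by
  rw [L2.inner_def, L2.inner_def]
  refine integral_congr_ae ?_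
  filter_upwards [coeFn_mulL a f, coeFn_mulL a g] with x h1 h2
  rw [h1, h2, inner_smul_left, inner_smul_right]; rfl

/-- The balance of momentum tested with `φ w`. -/
lemma inner_force_mulL (ν : ℝ) {η : Vec → ℝ} (hη : IsKernel η) {δ : ℝ} (hδ : 0 < δ) (v : V)
    {φ : T3 → ℝ} (hφ : SmoothT φ) :
    inner ℝ (force ν hη hδ v) (mulL hφ.toC (V.val (mollV hη hδ v)))
      = energyFlux hφ.gradS.toC (mollV hη hδ v)
        - inner ℝ (V.grad (potential (fluxV ν hη hδ v))) (gradMul hφ (mollV hη hδ v)) := by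
  have h := inner_force ν hη hδ v (mul_mem_H1 hφ (mollV hη hδ v))
  change inner ℝ (force ν hη hδ v) (mulL hφ.toC (V.val (mollV hη hδ v)))
    = inner ℝ (tensorV (mollV hη hδ v) (mollV hη hδ v)) (gradMul hφ (mollV hη hδ v))
      + inner ℝ (pressureL _) (traceLp (gradMul hφ (mollV hη hδ v)))
      - inner ℝ _ (gradMul hφ (mollV hη hδ v)) at h
  rw [h, inner_tensorV_gradMul, traceLp_gradMul, energyFlux]

variable {ν T : ℝ} {u₀ : L2Vec} {u : ℝ → L2Vec} {U : L2V T}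

lemma ae_interval {T t : ℝ} (ht : t ∈ Icc 0 T) {p : ℝ → Prop}
    (h : ∀ᵐ s ∂timeMeasure T, p s) : ∀ᵐ s, s ∈ uIoc 0 t → p s := by
  rw [ae_restrict_iff' measurableSet_Ioo] at h
  filter_upwards [h, Measure.ae_ne volume T] with s hs hsT hst
  rw [uIoc_of_le ht.1] at hst
  exact hs ⟨hst.1, lt_of_le_of_ne (hst.2.trans ht.2) hsT⟩

lemma energy_rate (M' : L2Vec →L[ℝ] L2Vec) {M : L2Vec →L[ℝ] L2Vec}
    (hM : ∀ f g, inner ℝ (M f) g = inner ℝ f (M g)) {w f : L2Vec} {e d : ℝ}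
    (h : inner ℝ f (M w) = e - d) :
    1 / 2 * (inner ℝ (M' w + M f) w + inner ℝ (M w) f) = 1 / 2 * inner ℝ (M' w) w + e - d := by
  rw [inner_add_left, hM, real_inner_comm f (M w), h]
  ring

/-- The energy balance of the mollified velocity, localised by a smooth function `φ`. -/
lemma IsWeakSolution.mollified_energy (hT : 0 < T) (hu : IsWeakSolution ν T u₀ u U) {η : Vec → ℝ}
    (hη : IsKernel η) {δ : ℝ} (hδ : 0 < δ) {φ : ℝ → T3 → ℝ} (hφ : SmoothFamily φ) {t : ℝ}
    (ht : t ∈ Icc 0 T) :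
    1 / 2 * inner ℝ (mulL (hφ.curve t) (mollL hη hδ (u t))) (mollL hη hδ (u t))
        - 1 / 2 * inner ℝ (mulL (hφ.curve 0) (mollL hη hδ (u 0))) (mollL hη hδ (u 0))
      = ∫ s in (0 : ℝ)..t,
        (1 / 2 * inner ℝ (mulL (hφ.timeDeriv.curve s) (V.val (mollV hη hδ (U s))))
            (V.val (mollV hη hδ (U s)))
          + energyFlux (hφ.gradS.curve s) (mollV hη hδ (U s))
          - inner ℝ (V.grad (potential (fluxV ν hη hδ (U s))))
              (gradMul (hφ.smoothT s) (mollV hη hδ (U s)))) := by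
  have hw := hu.isPrimitive_moll hT hη hδ
  -- The product rule, applied to `φ w` and then to `⟨φ w, w⟩`.
  have h1 := (hφ.isPrimitive T).bilin (mulL (E := Vec)) hT.le hw
  have h2 : inner ℝ (mulL (hφ.curve t) (mollL hη hδ (u t))) (mollL hη hδ (u t))
      = inner ℝ (mulL (hφ.curve 0) (mollL hη hδ (u 0))) (mollL hη hδ (u 0))
        + ∫ s in (0 : ℝ)..t,
          (inner ℝ (mulL (hφ.timeDeriv.curve s) (mollL hη hδ (u s))
              + mulL (hφ.curve s) (force ν hη hδ (U s))) (mollL hη hδ (u s))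
            + inner ℝ (mulL (hφ.curve s) (mollL hη hδ (u s))) (force ν hη hδ (U s))) :=
    (h1.bilin (innerSL ℝ) hT.le hw).eq_add t ht
  rw [h2, mul_add, add_sub_cancel_left, ← intervalIntegral.integral_const_mul]
  refine intervalIntegral.integral_congr_ae (ae_interval ht ?_)
  filter_upwards [hu.val_eq] with s hs
  rw [← hs, ← val_mollV]
  exact energy_rate (mulL (hφ.timeDeriv.curve s)) (inner_mulL_comm (hφ.curve s))
    (inner_force_mulL ν hη hδ (U s) (hφ.smoothT s))

end MollifiedEnergy

/-! ### The minimization problem -/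

section Hilbert

variable {X Y : Type*} [NormedAddCommGroup X] [InnerProductSpace ℝ X] [NormedAddCommGroup Y]
  [InnerProductSpace ℝ Y]

/-- The factor by which the unconstrained minimizer `g`, with `‖D g‖ = s`, has to be scaled to lie in
the ball of radius `r`. -/
def scaleFactor (r s : ℝ) : ℝ := r / max r s

lemma scaleFactor_pos {r : ℝ} (hr : 0 < r) (s : ℝ) : 0 < scaleFactor r s :=
  div_pos hr (lt_max_of_lt_left hr)

lemma scaleFactor_mul_le {r : ℝ} (hr : 0 < r) (s : ℝ) : scaleFactor r s * s ≤ r := by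
  rw [scaleFactor, div_mul_eq_mul_div, div_le_iff₀ (lt_max_of_lt_left hr)]
  exact mul_le_mul_of_nonneg_left (le_max_right _ _) hr.le

lemma scaleFactor_le_one {r : ℝ} (hr : 0 < r) (s : ℝ) : scaleFactor r s ≤ 1 :=
  (div_le_one (lt_max_of_lt_left hr)).2 (le_max_left _ _)

lemma one_sub_scaleFactor_mul {r : ℝ} (hr : 0 < r) (s : ℝ) :
    (1 - scaleFactor r s) * (r - scaleFactor r s * s) = 0 := by
  rw [scaleFactor]
  rcases le_total s r with h | h
  · rw [max_eq_left h, div_self hr.ne']; ring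
  · rw [max_eq_right h, div_mul_cancel₀ _ (hr.trans_le h).ne', sub_self, mul_zero]

/-- The quadratic functional `½ ‖D v‖² - ⟨D g, D v⟩` on the ball `‖D v‖ ≤ r` exceeds its value at the
rescaled `g` by at least `½ ‖D (v - c g)‖²`. -/
lemma quadratic_ge {r : ℝ} (hr : 0 < r) (G y : Y) (hy : ‖y‖ ≤ r) :
    1 / 2 * ‖scaleFactor r ‖G‖ • G‖ ^ 2 - inner ℝ G (scaleFactor r ‖G‖ • G)
        + 1 / 2 * ‖y - scaleFactor r ‖G‖ • G‖ ^ 2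
      ≤ 1 / 2 * ‖y‖ ^ 2 - inner ℝ G y := by
  set c := scaleFactor r ‖G‖
  have h1 := one_sub_scaleFactor_mul hr ‖G‖
  have h2 := scaleFactor_le_one hr ‖G‖
  have h3 : inner ℝ G y ≤ ‖G‖ * r := (real_inner_le_norm G y).trans (by gcongr)
  rw [norm_sub_sq_real, norm_smul, inner_smul_right, inner_smul_right, real_inner_self_eq_norm_sq,
    real_inner_comm G y, Real.norm_eq_abs, mul_pow, sq_abs]
  have h4 := mul_le_mul_of_nonneg_left h3 (sub_nonneg.2 h2)
  have h5 : ‖G‖ * ((1 - c) * (r - c * ‖G‖)) = 0 := by rw [h1, mul_zero]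
  linarith

/-- Bounded sequences in separable Hilbert spaces have weakly convergent subsequences. -/
lemma exists_weakConv_subseq [CompleteSpace X] [TopologicalSpace.SeparableSpace X] {v : ℕ → X}
    {r : ℝ} (hv : ∀ n, ‖v n‖ ≤ r) : ∃ (k : ℕ → ℕ) (v' : X), StrictMono k ∧ WeakConv (v ∘ k) v' := by
  let f : ℕ → WeakDual ℝ X := fun n => StrongDual.toWeakDual (InnerProductSpace.toDual ℝ X (v n))
  have hf : ∀ n, f n ∈ WeakDual.toStrongDual ⁻¹' Metric.closedBall (0 : StrongDual ℝ X) r := by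
    intro n
    rw [mem_preimage, mem_closedBall_zero_iff]
    exact ((InnerProductSpace.toDual ℝ X).norm_map (v n)).trans_le (hv n)
  obtain ⟨F, -, k, hk, hlim⟩ := WeakDual.isSeqCompact_closedBall ℝ X 0 r hf
  refine ⟨k, (InnerProductSpace.toDual ℝ X).symm (WeakDual.toStrongDual F), hk, fun ℓ => ?_⟩
  have h1 := ((WeakDual.eval_continuous ((InnerProductSpace.toDual ℝ X).symm ℓ)).tendsto F).comp hlim
  have e1 : ∀ w : X, inner ℝ w ((InnerProductSpace.toDual ℝ X).symm ℓ) = ℓ w := fun w => by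
    rw [real_inner_comm, InnerProductSpace.toDual_symm_apply]
  have e2 : F ((InnerProductSpace.toDual ℝ X).symm ℓ)
      = ℓ ((InnerProductSpace.toDual ℝ X).symm (WeakDual.toStrongDual F)) := by
    rw [← e1, InnerProductSpace.toDual_symm_apply]; rfl
  rw [← e2]
  refine h1.congr fun n => ?_
  change inner ℝ (v (k n)) _ = _
  exact e1 _

end Hilbert

section Minimizer

instance : SecondCountableTopology L2Vec := Lp.SecondCountableTopology

instance : SecondCountableTopology L2Mat := Lp.SecondCountableTopology

instance : SecondCountableTopology W :=
  (WithLp.prodContinuousLinearEquiv 2 ℝ L2Vec L2Mat).toHomeomorph.secondCountableTopology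

instance : SecondCountableTopology V :=
  TopologicalSpace.Subtype.secondCountableTopology (V : Set W)

instance (T : ℝ) : SecondCountableTopology (L2V T) := Lp.SecondCountableTopology

/-- `L²(0, T; L²(𝕋³; ℝ^{3×3}))`. -/
abbrev L2L2Mat (T : ℝ) : Type := Lp L2Mat 2 (timeMeasure T)

/-- The gradient on `L²(0, T; V)`. -/
def gradT (T : ℝ) : L2V T →L[ℝ] L2L2Mat T := gradL.compLpL 2 (timeMeasure T)

lemma coeFn_gradT {T : ℝ} (v : L2V T) : gradT T v =ᵐ[timeMeasure T] fun t => V.grad (v t) :=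
  gradL.coeFn_compLpL v

/-- The potential of a time dependent matrix field. -/
def potentialT (T : ℝ) : L2L2Mat T →L[ℝ] L2V T := potential.compLpL 2 (timeMeasure T)

lemma coeFn_potentialT {T : ℝ} (J : L2L2Mat T) :
    potentialT T J =ᵐ[timeMeasure T] fun t => potential (J t) :=
  potential.coeFn_compLpL J

lemma norm_le_gradT {T : ℝ} (v : L2V T) : ‖v‖ ≤ 2 * ‖gradT T v‖ := by
  refine Lp.norm_le_mul_norm_of_ae_le_mul ?_
  filter_upwards [coeFn_gradT v] with t ht
  rw [ht]
  exact norm_V_le _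

lemma inner_gradT_potentialT {T : ℝ} (J : L2L2Mat T) (v : L2V T) :
    inner ℝ (gradT T (potentialT T J)) (gradT T v) = inner ℝ J (gradT T v) := by
  rw [L2.inner_def, L2.inner_def]
  refine integral_congr_ae ?_
  filter_upwards [coeFn_gradT v, coeFn_gradT (potentialT T J), coeFn_potentialT J] with t h1 h2 h3
  rw [h1, h2, h3, inner_grad_potential]

lemma norm_sq_gradT {T : ℝ} (v : L2V T) :
    ‖gradT T v‖ ^ 2 = ∫ t in Ioo 0 T, ‖V.grad (v t)‖ ^ 2 := by
  rw [← real_inner_self_eq_norm_sq, L2.inner_def]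
  refine integral_congr_ae ?_
  filter_upwards [coeFn_gradT v] with t ht
  rw [real_inner_self_eq_norm_sq, ht]

/-- The radius `‖b‖ / √2` of the enstrophy ball. -/
def radius (b : L2Vec) : ℝ := √(1 / 2 * ‖b‖ ^ 2)

lemma radius_pos {b : L2Vec} (hb : b ≠ 0) : 0 < radius b := by
  have := norm_pos_iff.2 hb
  exact Real.sqrt_pos.2 (by positivity)

lemma mem_enstrophyBall {T : ℝ} {b : L2Vec} {v : L2V T} :
    v ∈ enstrophyBall T b ↔ ‖gradT T v‖ ≤ radius b := by
  rw [enstrophyBall, mem_ofPred_eq, ← norm_sq_gradT, radius,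
    Real.le_sqrt (by positivity) (by positivity)]

lemma onsagerK_eq {T : ℝ} {J : L2L2Mat T} {j : ℝ → T3 → Mat}
    (hj : ∀ᵐ t ∂timeMeasure T, J t =ᵐ[volume] j t) (v : L2V T) :
    onsagerK T j v = 1 / 2 * ‖gradT T v‖ ^ 2 - inner ℝ (gradT T (potentialT T J)) (gradT T v) := by
  rw [inner_gradT_potentialT, ← real_inner_self_eq_norm_sq, L2.inner_def, L2.inner_def,
    ← integral_const_mul, ← integral_sub ((L2.integrable_inner _ _).const_mul _)
      (L2.integrable_inner _ _), onsagerK]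
  refine integral_congr_ae ?_
  filter_upwards [hj, coeFn_gradT v] with t h1 h2
  rw [h2, real_inner_self_eq_norm_sq, L2.inner_def (J t)]
  congr 1
  refine integral_congr_ae ?_
  filter_upwards [h1] with x hx
  rw [hx]

/-- The minimizer over the enstrophy ball is the rescaled potential of the flux. -/
lemma isMinimizer_iff {T : ℝ} {b : L2Vec} (hb : b ≠ 0) {J : L2L2Mat T} {j : ℝ → T3 → Mat}
    (hj : ∀ᵐ t ∂timeMeasure T, J t =ᵐ[volume] j t) (v : L2V T) :
    IsMinimizer T b j v
      ↔ v = scaleFactor (radius b) ‖gradT T (potentialT T J)‖ • potentialT T J := by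
  set G := gradT T (potentialT T J)
  set c := scaleFactor (radius b) ‖G‖
  have hr := radius_pos hb
  have hge : ∀ w ∈ enstrophyBall T b, onsagerK T j (c • potentialT T J)
      + 1 / 2 * ‖gradT T (w - c • potentialT T J)‖ ^ 2 ≤ onsagerK T j w := by
    intro w hw
    rw [onsagerK_eq hj, onsagerK_eq hj, map_sub, map_smul]
    exact quadratic_ge hr G (gradT T w) (mem_enstrophyBall.1 hw)
  have hmem : c • potentialT T J ∈ enstrophyBall T b := by
    rw [mem_enstrophyBall, map_smul, norm_smul, Real.norm_of_nonneg (scaleFactor_pos hr _).le]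
    exact scaleFactor_mul_le hr _
  constructor
  · rintro ⟨hv, hmin⟩
    have h1 := hge v hv
    have h2 : onsagerK T j v ≤ onsagerK T j (c • potentialT T J) := hmin hmem
    have h3 : ‖gradT T (v - c • potentialT T J)‖ ^ 2 ≤ 0 := by linarith
    have h4 : ‖gradT T (v - c • potentialT T J)‖ = 0 := by
      nlinarith [norm_nonneg (gradT T (v - c • potentialT T J))]
    have h5 := norm_le_gradT (v - c • potentialT T J)
    rw [h4, mul_zero] at h5
    exact sub_eq_zero.1 (norm_le_zero_iff.1 h5)
  · rintro rfl
    refine ⟨hmem, fun w hw => ?_⟩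
    have h1 := hge w hw
    have h2 := sq_nonneg ‖gradT T (w - c • potentialT T J)‖
    change onsagerK T j (c • potentialT T J) ≤ onsagerK T j w
    linarith

end Minimizer

section Flux

variable {ν T : ℝ} {u₀ : L2Vec} {u : ℝ → L2Vec} {U : L2V T}

lemma IsWeakSolution.exists_bound (hu : IsWeakSolution ν T u₀ u U) :
    ∃ M, 0 ≤ M ∧ ∀ᵐ t ∂timeMeasure T, ‖V.val (U t)‖ ≤ M := by
  refine ⟨(eLpNormEssSup u (timeMeasure T)).toReal, ENNReal.toReal_nonneg, ?_⟩
  have hfin : eLpNormEssSup u (timeMeasure T) ≠ ⊤ := by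
    rw [← eLpNorm_exponent_top]
    exact hu.bounded.eLpNorm_ne_top
  filter_upwards [hu.val_eq, enorm_ae_le_eLpNormEssSup u (timeMeasure T)] with t h1 h2
  rw [h1, ← toReal_enorm]
  exact ENNReal.toReal_mono hfin h2

lemma IsWeakSolution.memLp_flux (hu : IsWeakSolution ν T u₀ u U) {η : Vec → ℝ}
    (hη : IsKernel η) {δ : ℝ} (hδ : 0 < δ) :
    MemLp (fun t => fluxV ν hη hδ (U t)) 2 (timeMeasure T) := by
  obtain ⟨M, hM0, hM⟩ := hu.exists_bound
  obtain ⟨C, hC⟩ := exists_norm_fluxV_le ν hη hδ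
  refine MemLp.of_le ((((Lp.memLp U).norm.const_mul |ν|)).add (memLp_const (|C| * M ^ 2)))
    ((continuous_fluxV ν hη hδ).comp_aestronglyMeasurable (Lp.aestronglyMeasurable U)) ?_
  filter_upwards [hM] with t ht
  refine (hC _).trans ((le_abs_self _).trans' ?_)
  have h1 : C * ‖V.val (U t)‖ ^ 2 ≤ |C| * M ^ 2 := by
    gcongr
    exact le_abs_self C
  have h2 := mul_le_mul_of_nonneg_left (norm_grad_le (U t)) (abs_nonneg ν)
  change _ ≤ |ν| * ‖U t‖ + |C| * M ^ 2
  linarith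

/-- The flux of a weak solution as an element of `L²(0, T; L²)`. -/
def fluxT (hu : IsWeakSolution ν T u₀ u U) {η : Vec → ℝ} (hη : IsKernel η) {δ : ℝ} (hδ : 0 < δ) :
    L2L2Mat T :=
  (hu.memLp_flux hη hδ).toLp _

lemma coeFn_fluxT (hu : IsWeakSolution ν T u₀ u U) {η : Vec → ℝ} (hη : IsKernel η) {δ : ℝ}
    (hδ : 0 < δ) : fluxT hu hη hδ =ᵐ[timeMeasure T] fun t => fluxV ν hη hδ (U t) :=
  MemLp.coeFn_toLp (hu.memLp_flux hη hδ)

lemma fluxT_ae (hu : IsWeakSolution ν T u₀ u U) {η : Vec → ℝ} (hη : IsKernel η) {δ : ℝ}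
    (hδ : 0 < δ) : ∀ᵐ t ∂timeMeasure T, fluxT hu hη hδ t =ᵐ[volume] flux ν η δ (u t) := by
  filter_upwards [coeFn_fluxT hu hη hδ, hu.val_eq] with t h1 h2
  rw [h1, ← h2]
  exact coeFn_fluxV ν hη hδ (U t)

end Flux

/-! ### The vanishing of the Reynolds stress -/

section WeakLimits

variable {X : Type*} [NormedAddCommGroup X] [InnerProductSpace ℝ X]

/-- A bounded sequence that converges weakly when tested on a dense set of fields `D x` converges
weakly when tested on all of them. -/
lemma tendsto_inner_of_dense {E : Type*} [PseudoMetricSpace E] {D : E → X} {K : NNReal}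
    (hD : LipschitzWith K D) {a : ℕ → X} {a' : X} {R : ℝ} (ha : ∀ᶠ n in atTop, ‖a n‖ ≤ R)
    {s : Set E} (hs : Dense s)
    (h : ∀ x ∈ s, Tendsto (fun n => inner ℝ (a n) (D x)) atTop (𝓝 (inner ℝ a' (D x)))) (x : E) :
    Tendsto (fun n => inner ℝ (a n) (D x)) atTop (𝓝 (inner ℝ a' (D x))) := by
  rw [Metric.tendsto_nhds]
  intro ε hε
  set M := (|R| + ‖a'‖ + 1) * (K + 1)
  have hM : 0 < M := by positivity
  obtain ⟨y, hy, hxy⟩ := hs.exists_dist_lt x (ε := ε / (2 * M)) (by positivity)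
  filter_upwards [ha, Metric.tendsto_nhds.1 (h y hy) (ε / 2) (by positivity)] with n h1 h2
  rw [Real.dist_eq] at h2 ⊢
  have e : inner ℝ (a n) (D x) - inner ℝ a' (D x)
      = inner ℝ (a n - a') (D x - D y) + (inner ℝ (a n) (D y) - inner ℝ a' (D y)) := by
    simp only [inner_sub_left, inner_sub_right]; ring
  have h3 : ‖a n - a'‖ ≤ |R| + ‖a'‖ + 1 := (norm_sub_le _ _).trans (by linarith [le_abs_self R])
  have h4 : |inner ℝ (a n - a') (D x - D y)| ≤ M * (ε / (2 * M)) := by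
    calc _ ≤ ‖a n - a'‖ * ‖D x - D y‖ := abs_real_inner_le_norm _ _
      _ ≤ (|R| + ‖a'‖ + 1) * ((K + 1) * (ε / (2 * M))) := by
          gcongr
          rw [← dist_eq_norm]
          exact (hD.dist_le_mul x y).trans (by gcongr; linarith)
      _ = _ := by rw [← mul_assoc]
  have h5 : M * (ε / (2 * M)) = ε / 2 := by field_simp
  rw [e]
  linarith [abs_add_le (inner ℝ (a n - a') (D x - D y))
    (inner ℝ (a n) (D y) - inner ℝ a' (D y))]

/-- The pairing of a bounded weakly convergent and a strongly convergent sequence converges. -/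
lemma tendsto_inner_of_weak_of_strong {a b : ℕ → X} {a' b' : X} {R : ℝ}
    (ha : ∀ᶠ n in atTop, ‖a n‖ ≤ R)
    (hw : ∀ x, Tendsto (fun n => inner ℝ (a n) x) atTop (𝓝 (inner ℝ a' x)))
    (hb : Tendsto b atTop (𝓝 b')) :
    Tendsto (fun n => inner ℝ (a n) (b n)) atTop (𝓝 (inner ℝ a' b')) := by
  have h1 : Tendsto (fun n => inner ℝ (a n) (b n - b')) atTop (𝓝 0) := by
    have h2 := (tendsto_iff_norm_sub_tendsto_zero.1 hb).const_mul R
    rw [mul_zero] at h2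
    refine squeeze_zero_norm' ?_ h2
    filter_upwards [ha] with n hn
    exact (norm_inner_le_norm _ _).trans (by gcongr)
  have h3 := h1.add (hw b')
  rw [zero_add] at h3
  refine h3.congr fun n => ?_
  rw [inner_sub_right, sub_add_cancel]

end WeakLimits

section Flux

variable {ν T : ℝ} {u₀ : L2Vec} {u : ℝ → L2Vec} {U : L2V T}

/-- For a fixed field of `V` the Reynolds stress tends to zero in `L²`. -/
lemma tendsto_fluxV (ν : ℝ) {η : Vec → ℝ} (hη : IsKernel η) {δ : ℕ → ℝ} (hδ : ∀ n, 0 < δ n)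
    (hδ0 : Tendsto δ atTop (𝓝 0)) (v : V) :
    Tendsto (fun n => fluxV ν hη (hδ n) v) atTop (𝓝 (ν • V.grad v)) := by
  have h1 := tendsto_mollV hη hδ hδ0 v
  have h2 := tendsto_mollL hη hδ hδ0 (tensorV v v)
  have h3 : Tendsto (fun n => V.grad (mollV hη (hδ n) v)) atTop (𝓝 (V.grad v)) :=
    (gradL.continuous.tendsto v).comp h1
  have hc : Continuous fun v : V => tensorV v v := by fun_prop
  have h4 : Tendsto (fun n => tensorV (mollV hη (hδ n) v) (mollV hη (hδ n) v)) atTop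
      (𝓝 (tensorV v v)) := (hc.tendsto v).comp h1
  have h5 := (h3.const_smul ν).sub (h2.sub h4)
  rwa [sub_self, sub_zero] at h5

/-- A bound on the flux that is uniform in the scale of the mollification. -/
lemma exists_norm_fluxV_le_uniform (ν : ℝ) : ∃ C, ∀ {η : Vec → ℝ} (hη : IsKernel η) {δ : ℝ}
    (hδ : 0 < δ) (v : V), ‖fluxV ν hη hδ v‖ ≤ C * (1 + ‖v‖ ^ 2) := by
  obtain ⟨C, hC, h⟩ := exists_norm_tensorV_le
  refine ⟨|ν| + 2 * C, fun {η} hη {δ} hδ v => ?_⟩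
  have hm := norm_mollV_le hη hδ v
  have h1 : ‖ν • V.grad (mollV hη hδ v)‖ ≤ |ν| * ‖v‖ := by
    rw [norm_smul, Real.norm_eq_abs]
    gcongr
    exact (norm_grad_le _).trans hm
  have h2 : ‖mollL hη hδ (tensorV v v)‖ ≤ C * ‖v‖ * ‖v‖ := (norm_mollL_le _ _ _).trans (h v v)
  have h3 : ‖tensorV (mollV hη hδ v) (mollV hη hδ v)‖ ≤ C * ‖v‖ * ‖v‖ :=
    (h _ _).trans (by gcongr)
  have h4 : ‖v‖ ≤ 1 + ‖v‖ ^ 2 := by nlinarith [sq_nonneg (‖v‖ - 1)]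
  have h5 := mul_le_mul_of_nonneg_left h4 (abs_nonneg ν)
  calc _ ≤ _ := (norm_sub_le _ _).trans (add_le_add h1 ((norm_sub_le _ _).trans (add_le_add h2 h3)))
    _ ≤ _ := by nlinarith

/-- The fields in `L²(0, T; V)` which are essentially bounded. -/
def boundedFields (T : ℝ) : Set (L2V T) := {w | ∃ M, ∀ᵐ t ∂timeMeasure T, ‖w t‖ ≤ M}

lemma dense_boundedFields (T : ℝ) : Dense (boundedFields T) := by
  -- Simple functions are bounded.
  refine (Lp.simpleFunc.denseRange (E := V) (μ := timeMeasure T) (p := 2) (by simp)).mono ?_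
  rintro _ ⟨w, rfl⟩
  obtain ⟨M, hM⟩ := (Lp.simpleFunc.toSimpleFunc w).exists_forall_norm_le
  refine ⟨M, ?_⟩
  filter_upwards [Lp.simpleFunc.toSimpleFunc_eq_toFun w] with t ht
  rw [← ht]
  exact hM t

/-- Tested against a bounded field, the flux converges to the viscous flux: the contribution of the
Reynolds stress disappears. -/
lemma tendsto_inner_potential_of_bounded (hu : IsWeakSolution ν T u₀ u U) {η : Vec → ℝ}
    (hη : IsKernel η) {δ : ℕ → ℝ} (hδ : ∀ n, 0 < δ n) (hδ0 : Tendsto δ atTop (𝓝 0)) {w : L2V T}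
    (hw : w ∈ boundedFields T) :
    Tendsto (fun n => inner ℝ (gradT T (potentialT T (fluxT hu hη (hδ n)))) (gradT T w)) atTop
      (𝓝 (inner ℝ (ν • gradT T U) (gradT T w))) := by
  obtain ⟨M, hM⟩ := hw
  obtain ⟨C, hC⟩ := exists_norm_fluxV_le_uniform ν
  have e1 : inner ℝ (ν • gradT T U) (gradT T w)
      = ∫ t, inner ℝ (ν • V.grad (U t)) (V.grad (w t)) ∂timeMeasure T := by
    rw [L2.inner_def]
    refine integral_congr_ae ?_
    filter_upwards [Lp.coeFn_smul ν (gradT T U), coeFn_gradT U, coeFn_gradT w] with t h1 h2 h3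
    rw [h1, Pi.smul_apply, h2, h3]
  have e2 : ∀ n, inner ℝ (gradT T (potentialT T (fluxT hu hη (hδ n)))) (gradT T w)
      = ∫ t, inner ℝ (fluxV ν hη (hδ n) (U t)) (V.grad (w t)) ∂timeMeasure T := by
    intro n
    rw [inner_gradT_potentialT, L2.inner_def]
    refine integral_congr_ae ?_
    filter_upwards [coeFn_fluxT hu hη (hδ n), coeFn_gradT w] with t h1 h2
    rw [h1, h2]
  rw [e1]
  simp_rw [e2]
  refine tendsto_integral_of_dominated_convergence (fun t => C * (1 + ‖U t‖ ^ 2) * M)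
    (fun n => ?_) ((((integrable_const (1 : ℝ)).add (integrable_norm_sq U)).const_mul C).mul_const M)
    (fun n => ?_) (Eventually.of_forall fun t => ?_)
  · exact ((continuous_fluxV ν hη (hδ n)).comp_aestronglyMeasurable
      (Lp.aestronglyMeasurable U)).inner (gradL.continuous.comp_aestronglyMeasurable
        (Lp.aestronglyMeasurable w))
  · filter_upwards [hM] with t ht
    have h1 := hC hη (hδ n) (U t)
    exact (norm_inner_le_norm _ _).trans (mul_le_mul h1 ((norm_grad_le _).trans ht) (norm_nonneg _)
      ((norm_nonneg _).trans h1))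
  · exact (tendsto_fluxV ν hη hδ hδ0 (U t)).inner tendsto_const_nhds

/-- By the Poincaré inequality the gradient is injective on `L²(0, T; V)`. -/
lemma gradT_ne_zero {v : L2V T} (hv : v ≠ 0) : gradT T v ≠ 0 := fun h => by
  have := norm_le_gradT v
  rw [h, norm_zero, mul_zero] at this
  exact hv ((@norm_le_zero_iff (L2V T) _ v).1 this)

/-- If the minimizers have a weak limit `v' ≠ 0`, the scaling factors cannot tend to `0`, so that the
potentials of the fluxes stay bounded. -/
lemma eventually_norm_potential_le (hu : IsWeakSolution ν T u₀ u U) {η : Vec → ℝ}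
    (hη : IsKernel η) {δ : ℕ → ℝ} (hδ : ∀ n, 0 < δ n) (hδ0 : Tendsto δ atTop (𝓝 0)) {r : ℝ}
    (hr : 0 < r) {v' : L2V T} (hv' : v' ≠ 0)
    (h : WeakConv (fun n => scaleFactor r ‖gradT T (potentialT T (fluxT hu hη (hδ n)))‖
      • potentialT T (fluxT hu hη (hδ n))) v') :
    ∃ R, ∀ᶠ n in atTop, ‖gradT T (potentialT T (fluxT hu hη (hδ n)))‖ ≤ R := by
  set g : ℕ → L2L2Mat T := fun n => gradT T (potentialT T (fluxT hu hη (hδ n)))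
  set c : ℕ → ℝ := fun n => scaleFactor r ‖g n‖
  -- A bounded field that detects the weak limit.
  obtain ⟨w, hw, hne⟩ : ∃ w ∈ boundedFields T, inner ℝ (gradT T v') (gradT T w) ≠ 0 := by
    by_contra! hcon
    have hcl : IsClosed {w : L2V T | inner ℝ (gradT T v') (gradT T w) = 0} :=
      isClosed_eq (continuous_const.inner (gradT T).continuous) continuous_const
    have h0 : inner ℝ (gradT T v') (gradT T v') = 0 :=
      hcl.closure_subset_iff.2 hcon ((dense_boundedFields T).closure_eq ▸ mem_univ v')
    exact gradT_ne_zero hv' (inner_self_eq_zero.1 h0)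
  have h1 := tendsto_inner_potential_of_bounded hu hη hδ hδ0 hw
  have h2 : Tendsto (fun n => c n * inner ℝ (g n) (gradT T w)) atTop
      (𝓝 (inner ℝ (gradT T v') (gradT T w))) := by
    have h3 := h ((innerSL ℝ (gradT T w)).comp (gradT T))
    have e : ∀ x : L2V T, (innerSL ℝ (gradT T w)).comp (gradT T) x
        = inner ℝ (gradT T x) (gradT T w) := fun x =>
      real_inner_comm (gradT T x) (gradT T w)
    simp only [e] at h3
    refine h3.congr fun n => ?_
    rw [map_smul, inner_smul_left]; rfl
  set m := inner ℝ (ν • gradT T U) (gradT T w)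
  set ℓ := inner ℝ (gradT T v') (gradT T w)
  have hℓ : 0 < |ℓ| := abs_pos.2 hne
  refine ⟨2 * r * (|m| + 1) / |ℓ|, ?_⟩
  filter_upwards [h2.abs.eventually (lt_mem_nhds (half_lt_self hℓ)),
    h1.abs.eventually (gt_mem_nhds (lt_add_one |m|))] with n hn1 hn2
  have hc : 0 < c n := scaleFactor_pos hr _
  have hcr : c n * ‖g n‖ ≤ r := scaleFactor_mul_le hr _
  rw [abs_mul, abs_of_pos hc] at hn1
  -- As `c n * ⟨g n, ∇w⟩ → ℓ ≠ 0` while `⟨g n, ∇w⟩` stays bounded, `c n` is bounded from below.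
  have h5 : |ℓ| / 2 ≤ c n * (|m| + 1) := hn1.le.trans (by gcongr)
  rw [le_div_iff₀ hℓ]
  have h6 := mul_le_mul_of_nonneg_left h5 (norm_nonneg (g n))
  have h7 := mul_le_mul_of_nonneg_right hcr (by positivity : 0 ≤ |m| + 1)
  linarith

lemma inner_gradT_eq_potentialT (g : L2V T) (Ψ : L2L2Mat T) :
    inner ℝ (gradT T g) Ψ = inner ℝ (gradT T g) (gradT T (potentialT T Ψ)) := by
  rw [real_inner_comm, real_inner_comm (gradT T (potentialT T Ψ)), inner_gradT_potentialT]

lemma lipschitz_gradT (T : ℝ) : LipschitzWith 1 (gradT T) := by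
  refine LipschitzWith.of_dist_le_mul fun v w => ?_
  have e : dist v w = ‖v - w‖ := dist_eq_norm v w
  rw [dist_eq_norm, ← map_sub, NNReal.coe_one, e]
  refine Lp.norm_le_mul_norm_of_ae_le_mul ?_
  filter_upwards [coeFn_gradT (v - w)] with t ht
  rw [ht, one_mul]
  exact norm_grad_le _

/-- As long as they are bounded, the potentials of the fluxes converge weakly to `ν u`. -/
lemma tendsto_inner_potential (hu : IsWeakSolution ν T u₀ u U) {η : Vec → ℝ}
    (hη : IsKernel η) {δ : ℕ → ℝ} (hδ : ∀ n, 0 < δ n) (hδ0 : Tendsto δ atTop (𝓝 0)) {R : ℝ}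
    (hR : ∀ᶠ n in atTop, ‖gradT T (potentialT T (fluxT hu hη (hδ n)))‖ ≤ R) (Ψ : L2L2Mat T) :
    Tendsto (fun n => inner ℝ (gradT T (potentialT T (fluxT hu hη (hδ n)))) Ψ) atTop
      (𝓝 (inner ℝ (ν • gradT T U) Ψ)) := by
  have h := tendsto_inner_of_dense (lipschitz_gradT T) hR (dense_boundedFields T)
    (fun w hw => tendsto_inner_potential_of_bounded hu hη hδ hδ0 hw) (potentialT T Ψ)
  have e : inner ℝ (ν • gradT T U) (gradT T (potentialT T Ψ)) = inner ℝ (ν • gradT T U) Ψ := by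
    rw [inner_smul_left, inner_smul_left, ← inner_gradT_eq_potentialT]
  rw [e] at h
  exact h.congr fun n => (inner_gradT_eq_potentialT _ Ψ).symm

end Flux

/-! ### The energy balance in the limit -/

section Bounds

lemma exists_bound_bilin {X Y Z : Type*} [NormedAddCommGroup X] [NormedSpace ℝ X]
    [NormedAddCommGroup Y] [NormedSpace ℝ Y] [NormedAddCommGroup Z] [NormedSpace ℝ Z]
    (B : X →L[ℝ] Y →L[ℝ] Z) : ∃ C, 0 ≤ C ∧ ∀ x y, ‖B x y‖ ≤ C * ‖x‖ * ‖y‖ :=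
  ⟨‖B‖, norm_nonneg B, B.le_opNorm₂⟩

lemma exists_abs_energyFlux_le : ∃ C, 0 ≤ C ∧ ∀ (a : C(T3, Vec)) (v : V),
    |energyFlux a v| ≤ C * ‖a‖ * ‖v‖ ^ 2 * ‖V.val v‖ := by
  obtain ⟨C₁, h₁, hC₁⟩ := exists_norm_tensorV_le
  obtain ⟨C₂, h₂, hC₂⟩ := exists_bound_bilin outerL
  obtain ⟨C₃, h₃, hC₃⟩ := exists_bound_bilin dotL
  refine ⟨C₁ * C₂ + ‖pressureL‖ * C₁ * C₃, by positivity, fun a v => ?_⟩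
  have e1 : |inner ℝ (tensorV v v) (outerL a (V.val v))|
      ≤ C₁ * ‖v‖ * ‖v‖ * (C₂ * ‖a‖ * ‖V.val v‖) :=
    (abs_real_inner_le_norm _ _).trans (mul_le_mul (hC₁ v v) (hC₂ _ _) (norm_nonneg _)
      (by positivity))
  have e2 : |inner ℝ (pressureL (tensorV v v)) (dotL a (V.val v))|
      ≤ ‖pressureL‖ * (C₁ * ‖v‖ * ‖v‖) * (C₃ * ‖a‖ * ‖V.val v‖) :=
    (abs_real_inner_le_norm _ _).trans (mul_le_mul ((pressureL.le_opNorm _).trans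
      (mul_le_mul_of_nonneg_left (hC₁ v v) (norm_nonneg _))) (hC₃ _ _) (norm_nonneg _)
      (by positivity))
  have e3 : 0 ≤ C₁ * ‖v‖ * ‖v‖ * (C₂ * ‖a‖ * ‖V.val v‖) := by positivity
  calc |energyFlux a v| ≤ |1 / 2 * inner ℝ (tensorV v v) (outerL a (V.val v))|
        + |inner ℝ (pressureL (tensorV v v)) (dotL a (V.val v))| := abs_add_le _ _
    _ ≤ C₁ * ‖v‖ * ‖v‖ * (C₂ * ‖a‖ * ‖V.val v‖)
        + ‖pressureL‖ * (C₁ * ‖v‖ * ‖v‖) * (C₃ * ‖a‖ * ‖V.val v‖) := by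
        refine add_le_add ?_ e2
        rw [abs_mul, abs_of_pos (by norm_num : (0 : ℝ) < 1 / 2)]
        linarith
    _ = _ := by ring

lemma continuous_energyFlux : Continuous fun p : C(T3, Vec) × V => energyFlux p.1 p.2 := by
  have h0 : Continuous fun p : C(T3, Vec) × V => V.val p.2 := valL.continuous.comp continuous_snd
  have h1 : Continuous fun p : C(T3, Vec) × V => outerL p.1 (V.val p.2) :=
    (outerL.continuous.comp continuous_fst).clm_apply h0
  have h2 : Continuous fun p : C(T3, Vec) × V => dotL p.1 (V.val p.2) :=
    (dotL.continuous.comp continuous_fst).clm_apply h0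
  have hc : Continuous fun v : V => tensorV v v := by fun_prop
  have h3 : Continuous fun p : C(T3, Vec) × V => tensorV p.2 p.2 := hc.comp continuous_snd
  unfold energyFlux
  exact ((h3.inner h1).const_mul _).add ((pressureL.continuous.comp h3).inner h2)

/-- The part of the local energy balance which does not contain the viscosity. -/
def energyRate {φ : ℝ → T3 → ℝ} (hφ : SmoothFamily φ) (s : ℝ) (v : V) : ℝ :=
  1 / 2 * inner ℝ (mulL (hφ.timeDeriv.curve s) (V.val v)) (V.val v)
    + energyFlux (hφ.gradS.curve s) v

variable {φ : ℝ → T3 → ℝ} (hφ : SmoothFamily φ)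

lemma continuous_energyRate : Continuous fun p : ℝ × V => energyRate hφ p.1 p.2 := by
  have h0 : Continuous fun p : ℝ × V => V.val p.2 := valL.continuous.comp continuous_snd
  have h1 : Continuous fun p : ℝ × V => mulL (hφ.timeDeriv.curve p.1) (V.val p.2) :=
    (mulL.continuous.comp (hφ.timeDeriv.continuous_curve.comp continuous_fst)).clm_apply h0
  have h2 : Continuous fun p : ℝ × V => hφ.gradS.curve p.1 :=
    hφ.gradS.continuous_curve.comp continuous_fst
  have h3 : Continuous fun p : ℝ × V => (hφ.gradS.curve p.1, p.2) := h2.prodMk continuous_snd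
  have h4 : Continuous fun p : ℝ × V => energyFlux (hφ.gradS.curve p.1) p.2 :=
    Continuous.comp (g := fun p : C(T3, Vec) × V => energyFlux p.1 p.2)
      (f := fun p : ℝ × V => (hφ.gradS.curve p.1, p.2)) continuous_energyFlux h3
  have h5 : Continuous fun p : ℝ × V =>
      (inner ℝ (mulL (hφ.timeDeriv.curve p.1) (V.val p.2)) (V.val p.2) : ℝ) := h1.inner h0
  unfold energyRate
  exact (h5.const_mul (1 / 2)).add h4

lemma exists_abs_energyRate_le (T : ℝ) : ∃ C, 0 ≤ C ∧ ∀ s ∈ Icc 0 T, ∀ v : V,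
    |energyRate hφ s v| ≤ C * (1 + ‖V.val v‖) * ‖v‖ ^ 2 := by
  obtain ⟨C₁, h₁, hC₁⟩ := exists_abs_energyFlux_le
  obtain ⟨C₂, h₂, hC₂⟩ := exists_bound_bilin (mulL (E := Vec))
  obtain ⟨M₁, hM₁⟩ := isCompact_Icc.exists_bound_of_continuousOn
    (hφ.gradS.continuous_curve.continuousOn (s := Icc 0 T))
  obtain ⟨M₂, hM₂⟩ := isCompact_Icc.exists_bound_of_continuousOn
    (hφ.timeDeriv.continuous_curve.continuousOn (s := Icc 0 T))
  refine ⟨C₁ * |M₁| + C₂ * |M₂|, by positivity, fun s hs v => ?_⟩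
  have a1 := (hM₁ s hs).trans (le_abs_self M₁)
  have a2 := (hM₂ s hs).trans (le_abs_self M₂)
  have e1 : |energyFlux (hφ.gradS.curve s) v| ≤ C₁ * |M₁| * ‖v‖ ^ 2 * ‖V.val v‖ :=
    (hC₁ _ v).trans (by gcongr)
  have e2 : |inner ℝ (mulL (hφ.timeDeriv.curve s) (V.val v)) (V.val v)| ≤ C₂ * |M₂| * ‖v‖ ^ 2 := by
    calc _ ≤ ‖mulL (hφ.timeDeriv.curve s) (V.val v)‖ * ‖V.val v‖ := abs_real_inner_le_norm _ _
      _ ≤ C₂ * |M₂| * ‖v‖ * ‖v‖ := by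
        refine mul_le_mul ((hC₂ _ _).trans ?_) (norm_val_le v) (norm_nonneg _) (by positivity)
        gcongr
        exact norm_val_le v
      _ = _ := by ring
  have e3 : 0 ≤ C₂ * |M₂| * ‖v‖ ^ 2 := by positivity
  have e4 : 0 ≤ C₂ * |M₂| * ‖v‖ ^ 2 * ‖V.val v‖ := by positivity
  have e5 : 0 ≤ C₁ * |M₁| * ‖v‖ ^ 2 := by positivity
  calc |energyRate hφ s v|
      ≤ |1 / 2 * inner ℝ (mulL (hφ.timeDeriv.curve s) (V.val v)) (V.val v)|
        + |energyFlux (hφ.gradS.curve s) v| := abs_add_le _ _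
    _ ≤ C₂ * |M₂| * ‖v‖ ^ 2 + C₁ * |M₁| * ‖v‖ ^ 2 * ‖V.val v‖ := by
        refine add_le_add ?_ e1
        rw [abs_mul, abs_of_pos (by norm_num : (0 : ℝ) < 1 / 2)]
        linarith
    _ ≤ _ := by linarith

lemma continuous_gradMul : Continuous fun p : ℝ × V => gradMul (hφ.smoothT p.1) p.2 := by
  have h0 : Continuous fun p : ℝ × V => V.val p.2 := valL.continuous.comp continuous_snd
  have h1 : Continuous fun p : ℝ × V => V.grad p.2 := gradL.continuous.comp continuous_snd
  have h2 : Continuous fun p : ℝ × V => mulL (hφ.curve p.1) (V.grad p.2) :=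
    (mulL.continuous.comp (hφ.continuous_curve.comp continuous_fst)).clm_apply h1
  have h3 : Continuous fun p : ℝ × V => outerL (hφ.gradS.curve p.1) (V.val p.2) :=
    (outerL.continuous.comp (hφ.gradS.continuous_curve.comp continuous_fst)).clm_apply h0
  exact h2.add h3

lemma exists_norm_gradMul_le (T : ℝ) : ∃ C, 0 ≤ C ∧ ∀ s ∈ Icc 0 T, ∀ v : V,
    ‖gradMul (hφ.smoothT s) v‖ ≤ C * ‖v‖ := by
  obtain ⟨C₁, h₁, hC₁⟩ := exists_bound_bilin outerL
  obtain ⟨C₂, h₂, hC₂⟩ := exists_bound_bilin (mulL (E := Mat))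
  obtain ⟨M₁, hM₁⟩ := isCompact_Icc.exists_bound_of_continuousOn
    (hφ.gradS.continuous_curve.continuousOn (s := Icc 0 T))
  obtain ⟨M₂, hM₂⟩ := isCompact_Icc.exists_bound_of_continuousOn
    (hφ.continuous_curve.continuousOn (s := Icc 0 T))
  refine ⟨C₂ * |M₂| + C₁ * |M₁|, by positivity, fun s hs v => ?_⟩
  have a1 := (hM₁ s hs).trans (le_abs_self M₁)
  have a2 := (hM₂ s hs).trans (le_abs_self M₂)
  have e1 : ‖mulL (hφ.curve s) (V.grad v)‖ ≤ C₂ * |M₂| * ‖v‖ :=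
    (hC₂ _ _).trans (by gcongr; exact norm_grad_le v)
  have e2 : ‖outerL (hφ.gradS.curve s) (V.val v)‖ ≤ C₁ * |M₁| * ‖v‖ :=
    (hC₁ _ _).trans (by gcongr; exact norm_val_le v)
  rw [add_mul]
  exact (norm_add_le _ _).trans (add_le_add e1 e2)

end Bounds

section Limit

variable {ν T : ℝ} {u₀ : L2Vec} {u : ℝ → L2Vec} {U : L2V T} {φ : ℝ → T3 → ℝ}

lemma ae_mem_Icc (T : ℝ) : ∀ᵐ s ∂timeMeasure T, s ∈ Icc 0 T :=
  (ae_restrict_iff' measurableSet_Ioo).2 (Eventually.of_forall fun _ hs => Ioo_subset_Icc_self hs)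

lemma aestronglyMeasurable_time_prod {v : ℝ → V} (hv : AEStronglyMeasurable v (timeMeasure T)) :
    AEStronglyMeasurable (fun s => (s, v s)) (timeMeasure T) :=
  aestronglyMeasurable_id.prodMk hv

lemma integrable_energyRate (hφ : SmoothFamily φ) {v : ℝ → V}
    (hv : AEStronglyMeasurable v (timeMeasure T)) (hvU : ∀ s, ‖v s‖ ≤ ‖U s‖) {M : ℝ}
    (hM : ∀ᵐ s ∂timeMeasure T, ‖V.val (v s)‖ ≤ M) :
    Integrable (fun s => energyRate hφ s (v s)) (timeMeasure T) := by
  obtain ⟨C, hC, h⟩ := exists_abs_energyRate_le hφ T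
  have h1 : AEStronglyMeasurable (fun s => energyRate hφ s (v s)) (timeMeasure T) :=
    (continuous_energyRate hφ).comp_aestronglyMeasurable (f := fun s => (s, v s))
      (aestronglyMeasurable_time_prod hv)
  have h2 : Integrable (fun s => C * (1 + M) * ‖U s‖ ^ 2) (timeMeasure T) :=
    (integrable_norm_sq U).const_mul (C * (1 + M))
  refine h2.mono' h1 ?_
  filter_upwards [ae_mem_Icc T, hM] with s hs hM
  have hM0 : 0 ≤ M := (norm_nonneg _).trans hM
  refine (h s hs (v s)).trans ?_
  gcongr
  exact hvU s

/-- The gradient of `φ v`, cut off at the time `t`. -/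
def cutGradMul (hφ : SmoothFamily φ) (t : ℝ) (v : ℝ → V) : ℝ → L2Mat :=
  (Iio t).indicator fun s => gradMul (hφ.smoothT s) (v s)

lemma memLp_cutGradMul (hφ : SmoothFamily φ) (t : ℝ) {v : ℝ → V}
    (hv : AEStronglyMeasurable v (timeMeasure T)) (hvU : ∀ s, ‖v s‖ ≤ ‖U s‖) :
    MemLp (cutGradMul hφ t v) 2 (timeMeasure T) := by
  obtain ⟨C, hC, h⟩ := exists_norm_gradMul_le hφ T
  refine MemLp.of_le ((Lp.memLp U).norm.const_mul C) (AEStronglyMeasurable.indicator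
    ((continuous_gradMul hφ).comp_aestronglyMeasurable (aestronglyMeasurable_time_prod hv))
    measurableSet_Iio) ?_
  filter_upwards [ae_mem_Icc T] with s hs
  refine (norm_indicator_le_norm_self _ _).trans ((h s hs (v s)).trans ((le_abs_self _).trans' ?_))
  exact mul_le_mul_of_nonneg_left (hvU s) hC

lemma interval_eq_indicator {X : Type*} [NormedAddCommGroup X] [NormedSpace ℝ X] {t : ℝ}
    (ht : t ∈ Icc 0 T) (f : ℝ → X) :
    ∫ s in (0 : ℝ)..t, f s = ∫ s, (Iio t).indicator f s ∂timeMeasure T := by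
  rw [interval_eq_timeMeasure ht.1, integral_indicator measurableSet_Iio,
    Measure.restrict_restrict measurableSet_Iio]
  have e : Iio t ∩ Ioo 0 T = Ioo 0 t := by
    ext s
    rw [mem_inter_iff, mem_Iio, mem_Ioo, mem_Ioo]
    exact ⟨fun h => ⟨h.2.1, h.1⟩, fun h => ⟨h.2, h.1, h.2.trans_le ht.2⟩⟩
  rw [e]

/-- The integral over `(0, t)` of a pairing with the gradient of `φ v` as an inner product in
`L²(0, T; L²)`. -/
lemma interval_inner_eq (hφ : SmoothFamily φ) {t : ℝ} (ht : t ∈ Icc 0 T) {v : ℝ → V}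
    (hv : MemLp (cutGradMul hφ t v) 2 (timeMeasure T)) (G : L2L2Mat T) :
    ∫ s in (0 : ℝ)..t, inner ℝ (G s) (gradMul (hφ.smoothT s) (v s)) = inner ℝ G (hv.toLp _) := by
  rw [interval_eq_indicator ht, L2.inner_def]
  refine integral_congr_ae ?_
  filter_upwards [hv.coeFn_toLp] with s hs
  rw [hs, cutGradMul]
  by_cases h : s ∈ Iio t <;> simp [h]

lemma intervalIntegrable_inner (hφ : SmoothFamily φ) {t : ℝ} (ht : t ∈ Icc 0 T) {v : ℝ → V}
    (hv : MemLp (cutGradMul hφ T v) 2 (timeMeasure T)) (G : L2L2Mat T) :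
    IntervalIntegrable (fun s => inner ℝ (G s) (gradMul (hφ.smoothT s) (v s))) volume 0 t := by
  have hT : 0 ≤ T := ht.1.trans ht.2
  refine IntervalIntegrable.mono_set ((intervalIntegrable_iff_timeMeasure hT).2 ?_)
    (uIcc_subset_uIcc left_mem_uIcc (by rwa [uIcc_of_le hT]))
  refine (L2.integrable_inner (𝕜 := ℝ) G (hv.toLp _)).congr ?_
  filter_upwards [hv.coeFn_toLp, (ae_restrict_iff' measurableSet_Ioo).2
    (Eventually.of_forall fun (s : ℝ) (hs : s ∈ Ioo 0 T) => hs)] with s h1 h2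
  rw [h1, cutGradMul, indicator_of_mem (mem_Iio.2 h2.2)]

/-- Dominated convergence: pointwise convergence `v n → u` below `‖u‖` gives strong convergence of the
cut off gradients. -/
lemma tendsto_cutGradMul (hφ : SmoothFamily φ) (t : ℝ) {v : ℕ → ℝ → V}
    (hv : ∀ n, AEStronglyMeasurable (v n) (timeMeasure T)) (hvU : ∀ n s, ‖v n s‖ ≤ ‖U s‖)
    (hlim : ∀ s, Tendsto (fun n => v n s) atTop (𝓝 (U s))) :
    Tendsto (fun n => (memLp_cutGradMul hφ t (hv n) (hvU n)).toLp _) atTop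
      (𝓝 ((memLp_cutGradMul hφ t (Lp.aestronglyMeasurable U) fun _ => le_rfl).toLp _)) := by
  obtain ⟨C, hC, h⟩ := exists_norm_gradMul_le hφ T
  have hU := memLp_cutGradMul (U := U) hφ t (Lp.aestronglyMeasurable U) fun _ => le_rfl
  rw [tendsto_iff_norm_sub_tendsto_zero]
  have h1 : Tendsto (fun n => ∫ s, ‖cutGradMul hφ t (v n) s - cutGradMul hφ t U s‖ ^ 2
      ∂timeMeasure T) atTop (𝓝 (∫ _, (0 : ℝ) ∂timeMeasure T)) := by
    refine tendsto_integral_of_dominated_convergence (fun s => (2 * C * ‖U s‖) ^ 2)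
      (fun n => ?_) ?_ (fun n => ?_) (Eventually.of_forall fun s => ?_)
    · exact ((memLp_cutGradMul hφ t (hv n) (hvU n)).1.sub hU.1).norm.pow 2
    · simp_rw [mul_pow]
      exact (integrable_norm_sq U).const_mul _
    · filter_upwards [ae_mem_Icc T] with s hs
      rw [Real.norm_of_nonneg (sq_nonneg _)]
      have hb : ∀ w : ℝ → V, ‖w s‖ ≤ ‖U s‖ → ‖cutGradMul hφ t w s‖ ≤ C * ‖U s‖ := fun w hw =>
        (norm_indicator_le_norm_self _ _).trans ((h s hs (w s)).trans
          (mul_le_mul_of_nonneg_left hw hC))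
      have := (norm_sub_le (cutGradMul hφ t (v n) s) (cutGradMul hφ t U s)).trans
        (add_le_add (hb _ (hvU n s)) (hb _ le_rfl))
      gcongr
      linarith
    · have h2 : Tendsto (fun n => cutGradMul hφ t (v n) s) atTop (𝓝 (cutGradMul hφ t U s)) := by
        by_cases hs : s ∈ Iio t
        · simp only [cutGradMul, indicator_of_mem hs]
          exact ((gradMul (hφ.smoothT s)).continuous.tendsto _).comp (hlim s)
        · simp only [cutGradMul, indicator_of_notMem hs]
          exact tendsto_const_nhds
      have h3 := ((tendsto_iff_norm_sub_tendsto_zero.1 h2).pow 2)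
      simpa using h3
  rw [integral_zero] at h1
  have h2 := (Real.continuous_sqrt.tendsto 0).comp h1
  rw [Real.sqrt_zero] at h2
  refine h2.congr fun n => ?_
  rw [Function.comp_apply, ← MemLp.toLp_sub, Real.sqrt_eq_iff_mul_self_eq
    (integral_nonneg fun s => sq_nonneg _) (norm_nonneg _), ← sq, ← real_inner_self_eq_norm_sq,
    L2.inner_def]
  refine integral_congr_ae ?_
  filter_upwards [((memLp_cutGradMul hφ t (hv n) (hvU n)).sub hU).coeFn_toLp] with s hs
  rw [hs, real_inner_self_eq_norm_sq]; rfl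

set_option maxHeartbeats 1600000 in
/-- The local energy balance of a weak solution for which the potentials of the fluxes stay bounded:
no energy is lost in the limit. -/
lemma IsWeakSolution.local_energy (hT : 0 < T) (hu : IsWeakSolution ν T u₀ u U) {η : Vec → ℝ}
    (hη : IsKernel η) {δ : ℕ → ℝ} (hδ : ∀ n, 0 < δ n) (hδ0 : Tendsto δ atTop (𝓝 0)) {R : ℝ}
    (hR : ∀ᶠ n in atTop, ‖gradT T (potentialT T (fluxT hu hη (hδ n)))‖ ≤ R)
    (hφ : SmoothFamily φ) {t : ℝ} (ht : t ∈ Icc 0 T) :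
    1 / 2 * inner ℝ (mulL (hφ.curve t) (u t)) (u t)
        - 1 / 2 * inner ℝ (mulL (hφ.curve 0) u₀) u₀
      = (∫ s in (0 : ℝ)..t, energyRate hφ s (U s))
        - ν * ∫ s in (0 : ℝ)..t, inner ℝ (V.grad (U s)) (gradMul (hφ.smoothT s) (U s)) := by
  have htT : uIcc 0 t ⊆ uIcc 0 T :=
    uIcc_subset_uIcc left_mem_uIcc (by rwa [uIcc_of_le hT.le])
  obtain ⟨M, hM0, hM⟩ := hu.exists_bound
  set v : ℕ → ℝ → V := fun n s => mollV hη (hδ n) (U s)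
  have hv : ∀ n, AEStronglyMeasurable (v n) (timeMeasure T) := fun n =>
    (mollV hη (hδ n)).continuous.comp_aestronglyMeasurable (Lp.aestronglyMeasurable U)
  have hvU : ∀ n s, ‖v n s‖ ≤ ‖U s‖ := fun n s => norm_mollV_le hη (hδ n) (U s)
  have hvM : ∀ n, ∀ᵐ s ∂timeMeasure T, ‖V.val (v n s)‖ ≤ M := fun n => by
    filter_upwards [hM] with s hs using (norm_mollL_le hη (hδ n) _).trans hs
  have hlim : ∀ s, Tendsto (fun n => v n s) atTop (𝓝 (U s)) := fun s =>
    tendsto_mollV hη hδ hδ0 (U s)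
  set G : ℕ → L2L2Mat T := fun n => gradT T (potentialT T (fluxT hu hη (hδ n)))
  have hG : ∀ n, ∀ᵐ s ∂timeMeasure T,
      G n s = V.grad (potential (fluxV ν hη (hδ n) (U s))) := fun n => by
    filter_upwards [coeFn_gradT (potentialT T (fluxT hu hη (hδ n))),
      coeFn_potentialT (fluxT hu hη (hδ n)), coeFn_fluxT hu hη (hδ n)] with s h1 h2 h3
    rw [h1, h2, h3]
  have hrate : ∀ n, IntervalIntegrable (fun s => energyRate hφ s (v n s)) volume 0 t := fun n =>
    ((intervalIntegrable_iff_timeMeasure hT.le).2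
      (integrable_energyRate hφ (hv n) (hvU n) (hvM n))).mono_set htT
  have hvisc : ∀ n, IntervalIntegrable
      (fun s => inner ℝ (G n s) (gradMul (hφ.smoothT s) (v n s))) volume 0 t := fun n =>
    intervalIntegrable_inner hφ ht (memLp_cutGradMul hφ T (hv n) (hvU n)) (G n)
  have hn : ∀ n, 1 / 2 * inner ℝ (mulL (hφ.curve t) (mollL hη (hδ n) (u t)))
        (mollL hη (hδ n) (u t))
      - 1 / 2 * inner ℝ (mulL (hφ.curve 0) (mollL hη (hδ n) (u 0))) (mollL hη (hδ n) (u 0))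
      = (∫ s in (0 : ℝ)..t, energyRate hφ s (v n s))
        - inner ℝ (G n) ((memLp_cutGradMul hφ t (hv n) (hvU n)).toLp _) := by
    intro n
    rw [hu.mollified_energy hT hη (hδ n) hφ ht, ← interval_inner_eq hφ ht,
      ← intervalIntegral.integral_sub (hrate n) (hvisc n)]
    refine intervalIntegral.integral_congr_ae (ae_interval ht ?_)
    filter_upwards [hG n] with s hs
    rw [hs]; rfl
  have hl : ∀ s, Tendsto (fun n => 1 / 2 * inner ℝ (mulL (hφ.curve s) (mollL hη (hδ n) (u s)))
      (mollL hη (hδ n) (u s))) atTop (𝓝 (1 / 2 * inner ℝ (mulL (hφ.curve s) (u s)) (u s))) := by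
    intro s
    have h1 := tendsto_mollL hη hδ hδ0 (u s)
    exact ((((mulL (hφ.curve s)).continuous.tendsto (u s)).comp h1).inner h1).const_mul _
  have h1 : Tendsto (fun n => ∫ s in (0 : ℝ)..t, energyRate hφ s (v n s)) atTop
      (𝓝 (∫ s in (0 : ℝ)..t, energyRate hφ s (U s))) := by
    obtain ⟨C, hC, hCb⟩ := exists_abs_energyRate_le hφ T
    refine intervalIntegral.tendsto_integral_filter_of_dominated_convergence
      (fun s => C * (1 + M) * ‖U s‖ ^ 2) (Eventually.of_forall fun n =>
        (hrate n).aestronglyMeasurable_restrict_uIoc) (Eventually.of_forall fun n =>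
          ae_interval ht ?_) ?_ (Eventually.of_forall fun s _ => ?_)
    · filter_upwards [ae_mem_Icc T, hvM n] with s hs hM
      refine (hCb s hs (v n s)).trans ?_
      gcongr
      exact hvU n s
    · exact ((intervalIntegrable_iff_timeMeasure hT.le).2
        ((integrable_norm_sq U).const_mul _)).mono_set htT
    · exact (((continuous_energyRate hφ).comp (Continuous.prodMk_right s)).tendsto (U s)).comp
        (hlim s)
  -- The viscous term is the pairing in `L²(0, T; L²)` of `∇g`, which converges weakly, with the
  -- gradient of `φ w` cut off at `t`, which converges strongly.
  have h2 := tendsto_inner_of_weak_of_strong hR (tendsto_inner_potential hu hη hδ hδ0 hR)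
    (tendsto_cutGradMul hφ t hv hvU hlim)
  have h3 := tendsto_nhds_unique (((hl t).sub (hl 0)).congr hn) (h1.sub h2)
  rw [hu.initial] at h3
  rw [h3, inner_smul_left, ← interval_inner_eq hφ ht]
  congr 2
  refine intervalIntegral.integral_congr_ae (ae_interval ht ?_)
  filter_upwards [coeFn_gradT U] with s hs
  rw [hs]

end Limit

/-! ### The pressure of a weak solution and the transport of energy -/

section Transport

/-- The product of two square integrable functions, as an integrable function. -/
def smulL {E : Type*} [NormedAddCommGroup E] [NormedSpace ℝ E] :
    L2Real →L[ℝ] Lp E 2 (volume : Measure T3) →L[ℝ] Lp E 1 (volume : Measure T3) :=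
  (ContinuousLinearMap.lsmul ℝ ℝ).holderL volume 2 2 1

lemma coeFn_smulL {E : Type*} [NormedAddCommGroup E] [NormedSpace ℝ E] (g : L2Real)
    (f : Lp E 2 (volume : Measure T3)) : smulL g f =ᵐ[volume] fun x => g x • f x :=
  (ContinuousLinearMap.lsmul ℝ ℝ : ℝ →L[ℝ] E →L[ℝ] E).coeFn_holder (r := 1) g f

/-- The inclusion of `L²` in `L¹`. -/
def toL1 : L2Real →L[ℝ] Lp ℝ 1 (volume : Measure T3) := smulL (toL2 (1 : C(T3, ℝ)))

lemma coeFn_toL1 (f : L2Real) : toL1 f =ᵐ[volume] f := by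
  filter_upwards [coeFn_smulL (toL2 (1 : C(T3, ℝ))) f, coeFn_toL2 (1 : C(T3, ℝ))] with x h1 h2
  have : toL1 f x = smulL (toL2 (1 : C(T3, ℝ))) f x := rfl
  rw [this, h1, h2]
  exact one_smul ℝ (f x)

/-- The function `|v|² + 2 p`, where `p` is the pressure of `v`. -/
def bernoulli (v : V) : L2Real :=
  traceLp (tensorV v v) + (2 : ℝ) • pressureL (tensorV v v)

lemma coeFn_bernoulli (v : V) :
    bernoulli v =ᵐ[volume] fun x => ‖V.val v x‖ ^ 2 + 2 * pressureL (tensorV v v) x := by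
  filter_upwards [Lp.coeFn_add (traceLp (tensorV v v)) ((2 : ℝ) • pressureL (tensorV v v)),
    Lp.coeFn_smul (2 : ℝ) (pressureL (tensorV v v)), coeFn_traceLp (tensorV v v),
    coeFn_tensorV v v] with x h1 h2 h3 h4
  have : bernoulli v x = (traceLp (tensorV v v) + (2 : ℝ) • pressureL (tensorV v v)) x := rfl
  rw [this, h1, Pi.add_apply, h2, h3, h4, traceL_tensor, real_inner_self_eq_norm_sq]
  rfl

lemma continuous_bernoulli : Continuous bernoulli := by
  have hc : Continuous fun v : V => tensorV v v := by fun_prop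
  have h1 : Continuous fun v : V => pressureL (tensorV v v) := pressureL.continuous.comp hc
  unfold bernoulli
  exact (traceLp.continuous.comp hc).add (h1.fun_const_smul 2)

lemma exists_norm_bernoulli_le : ∃ C, 0 ≤ C ∧ ∀ v : V, ‖bernoulli v‖ ≤ C * ‖v‖ ^ 2 := by
  obtain ⟨C, hC, h⟩ := exists_norm_tensorV_le
  refine ⟨(‖traceLp‖ + 2 * ‖pressureL‖) * C, by positivity, fun v => ?_⟩
  have h1 : ‖traceLp (tensorV v v)‖ ≤ ‖traceLp‖ * ‖tensorV v v‖ := traceLp.le_opNorm _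
  have h2 : ‖pressureL (tensorV v v)‖ ≤ ‖pressureL‖ * ‖tensorV v v‖ := pressureL.le_opNorm _
  calc ‖bernoulli v‖ ≤ ‖traceLp (tensorV v v)‖ + ‖(2 : ℝ) • pressureL (tensorV v v)‖ :=
        norm_add_le _ _
    _ = ‖traceLp (tensorV v v)‖ + 2 * ‖pressureL (tensorV v v)‖ := by
        rw [norm_smul, Real.norm_eq_abs, abs_two]
    _ ≤ (‖traceLp‖ + 2 * ‖pressureL‖) * ‖tensorV v v‖ := by linarith
    _ ≤ (‖traceLp‖ + 2 * ‖pressureL‖) * (C * ‖v‖ * ‖v‖) := by gcongr; exact h v v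
    _ = _ := by ring

lemma inner_tensor_tensor (a b : Vec) :
    inner ℝ (tensor a a) (tensor a b) = ‖a‖ ^ 2 * inner ℝ a b := by
  rw [inner_tensor, EuclideanSpace.real_norm_sq_eq, PiLp.inner_apply, Finset.sum_mul_sum]
  refine Finset.sum_congr rfl fun i _ => Finset.sum_congr rfl fun j _ => ?_
  change a i * a j * (a i * b j) = a i ^ 2 * (b j * a j)
  ring

lemma energyFlux_eq (a : C(T3, Vec)) (v : V) :
    energyFlux a v = 1 / 2 * inner ℝ (bernoulli v) (dotL a (V.val v)) := by
  have h : inner ℝ (tensorV v v) (outerL a (V.val v))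
      = inner ℝ (traceLp (tensorV v v)) (dotL a (V.val v)) := by
    rw [L2.inner_def, L2.inner_def]
    refine integral_congr_ae ?_
    filter_upwards [coeFn_tensorV v v, coeFn_outerL a (V.val v), coeFn_traceLp (tensorV v v),
      coeFn_dotL a (V.val v)] with x h1 h2 h3 h4
    rw [h3, h4, h1, h2, inner_tensor_tensor, traceL_tensor, real_inner_self_eq_norm_sq]
    exact mul_comm _ _
  rw [energyFlux, bernoulli, inner_add_left, real_inner_smul_left, h]
  ring

end Transport

section Pressure

variable {ν T : ℝ} {u₀ : L2Vec} {u : ℝ → L2Vec} {U : L2V T}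

lemma memLp_pressure (U : L2V T) :
    MemLp (fun t => toL1 (pressureL (tensorV (U t) (U t)))) 1 (timeMeasure T) :=
  memLp_one_iff_integrable.2 ((toL1.comp pressureL).integrable_comp (integrable_tensorV U))

lemma inner_hess_tensor (ψ : T3 → ℝ) (a : Vec) (x : T3) :
    inner ℝ (hess ψ x) (tensor a a) = ∑ i, ∑ j, a i * a j * pderiv i (pderiv j ψ) x := by
  rw [inner_tensor]
  exact Finset.sum_congr rfl fun i _ => Finset.sum_congr rfl fun j _ => mul_comm _ _

lemma neg_integral_pressureL_mul_lapS (v : V) {ψ : T3 → ℝ} (hψ : SmoothT ψ) :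
    -(∫ x, pressureL (tensorV v v) x * lapS ψ x)
      = ∫ x, ∑ i, ∑ j, V.val v x i * V.val v x j * pderiv i (pderiv j ψ) x := by
  rw [integral_pressureL_mul_lapS _ hψ]
  refine integral_congr_ae ?_
  filter_upwards [coeFn_tensorV v v] with x hx
  rw [hx, inner_hess_tensor]

lemma IsWeakSolution.isPressure (hu : IsWeakSolution ν T u₀ u U) :
    IsPressure T u ((memLp_pressure U).toLp _) := by
  filter_upwards [hu.val_eq, (memLp_pressure U).coeFn_toLp] with t h1 h2
  rw [h2]
  have h3 := coeFn_toL1 (pressureL (tensorV (U t) (U t)))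
  refine ⟨(integral_congr_ae h3).trans (integral_pressureL _), fun ψ hψ => ?_⟩
  rw [← h1, ← neg_integral_pressureL_mul_lapS _ hψ]
  congr 1
  refine integral_congr_ae ?_
  filter_upwards [h3] with x hx
  rw [hx]

/-- The defining equations determine the pressure. -/
lemma IsWeakSolution.pressure_eq (hu : IsWeakSolution ν T u₀ u U)
    {p : Lp (Lp ℝ 1 (volume : Measure T3)) 1 (timeMeasure T)} (hp : IsPressure T u p) :
    ∀ᵐ t ∂timeMeasure T, p t =ᵐ[volume] pressureL (tensorV (U t) (U t)) := by
  filter_upwards [hu.val_eq, hp] with t h1 h2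
  have hi : Integrable (p t) := L1.integrable_coeFn (p t)
  have hq : Integrable (pressureL (tensorV (U t) (U t))) := integrable_L2 _
  have h3 : (fun x => p t x - pressureL (tensorV (U t) (U t)) x) =ᵐ[volume] 0 := by
    refine ae_eq_zero_of_integral_mul_lapS (hi.sub hq) ?_ fun ψ hψ => ?_
    · rw [integral_sub hi hq, h2.1, integral_pressureL, sub_zero]
    · have h4 := h2.2 ψ hψ
      rw [← h1, ← neg_integral_pressureL_mul_lapS _ hψ] at h4
      simp only [sub_mul]
      rw [integral_sub (integrable_mul_of_continuous hi hψ.lapS.continuous)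
        (integrable_mul_of_continuous hq hψ.lapS.continuous), sub_eq_zero]
      exact neg_injective h4
  filter_upwards [h3] with x hx
  exact sub_eq_zero.1 hx

lemma IsWeakSolution.existsUnique_pressure (hu : IsWeakSolution ν T u₀ u U) :
    ∃! p, IsPressure T u p := by
  refine ⟨_, hu.isPressure, fun p hp => Lp.ext ?_⟩
  filter_upwards [hu.pressure_eq hp, (memLp_pressure U).coeFn_toLp] with t h1 h2
  rw [h2]
  exact Lp.ext (h1.trans (coeFn_toL1 _).symm)

lemma IsWeakSolution.coeFn_bernoulli_ae (hu : IsWeakSolution ν T u₀ u U)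
    {p : Lp (Lp ℝ 1 (volume : Measure T3)) 1 (timeMeasure T)} (hp : IsPressure T u p) :
    ∀ᵐ t ∂timeMeasure T, bernoulli (U t) =ᵐ[volume] fun x => ‖u t x‖ ^ 2 + 2 * p t x := by
  filter_upwards [hu.val_eq, hu.pressure_eq hp] with t h1 h2
  filter_upwards [coeFn_bernoulli (U t), h2] with x h3 h4
  rw [h3, h4, h1]

lemma IsWeakSolution.transport_ae (hu : IsWeakSolution ν T u₀ u U)
    {p : Lp (Lp ℝ 1 (volume : Measure T3)) 1 (timeMeasure T)} (hp : IsPressure T u p) :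
    ∀ᵐ t ∂timeMeasure T, smulL (bernoulli (U t)) (V.val (U t))
      =ᵐ[volume] fun x => (‖u t x‖ ^ 2 + 2 * p t x) • u t x := by
  filter_upwards [hu.val_eq, hu.coeFn_bernoulli_ae hp] with t h1 h2
  filter_upwards [coeFn_smulL (bernoulli (U t)) (V.val (U t)), h2] with x h3 h4
  rw [h3, h4, h1]

lemma IsWeakSolution.integrable_transport (hu : IsWeakSolution ν T u₀ u U)
    {p : Lp (Lp ℝ 1 (volume : Measure T3)) 1 (timeMeasure T)} (hp : IsPressure T u p) :
    (∀ᵐ t ∂timeMeasure T, Integrable fun x => (‖u t x‖ ^ 2 + 2 * p t x) • u t x) ∧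
      Integrable (fun t => ∫ x, ‖(‖u t x‖ ^ 2 + 2 * p t x) • u t x‖) (timeMeasure T) := by
  constructor
  · filter_upwards [hu.transport_ae hp] with t ht
    exact (L1.integrable_coeFn (smulL (bernoulli (U t)) (V.val (U t)))).congr ht
  obtain ⟨M, hM0, hM⟩ := hu.exists_bound
  obtain ⟨C₁, h₁, hC₁⟩ := exists_norm_bernoulli_le
  obtain ⟨C₂, h₂, hC₂⟩ := exists_bound_bilin (smulL (E := Vec))
  have hc : Continuous fun v : V => smulL (bernoulli v) (V.val v) :=
    (smulL.continuous.comp continuous_bernoulli).clm_apply valL.continuous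
  have hm : AEStronglyMeasurable (fun t => ‖smulL (bernoulli (U t)) (V.val (U t))‖)
      (timeMeasure T) :=
    (hc.comp_aestronglyMeasurable (Lp.aestronglyMeasurable U)).norm
  have hi : Integrable (fun t => ‖smulL (bernoulli (U t)) (V.val (U t))‖) (timeMeasure T) := by
    refine Integrable.mono' ((integrable_norm_sq U).const_mul (C₂ * C₁ * M)) hm ?_
    filter_upwards [hM] with t ht
    rw [norm_norm]
    calc _ ≤ C₂ * ‖bernoulli (U t)‖ * ‖V.val (U t)‖ := hC₂ _ _
      _ ≤ C₂ * (C₁ * ‖U t‖ ^ 2) * M := by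
        gcongr
        exact hC₁ (U t)
      _ = _ := by ring
  refine hi.congr ?_
  filter_upwards [hu.transport_ae hp] with t ht
  rw [L1.norm_eq_integral_norm]
  refine integral_congr_ae ?_
  filter_upwards [ht] with x hx
  rw [hx]

end Pressure

/-! ### The energy equalities -/

section EnergyEqualities

lemma inner_mulL_self {E : Type*} [NormedAddCommGroup E] [InnerProductSpace ℝ E] (a : C(T3, ℝ))
    (f : Lp E 2 (volume : Measure T3)) : inner ℝ f (mulL a f) = ∫ x, ‖f x‖ ^ 2 * a x := by
  rw [L2.inner_def]
  refine integral_congr_ae ?_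
  filter_upwards [coeFn_mulL a f] with x hx
  rw [hx, inner_smul_right, real_inner_self_eq_norm_sq, mul_comm]

variable {ν T : ℝ} {u₀ : L2Vec} {u : ℝ → L2Vec} {U : L2V T} {φ : ℝ → T3 → ℝ}

/-- The balance of the energy localised by smooth functions `φ`, between the time `0` and any time
of `[0, T]`. -/
def EnergyBalance (ν T : ℝ) (u₀ : L2Vec) (u : ℝ → L2Vec) (U : L2V T) : Prop :=
  ∀ (φ : ℝ → T3 → ℝ) (hφ : SmoothFamily φ), ∀ t ∈ Icc 0 T,
    1 / 2 * inner ℝ (mulL (hφ.curve t) (u t)) (u t)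
        - 1 / 2 * inner ℝ (mulL (hφ.curve 0) u₀) u₀
      = (∫ s in (0 : ℝ)..t, energyRate hφ s (U s))
        - ν * ∫ s in (0 : ℝ)..t, inner ℝ (V.grad (U s)) (gradMul (hφ.smoothT s) (U s))

lemma integrable_inner_mulL {E : Type*} [NormedAddCommGroup E] [InnerProductSpace ℝ E]
    (hφ : SmoothFamily φ) {g : V → Lp E 2 (volume : Measure T3)} (hg : Continuous g)
    (hgv : ∀ v, ‖g v‖ ≤ ‖v‖) (U : L2V T) :
    Integrable (fun s => inner ℝ (g (U s)) (mulL (hφ.curve s) (g (U s)))) (timeMeasure T) := by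
  obtain ⟨C, hC, h⟩ := exists_bound_bilin (mulL (E := E))
  obtain ⟨M, hM⟩ := isCompact_Icc.exists_bound_of_continuousOn
    (hφ.continuous_curve.continuousOn (s := Icc 0 T))
  have h0 : Continuous fun p : ℝ × V => g p.2 := hg.comp continuous_snd
  have h1 : Continuous fun p : ℝ × V => mulL (hφ.curve p.1) (g p.2) :=
    (mulL.continuous.comp (hφ.continuous_curve.comp continuous_fst)).clm_apply h0
  have h2 : Continuous fun p : ℝ × V => (inner ℝ (g p.2) (mulL (hφ.curve p.1) (g p.2)) : ℝ) :=
    h0.inner h1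
  have h3 : AEStronglyMeasurable
      (fun s => (inner ℝ (g (U s)) (mulL (hφ.curve s) (g (U s))) : ℝ)) (timeMeasure T) :=
    h2.comp_aestronglyMeasurable (f := fun s => (s, U s))
      (aestronglyMeasurable_time_prod (Lp.aestronglyMeasurable U))
  refine Integrable.mono' ((integrable_norm_sq U).const_mul (C * |M|)) h3 ?_
  filter_upwards [ae_mem_Icc T] with s hs
  have a1 := (hM s hs).trans (le_abs_self M)
  have a2 := hgv (U s)
  calc _ ≤ ‖g (U s)‖ * ‖mulL (hφ.curve s) (g (U s))‖ := abs_real_inner_le_norm _ _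
    _ ≤ ‖U s‖ * (C * |M| * ‖U s‖) := by
      refine mul_le_mul a2 ((h _ _).trans ?_) (norm_nonneg _) (norm_nonneg _)
      gcongr
    _ = _ := by ring

set_option maxHeartbeats 1600000 in
/-- The energy balance between the times `0` and `T` for a function `φ` that vanishes at `T`, in
terms of the function `|u|² + 2 p`. -/
lemma IsWeakSolution.local_energy_test (hT : 0 < T) (hu : IsWeakSolution ν T u₀ u U)
    (hφ : SmoothFamily φ)
    (h : EnergyBalance ν T u₀ u U) (hφT : ∀ x, φ T x = 0) :
    2 * ν * (∫ s, inner ℝ (V.grad (U s)) (mulL (hφ.curve s) (V.grad (U s))) ∂timeMeasure T)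
      = (∫ s, (inner ℝ (V.val (U s)) (mulL (hφ.timeDeriv.curve s) (V.val (U s)))
            + ν * inner ℝ (V.val (U s)) (mulL (hφ.lapS.curve s) (V.val (U s)))) ∂timeMeasure T)
        + (∫ s, inner ℝ (bernoulli (U s)) (dotL (hφ.gradS.curve s) (V.val (U s))) ∂timeMeasure T)
        + inner ℝ u₀ (mulL (hφ.curve 0) u₀) := by
  obtain ⟨M, hM0, hM⟩ := hu.exists_bound
  have hval : Continuous fun v : V => V.val v := valL.continuous
  have hgrad : Continuous fun v : V => V.grad v := gradL.continuous
  have iA := integrable_inner_mulL hφ.timeDeriv hval norm_val_le U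
  have iL := integrable_inner_mulL hφ.lapS hval norm_val_le U
  have iD := integrable_inner_mulL hφ hgrad norm_grad_le U
  have iR := integrable_energyRate (U := U) (v := U) hφ (Lp.aestronglyMeasurable U)
    (fun _ => le_rfl) hM
  set A : ℝ → ℝ := fun s => inner ℝ (V.val (U s)) (mulL (hφ.timeDeriv.curve s) (V.val (U s)))
  set L : ℝ → ℝ := fun s => inner ℝ (V.val (U s)) (mulL (hφ.lapS.curve s) (V.val (U s)))
  set D : ℝ → ℝ := fun s => inner ℝ (V.grad (U s)) (mulL (hφ.curve s) (V.grad (U s)))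
  set B : ℝ → ℝ := fun s => inner ℝ (bernoulli (U s)) (dotL (hφ.gradS.curve s) (V.val (U s)))
  have eR : ∀ s, energyRate hφ s (U s) = 1 / 2 * A s + 1 / 2 * B s := fun s => by
    rw [energyRate, energyFlux_eq, inner_mulL_comm]
  have eG : ∀ s, inner ℝ (V.grad (U s)) (gradMul (hφ.smoothT s) (U s))
      = D s - 1 / 2 * L s := fun s => by
    have h1 := inner_grad_outerL (hφ.smoothT s) (U s)
    rw [inner_mulL_comm] at h1
    rw [gradMul_apply, inner_add_right, h1]
    change D s + -(1 / 2) * L s = D s - 1 / 2 * L s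
    ring
  have iB : Integrable B (timeMeasure T) := by
    have := (iR.const_mul 2).sub iA
    refine this.congr (Eventually.of_forall fun s => ?_)
    change 2 * energyRate hφ s (U s) - A s = B s
    rw [eR]
    ring
  have h1 := h φ hφ T ⟨hT.le, le_rfl⟩
  have h2 : mulL (hφ.curve T) (u T) = 0 := by
    have : hφ.curve T = 0 := ContinuousMap.ext hφT
    rw [this, map_zero]; rfl
  rw [h2, inner_zero_left, inner_mulL_comm, interval_eq_timeMeasure hT.le,
    interval_eq_timeMeasure hT.le] at h1
  simp only [eR, eG] at h1
  rw [integral_add (iA.const_mul _) (iB.const_mul _), integral_sub iD (iL.const_mul _),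
    integral_const_mul, integral_const_mul, integral_const_mul] at h1
  rw [integral_add iA (iL.const_mul _), integral_const_mul]
  linarith

lemma IsWeakSolution.localEnergyEq (hT : 0 < T) (hu : IsWeakSolution ν T u₀ u U)
    (h : EnergyBalance ν T u₀ u U)
    {p : Lp (Lp ℝ 1 (volume : Measure T3)) 1 (timeMeasure T)} (hp : IsPressure T u p) :
    LocalEnergyEq ν T u₀ u U p := by
  refine ⟨(hu.integrable_transport hp).1, (hu.integrable_transport hp).2, fun φ htest => ?_⟩
  obtain ⟨hφ, T', hT', hφT⟩ := htest
  have key := hu.local_energy_test hT hφ h (hφT T hT'.le)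
  have e1 : (∫ s, inner ℝ (V.grad (U s)) (mulL (SmoothFamily.curve hφ s) (V.grad (U s)))
        ∂timeMeasure T)
      = ∫ t in Ioo 0 T, ∫ x, ‖V.grad (U t) x‖ ^ 2 * φ t x :=
    integral_congr_ae (Eventually.of_forall fun s => inner_mulL_self _ _)
  have e2 : (∫ s, (inner ℝ (V.val (U s)) (mulL ((SmoothFamily.timeDeriv hφ).curve s)
            (V.val (U s)))
        + ν * inner ℝ (V.val (U s)) (mulL ((SmoothFamily.lapS hφ).curve s) (V.val (U s))))
        ∂timeMeasure T)
      = ∫ t in Ioo 0 T, ∫ x, ‖u t x‖ ^ 2 * (deriv (fun s => φ s x) t + ν * lapS (φ t) x) := by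
    refine integral_congr_ae ?_
    filter_upwards [hu.val_eq] with s hs
    rw [hs, ← real_inner_smul_right, ← inner_add_right]
    have h1 : mulL ((SmoothFamily.timeDeriv hφ).curve s) (u s)
        + ν • mulL ((SmoothFamily.lapS hφ).curve s) (u s)
        = mulL ((SmoothFamily.timeDeriv hφ).curve s + ν • (SmoothFamily.lapS hφ).curve s) (u s) := by
      rw [map_add, map_smul]; rfl
    rw [h1, inner_mulL_self]
    rfl
  have e3 : (∫ s, inner ℝ (bernoulli (U s)) (dotL ((SmoothFamily.gradS hφ).curve s) (V.val (U s)))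
        ∂timeMeasure T)
      = ∫ t in Ioo 0 T, ∫ x, (‖u t x‖ ^ 2 + 2 * p t x) * inner ℝ (u t x) (gradS (φ t) x) := by
    refine integral_congr_ae ?_
    filter_upwards [hu.val_eq, hu.coeFn_bernoulli_ae hp] with s hs hb
    rw [L2.inner_def]
    refine integral_congr_ae ?_
    filter_upwards [hb, coeFn_dotL ((SmoothFamily.gradS hφ).curve s) (V.val (U s))] with x h1 h2
    rw [h1, h2, hs]
    exact mul_comm _ _
  rw [e1, e2, e3, inner_mulL_self] at key
  exact key

lemma mulL_one {E : Type*} [NormedAddCommGroup E] [NormedSpace ℝ E]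
    (f : Lp E 2 (volume : Measure T3)) : mulL (1 : C(T3, ℝ)) f = f := by
  refine Lp.ext ?_
  filter_upwards [coeFn_mulL (1 : C(T3, ℝ)) f] with x hx
  rw [hx]
  exact one_smul ℝ (f x)

/-- The case `φ = 1` of the energy balance. -/
lemma globalEnergyEq (h : EnergyBalance ν T u₀ u U) : GlobalEnergyEq ν T u₀ u U := by
  intro t ht
  have hφ : SmoothFamily fun (_ : ℝ) (_ : T3) => (1 : ℝ) := contDiff_const
  have h1 : ∀ s, hφ.curve s = 1 := fun _ => rfl
  have h2 : ∀ s, hφ.timeDeriv.curve s = 0 := fun s => ContinuousMap.ext fun x => deriv_const s 1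
  have h3 : ∀ s, hφ.gradS.curve s = 0 := fun s => ContinuousMap.ext fun x => by
    ext j
    exact pderiv_const (1 : ℝ) j x
  have h4 : ∀ s, energyRate hφ s (U s) = 0 := fun s => by
    rw [energyRate, energyFlux, h2, h3, map_zero, map_zero, map_zero]
    simp
  have h5 : ∀ s, gradMul (hφ.smoothT s) (U s) = V.grad (U s) := fun s => by
    change mulL (hφ.curve s) (V.grad (U s)) + outerL (hφ.gradS.curve s) (V.val (U s)) = _
    rw [h1, h3, mulL_one, map_zero]
    exact add_zero _
  have key := h _ hφ t ht
  simp only [h1, h4, h5, mulL_one] at key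
  rw [intervalIntegral.integral_zero, interval_eq_timeMeasure ht.1] at key
  simp only [real_inner_self_eq_norm_sq] at key
  linarith

end EnergyEqualities

end TorusNS

end

open TorusNS

theorem theorem1 (ν T : ℝ) (hν : 0 < ν) (hT : 0 < T)
    (u₀ : L2Vec) (u : ℝ → L2Vec) (U : L2V T) (hu : IsLerayHopf ν T u₀ u U)
    (η : Vec → ℝ) (hη : IsKernel η)
    (δ : ℕ → ℝ) (hδ : ∀ n, 0 < δ n) (hδ0 : Tendsto δ atTop (𝓝 0))
    (b : L2Vec) (hb : b ≠ 0) :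
    (∀ n, ∃! v : L2V T, IsMinimizer T b (fun t => flux ν η (δ n) (u t)) v) ∧
    ∀ v : ℕ → L2V T, (∀ n, IsMinimizer T b (fun t => flux ν η (δ n) (u t)) (v n)) →
      (∃ (k : ℕ → ℕ) (v' : L2V T), StrictMono k ∧ WeakConv (v ∘ k) v') ∧
      ∀ (k : ℕ → ℕ) (v' : L2V T), StrictMono k → WeakConv (v ∘ k) v' → v' ≠ 0 →
        (∃! p, IsPressure T u p) ∧ (∀ p, IsPressure T u p → LocalEnergyEq ν T u₀ u U p) ∧
          GlobalEnergyEq ν T u₀ u U := by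
  have hw := hu.toIsWeakSolution
  have hmin := fun n => isMinimizer_iff hb (fluxT_ae hw hη (hδ n))
  refine ⟨fun n => ⟨_, (hmin n _).2 rfl, fun v hv => (hmin n v).1 hv⟩, fun v hv => ⟨?_, ?_⟩⟩
  · have hle : ∀ n, ‖v n‖ ≤ 2 * radius b := fun n => (norm_le_gradT (v n)).trans
      (mul_le_mul_of_nonneg_left (mem_enstrophyBall.1 (hv n).1) zero_le_two)
    exact exists_weakConv_subseq (X := L2V T) hle
  intro k v' hk hlim hv'
  have hδk : ∀ n, 0 < (δ ∘ k) n := fun n => hδ (k n)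
  have hδk0 : Tendsto (δ ∘ k) atTop (𝓝 0) := hδ0.comp hk.tendsto_atTop
  have hvk : v ∘ k = fun n => scaleFactor (radius b)
      ‖gradT T (potentialT T (fluxT hw hη (hδk n)))‖ • potentialT T (fluxT hw hη (hδk n)) :=
    funext fun n => (hmin (k n) (v (k n))).1 (hv (k n))
  rw [hvk] at hlim
  obtain ⟨R, hR⟩ := eventually_norm_potential_le hw hη hδk hδk0 (radius_pos hb) hv' hlim
  have key : EnergyBalance ν T u₀ u U := fun φ hφ t ht =>
    hw.local_energy hT hη hδk hδk0 hR hφ ht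
  exact ⟨hw.existsUnique_pressure, fun p hp => hw.localEnergyEq hT key hp, globalEnergyEq key⟩
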